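/- A (weighted) system $Az=b$ consists of $m$ linear equations in $n$ variables over $\mathbb{F}_2$, each with a positive integral weight. The excess of an assignment $z\in\mathbb{F}_2^n$ is the total weight of the equations it satisfies minus the total weight of those it falsifies. In \textsc{Max Lin AA} we are given a system and a parameter $k\in\mathbb{N}$ and must decide whether the maximum excess is at least $k$. Call a system irreducible if every equation contains at least one variable, no two equations have the same left-hand side, and $\operatorname{rank}A=n$. Programs run on a random access machine whose arithmetic operations are addition and cut-off subtraction of natural numbers. Let $p:\mathbb{N}\to\mathbb{R}$ be a fixed function with $p(n)=o(n)$, and consider the instances whose system is irreducible with $m\le 2^{p(n)}$. (a) On these instances \textsc{Max Lin AA} is (uniformly) fixed-parameter tractable: there are one program, a function $f:\mathbb{N}\to\mathbb{N}$ and a constant $c$ such that the program decides each such instance $(x,k)$ in time at most $f(k)\,|x|^{c}$, where $|x|$ is the number of bits of the instance and time is counted at logarithmic (bit) cost. (b) Moreover, there are one program, a function $g:\mathbb{N}\to\mathbb{N}$ and a constant $c$ such that, on each such instance, the program finds an assignment of excess at least $k$, or reports that there is none, in at most $g(k)\,(m+1)^{c}$ steps, each arithmetic operation on integers counting as one step.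 (c) If $p(n)=o(n)$ holds effectively, i.e. there is a computable $N:\mathbb{N}\to\mathbb{N}$ with $j\,|p(n)|\le n$ for all $j$ and all $n\ge N(j)$, then the functions $f$ in (a) and $g$ in (b) can be chosen computable. -/

import Mathlib

/-! ## A random access machine -/

namespace RAM

/-- Elementary instructions. Registers (written `R`) are addressed directly by the program, memory
cells (written `M`) only indirectly, through the contents of a register. The arithmetic is addition
and cut-off subtraction of natural numbers; there is no multiplication. -/
inductive Instr where
  /-- `R[d] := c` -/
  | const (d c : ℕ)
  /-- `R[d] := R[a] + R[b]` -/
  | add (d a b : ℕ)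
  /-- `R[d] := R[a] - R[b]`, or `0` if `R[a] < R[b]` -/
  | sub (d a b : ℕ)
  /-- `R[d] := M[R[a]]` -/
  | load (d a : ℕ)
  /-- `M[R[a]] := R[b]` -/
  | store (a b : ℕ)

/-- Programs: finite texts with structured control flow; the tests are `R[a] < R[b]`. -/
inductive Prog where
  | skip
  | instr (i : Instr)
  | seq (P Q : Prog)
  | ifLt (a b : ℕ) (P Q : Prog)
  | whileLt (a b : ℕ) (P : Prog)

/-- The contents of the registers and of the memory. -/
structure State where
  reg : ℕ → ℕ
  mem : ℕ → ℕ

/-- The effect of an elementary instruction. -/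
def Instr.run : Instr → State → State
  | const d c, s => { s with reg := Function.update s.reg d c }
  | add d a b, s => { s with reg := Function.update s.reg d (s.reg a + s.reg b) }
  | sub d a b, s => { s with reg := Function.update s.reg d (s.reg a - s.reg b) }
  | load d a, s => { s with reg := Function.update s.reg d (s.mem (s.reg a)) }
  | store a b, s => { s with mem := Function.update s.mem (s.reg a) (s.reg b) }

/-- The cost of an elementary instruction, when handling a number `v` costs `μ v` on top of the
unit cost of the instruction. -/
def Instr.cost (μ : ℕ → ℕ) : Instr → State → ℕ
  | const _ c, _ => 1 + μ c
  | add _ a b, s => 1 + μ (s.reg a) + μ (s.reg b)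
  | sub _ a b, s => 1 + μ (s.reg a) + μ (s.reg b)
  | load _ a, s => 1 + μ (s.reg a) + μ (s.mem (s.reg a))
  | store a b, s => 1 + μ (s.reg a) + μ (s.reg b)

/-- `Exec μ P s t s'`: started in the state `s`, the program `P` terminates in the state `s'` after
a computation of total cost `t`. -/
inductive Exec (μ : ℕ → ℕ) : Prog → State → ℕ → State → Prop
  | skip (s : State) : Exec μ .skip s 1 s
  | instr (i : Instr) (s : State) : Exec μ (.instr i) s (i.cost μ s) (i.run s)
  | seq {P Q : Prog} {s s' s'' : State} {t t' : ℕ}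
      (hP : Exec μ P s t s') (hQ : Exec μ Q s' t' s'') :
      Exec μ (.seq P Q) s (t + t') s''
  | ifLt_true {a b : ℕ} {P Q : Prog} {s s' : State} {t : ℕ}
      (h : s.reg a < s.reg b) (hP : Exec μ P s t s') :
      Exec μ (.ifLt a b P Q) s (1 + μ (s.reg a) + μ (s.reg b) + t) s'
  | ifLt_false {a b : ℕ} {P Q : Prog} {s s' : State} {t : ℕ}
      (h : ¬ s.reg a < s.reg b) (hQ : Exec μ Q s t s') :
      Exec μ (.ifLt a b P Q) s (1 + μ (s.reg a) + μ (s.reg b) + t) s'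
  | whileLt_true {a b : ℕ} {P : Prog} {s s' s'' : State} {t t' : ℕ}
      (h : s.reg a < s.reg b) (hP : Exec μ P s t s')
      (hW : Exec μ (.whileLt a b P) s' t' s'') :
      Exec μ (.whileLt a b P) s (1 + μ (s.reg a) + μ (s.reg b) + t + t') s''
  | whileLt_false {a b : ℕ} {P : Prog} {s : State} (h : ¬ s.reg a < s.reg b) :
      Exec μ (.whileLt a b P) s (1 + μ (s.reg a) + μ (s.reg b)) s

/-- Uniform cost: every elementary operation and every test costs one unit, so that the cost of a
computation is its number of steps. -/
def uniformCost : ℕ → ℕ := fun _ => 0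

/-- Logarithmic cost: operations and tests are charged for the binary lengths of the numbers and
memory addresses that they handle. Up to polynomials this is the time of a Turing machine. -/
def logCost : ℕ → ℕ := Nat.size

/-- The initial state on the instance `(x, k)`: `R[0] = k`, `R[1]` is the number of entries of `x`,
the entries of `x` are in `M[0], M[1], …`, and everything else is `0`. -/
def initState (x : List ℕ) (k : ℕ) : State where
  reg := fun i => if i = 0 then k else if i = 1 then x.length else 0
  mem := fun i => x.getD i 0

end RAM

/-! ## Fixed-parameter tractability -/

/-- The size of an instance that is written as a finite sequence of natural numbers: its length
when each number is written in binary and followed by a separator. -/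
def bitSize (x : List ℕ) : ℕ := (x.map fun a => Nat.size a + 1).sum

open Classical in
/-- On the class `D` of instances, membership in the parameterized problem `L` is decided in time
`f(k)·|x|^{O(1)}` by one program; the time is the logarithmic cost, and the answer (`1` for yes and
`0` for no) is left in `R[0]`. -/
def DecidableInFPTTime (D L : Set (List ℕ × ℕ)) (f : ℕ → ℕ) : Prop :=
  ∃ (P : RAM.Prog) (c : ℕ), ∀ (x : List ℕ) (k : ℕ), (x, k) ∈ D →
    ∃ (t : ℕ) (s : RAM.State), RAM.Exec RAM.logCost P (RAM.initState x k) t s ∧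
      t ≤ f k * bitSize x ^ c ∧ s.reg 0 = if (x, k) ∈ L then 1 else 0

/-- `L` is fixed-parameter tractable on the class `D`, with a computable `f`. -/
def IsFPTOn (D L : Set (List ℕ × ℕ)) : Prop :=
  ∃ f : ℕ → ℕ, Computable f ∧ DecidableInFPTTime D L f

/-- `L` is uniformly fixed-parameter tractable on the class `D`: a single program for all `k`, but
`f` is an arbitrary function. -/
def IsUniformlyFPTOn (D L : Set (List ℕ × ℕ)) : Prop :=
  ∃ f : ℕ → ℕ, DecidableInFPTTime D L f

/-! ## Max Lin Above Average -/

/-- A system `Az = b` of `m` linear equations in `n` variables over the field with two elements, in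
which each equation has a positive integral weight. -/
structure LinSystem (n m : ℕ) where
  A : Matrix (Fin m) (Fin n) (ZMod 2)
  b : Fin m → ZMod 2
  w : Fin m → ℕ
  w_pos : ∀ i, 0 < w i

namespace LinSystem

variable {n m : ℕ}

/-- Total weight of the satisfied equations minus total weight of the falsified ones. -/
def excess (S : LinSystem n m) (z : Fin n → ZMod 2) : ℤ :=
  ∑ i, if S.A.mulVec z i = S.b i then (S.w i : ℤ) else -(S.w i : ℤ)

/-- The maximum of the excess over all assignments. -/
def maxExcess (S : LinSystem n m) : ℤ :=
  Finset.univ.sup' Finset.univ_nonempty S.excess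

/-- Every equation has a variable in it, no two equations have the same left-hand side, and the
rank of `A` is the number of variables. -/
structure Irreducible (S : LinSystem n m) : Prop where
  row_ne_zero : ∀ i, S.A i ≠ 0
  row_injective : Function.Injective S.A
  rank_eq : S.A.rank = n

/-- The system as a sequence of numbers: `n`, `m`, and then, equation by equation, the `n`
coefficients, the right-hand side and the weight. -/
def encode (S : LinSystem n m) : List ℕ :=
  n :: m :: (List.finRange m).flatMap fun i =>
    (List.finRange n).map (fun j => (S.A i j).val) ++ [(S.b i).val, S.w i]

end LinSystem

/-- Max Lin AA: is the maximum excess of the system at least the parameter `k`? -/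
def MaxLinAA : Set (List ℕ × ℕ) :=
  {y | ∃ (n m : ℕ) (S : LinSystem n m), y.1 = S.encode ∧ (y.2 : ℤ) ≤ S.maxExcess}

/-- The instances whose system is irreducible with `m ≤ 2 ^ p(n)`. -/
def SparseInstances (p : ℕ → ℝ) : Set (List ℕ × ℕ) :=
  {y | ∃ (n m : ℕ) (S : LinSystem n m), y.1 = S.encode ∧ S.Irreducible ∧
    (m : ℝ) ≤ (2 : ℝ) ^ p n}

/-- For irreducible systems with `m ≤ 2 ^ p(n)`, one program finds, in `g(k)·(m+1)^{O(1)}` steps, an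
assignment of excess at least `k`, or reports that there is none. It leaves `1` in `R[0]` and the
values of the variables in `M[0], …, M[n-1]` in the first case, and `0` in `R[0]` in the second. -/
def SolutionFoundInTime (p : ℕ → ℝ) (g : ℕ → ℕ) : Prop :=
  ∃ (P : RAM.Prog) (c : ℕ), ∀ (n m : ℕ) (S : LinSystem n m) (k : ℕ),
    S.Irreducible → (m : ℝ) ≤ (2 : ℝ) ^ p n →
    ∃ (t : ℕ) (s : RAM.State), RAM.Exec RAM.uniformCost P (RAM.initState S.encode k) t s ∧
      t ≤ g k * (m + 1) ^ c ∧
      ((s.reg 0 = 1 ∧ ∃ z : Fin n → ZMod 2, (k : ℤ) ≤ S.excess z ∧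
          ∀ j : Fin n, s.mem j = (z j).val) ∨
        (s.reg 0 = 0 ∧ S.maxExcess < (k : ℤ)))

/-- `p(n) = o(n)` effectively: some computable `N` has `|p(n)| ≤ n / j` for all `n ≥ N(j)`. -/
def EffectivelySublinear (p : ℕ → ℝ) : Prop :=
  ∃ N : ℕ → ℕ, Computable N ∧ ∀ j n : ℕ, N j ≤ n → (j : ℝ) * |p n| ≤ n

/-! ## A language of bounded loops -/

namespace LoopLang

/-! Suppose first that `m < 2 ^ l` and `l * k < n` for some `l`. Then an irreducible system has an
assignment of excess at least `k`, found in polynomial time. Call `k` rows sum-free if they are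
linearly independent and no sum of two or more of them is a row of the system. Eliminate with such
rows one after the other. When the turn of a row comes, it is nonzero modulo its predecessors and no
other row has become equal to it, so a suitable right-hand side secures its whole weight, at least 1
(`Clears.zeroValue_lt`, `Progress.process_sumFree`). Elimination with the remaining rows, always
siding with the weighted majority among equal rows, loses nothing (`Clears.zeroValue_le`). In the
end all rows are zero and the right-hand sides tell which equations hold; `n` unit rows carried
along without counting reveal the assignment (`Progress.exists_assignment`).

Sum-free rows are collected greedily in passes. A pass works modulo a subspace `W`: a row is
accepted if it is nonzero modulo `W` and the rows accepted so far, and if every row equal to it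
there is already equal to it modulo `W` (`Pass.accept`). If a pass ends with fewer than `k` rows,
each remaining nonzero class of rows merges at least two nonzero classes modulo `W`. So the number
of nonzero classes is at least halved (`Pass.two_mul_numNonzero_le`), while the dimension of `W`
grows by at most `k`. After `l` failures no nonzero class would be left, and the rows would span a
space of dimension at most `l * k < n`, against full rank (`lt_of_reduces`).

If there is no such `l`, then `m ≤ 2 ^ p(n)` with `p(n) = o(n)` bounds `n` in terms of `k` alone
(`exists_lt_two_pow_of_sublinear`), and all `2 ^ n` assignments can be tried (`exhaust_spec`). The
program knows neither `p` nor `l`: it runs the polynomial part, tests its result, and falls back on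
exhaustive search if the test fails. The function `p` enters only the time analysis, through
thresholds `N(j)` for `j * |p n| ≤ n`; the time bounds are computable as soon as `N` is.

The algorithm is written in a language of loops whose numbers of rounds are fixed on entry, and
compiled to the machine with a proof of simulation and a polynomial step count (`Stmt.exec_compile`,
`Stmt.exists_time_le`). Since a step lengthens numbers by at most one digit, the step count also
controls the logarithmic cost (`exec_logCost`). -/

/-- Expressions over variables, arrays and the input. -/
inductive Expr where
  | var (v : ℕ)
  | const (c : ℕ)
  | add (e f : Expr)
  | sub (e f : Expr)
  /-- The entry of the array `a` with index `e`. -/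
  | read (a : ℕ) (e : Expr)
  /-- The entry of the input with index `e`, or `0` beyond the end of the input. -/
  | input (e : Expr)

/-- Statements. In `loop v b st P`, the number of rounds is the value of the variable `b` at the
beginning; in round `i`, the variable `v` is set to `i` times the initial value of `st`. -/
inductive Stmt where
  | skip
  | assign (v : ℕ) (e : Expr)
  | write (a : ℕ) (i e : Expr)
  /-- Overwrite an entry of the input. -/
  | output (i e : Expr)
  | seq (P Q : Stmt)
  | ifLt (e f : Expr) (P Q : Stmt)
  | loop (v b : ℕ) (st : Expr) (P : Stmt)

/-- The values of the variables and arrays; `io` is the input, of length `len`, as overwritten by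
the output. -/
structure Store where
  var : ℕ → ℕ
  arr : ℕ → ℕ → ℕ
  io : ℕ → ℕ
  len : ℕ

namespace Store

/-- Assignment to a variable. -/
def setVar (s : Store) (v x : ℕ) : Store := { s with var := Function.update s.var v x }

/-- Assignment to an array entry. -/
def setArr (s : Store) (a i x : ℕ) : Store :=
  { s with arr := Function.update s.arr a (Function.update (s.arr a) i x) }

/-- Assignment to an output entry. -/
def setCell (s : Store) (i x : ℕ) : Store :=
  if i < s.len then { s with io := Function.update s.io i x } else s

@[simp] lemma var_setVar (s : Store) (v x u : ℕ) :
    (s.setVar v x).var u = if u = v then x else s.var u := by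
  simp [setVar, Function.update_apply]
@[simp] lemma arr_setVar (s : Store) (v x : ℕ) : (s.setVar v x).arr = s.arr := rfl
@[simp] lemma io_setVar (s : Store) (v x : ℕ) : (s.setVar v x).io = s.io := rfl
@[simp] lemma len_setVar (s : Store) (v x : ℕ) : (s.setVar v x).len = s.len := rfl
@[simp] lemma var_setArr (s : Store) (a i x : ℕ) : (s.setArr a i x).var = s.var := rfl
@[simp] lemma arr_setArr (s : Store) (a i x b : ℕ) : (s.setArr a i x).arr b =
    if b = a then Function.update (s.arr a) i x else s.arr b := by
  simp [setArr, Function.update_apply]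
@[simp] lemma io_setArr (s : Store) (a i x : ℕ) : (s.setArr a i x).io = s.io := rfl
@[simp] lemma len_setArr (s : Store) (a i x : ℕ) : (s.setArr a i x).len = s.len := rfl
@[simp] lemma var_setCell (s : Store) (i x : ℕ) : (s.setCell i x).var = s.var := by
  unfold setCell; split_ifs <;> rfl
@[simp] lemma arr_setCell (s : Store) (i x : ℕ) : (s.setCell i x).arr = s.arr := by
  unfold setCell; split_ifs <;> rfl
@[simp] lemma len_setCell (s : Store) (i x : ℕ) : (s.setCell i x).len = s.len := by
  unfold setCell; split_ifs <;> rfl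
lemma io_setCell (s : Store) (i x : ℕ) : (s.setCell i x).io =
    if i < s.len then Function.update s.io i x else s.io := by
  unfold setCell; split_ifs <;> rfl

end Store

/-- The value of an expression. -/
def Expr.eval (s : Store) : Expr → ℕ
  | var v => s.var v
  | const c => c
  | add e f => e.eval s + f.eval s
  | sub e f => e.eval s - f.eval s
  | read a e => s.arr a (e.eval s)
  | input e => if e.eval s < s.len then s.io (e.eval s) else 0

/-- `rounds F v c i s`: the store after `i` rounds of a loop with body `F`, in which the variable
`v` takes the values `0, c, 2 * c, …`. -/
def rounds (F : Store → Store) (v c : ℕ) : ℕ → Store → Store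
  | 0, s => s
  | i + 1, s => F ((rounds F v c i s).setVar v (i * c))

/-- The effect of a statement. -/
def Stmt.run : Stmt → Store → Store
  | skip, s => s
  | assign v e, s => s.setVar v (e.eval s)
  | write a i e, s => s.setArr a (i.eval s) (e.eval s)
  | output i e, s => s.setCell (i.eval s) (e.eval s)
  | seq P Q, s => Q.run (P.run s)
  | ifLt e f P Q, s => if e.eval s < f.eval s then P.run s else Q.run s
  | loop v b st P, s => rounds P.run v (st.eval s) (s.var b) s

/-- The variables that a statement may change. -/
def Stmt.writtenVars : Stmt → List ℕ
  | assign v _ => [v]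
  | seq P Q => P.writtenVars ++ Q.writtenVars
  | ifLt _ _ P Q => P.writtenVars ++ Q.writtenVars
  | loop v _ _ P => v :: P.writtenVars
  | _ => []

/-- The arrays that a statement may change. -/
def Stmt.writtenArrs : Stmt → List ℕ
  | write a _ _ => [a]
  | seq P Q => P.writtenArrs ++ Q.writtenArrs
  | ifLt _ _ P Q => P.writtenArrs ++ Q.writtenArrs
  | loop _ _ _ P => P.writtenArrs
  | _ => []

/-- Whether a statement has output. -/
def Stmt.hasOutput : Stmt → Bool
  | output _ _ => true
  | seq P Q => P.hasOutput || Q.hasOutput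
  | ifLt _ _ P Q => P.hasOutput || Q.hasOutput
  | loop _ _ _ P => P.hasOutput
  | _ => false

/-- The store `t` differs from `s` only in what `P` may change. -/
structure Frame (P : Stmt) (s t : Store) : Prop where
  var : ∀ u, u ∉ P.writtenVars → t.var u = s.var u
  arr : ∀ a, a ∉ P.writtenArrs → t.arr a = s.arr a
  io : P.hasOutput = false → t.io = s.io
  len : t.len = s.len

/-- Stated for every intermediate round, not only the last, because the invariant rule `loop_induct`
offers this information at the start of each round. -/
lemma frame_rounds {P : Stmt} (hP : ∀ s, Frame P s (P.run s)) {v b : ℕ} {st : Expr} (c i : ℕ)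
    (s : Store) : Frame (.loop v b st P) s (rounds P.run v c i s) := by
  induction i with
  | zero => exact ⟨fun _ _ => rfl, fun _ _ => rfl, fun _ => rfl, rfl⟩
  | succ i ih =>
    have h := hP ((rounds P.run v c i s).setVar v (i * c))
    refine ⟨fun u hu => ?_, fun a ha => ?_, fun ho => ?_, ?_⟩
    · have hu' := hu
      simp only [Stmt.writtenVars, List.mem_cons, not_or] at hu'
      rw [rounds, h.var u hu'.2, Store.var_setVar, if_neg hu'.1, ih.var u hu]
    · rw [rounds, h.arr a ha, Store.arr_setVar, ih.arr a ha]
    · rw [rounds, h.io ho, Store.io_setVar, ih.io ho]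
    · rw [rounds, h.len, Store.len_setVar, ih.len]

/-- Because the written variables and arrays are computed syntactically, later specifications need
to describe only what changes; the rest follows from this with a membership test, mostly by
`decide`. -/
theorem Stmt.frame (P : Stmt) : ∀ s, Frame P s (P.run s) := by
  induction P with
  | skip => intro s; exact ⟨fun _ _ => rfl, fun _ _ => rfl, fun _ => rfl, rfl⟩
  | assign v e =>
    intro s
    refine ⟨fun u hu => ?_, fun _ _ => rfl, fun _ => rfl, rfl⟩
    have : u ≠ v := by simpa [writtenVars] using hu
    simp [run, this]
  | write a i e =>
    intro s
    refine ⟨fun _ _ => rfl, fun b hb => ?_, fun _ => rfl, rfl⟩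
    have : b ≠ a := by simpa [writtenArrs] using hb
    simp [run, this]
  | output i e =>
    intro s
    exact ⟨fun _ _ => by simp [run], fun _ _ => by simp [run], by simp [hasOutput], by simp [run]⟩
  | seq P Q hP hQ =>
    intro s
    have h₁ := hP s
    have h₂ := hQ (P.run s)
    refine ⟨fun u hu => ?_, fun a ha => ?_, fun ho => ?_, h₂.len.trans h₁.len⟩
    · simp only [writtenVars, List.mem_append, not_or] at hu
      exact (h₂.var u hu.2).trans (h₁.var u hu.1)
    · simp only [writtenArrs, List.mem_append, not_or] at ha
      exact (h₂.arr a ha.2).trans (h₁.arr a ha.1)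
    · simp only [hasOutput, Bool.or_eq_false_iff] at ho
      exact (h₂.io ho.2).trans (h₁.io ho.1)
  | ifLt e f P Q hP hQ =>
    intro s
    have h₁ := hP s
    have h₂ := hQ s
    simp only [run]
    split_ifs
    · refine ⟨fun u hu => ?_, fun a ha => ?_, fun ho => ?_, h₁.len⟩
      · simp only [writtenVars, List.mem_append, not_or] at hu
        exact h₁.var u hu.1
      · simp only [writtenArrs, List.mem_append, not_or] at ha
        exact h₁.arr a ha.1
      · simp only [hasOutput, Bool.or_eq_false_iff] at ho
        exact h₁.io ho.1
    · refine ⟨fun u hu => ?_, fun a ha => ?_, fun ho => ?_, h₂.len⟩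
      · simp only [writtenVars, List.mem_append, not_or] at hu
        exact h₂.var u hu.2
      · simp only [writtenArrs, List.mem_append, not_or] at ha
        exact h₂.arr a ha.2
      · simp only [hasOutput, Bool.or_eq_false_iff] at ho
        exact h₂.io ho.2
  | loop v b st P hP => exact fun s => frame_rounds hP _ _ s

/-- The invariant rule for loops. -/
theorem Stmt.loop_induct {v b : ℕ} {st : Expr} {P : Stmt} (s : Store) (I : ℕ → Store → Prop)
    (h0 : I 0 s)
    (hstep : ∀ i t, i < s.var b → Frame (loop v b st P) s t → I i t →
      I (i + 1) (P.run (t.setVar v (i * st.eval s)))) :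
    I (s.var b) ((loop v b st P).run s) := by
  have key : ∀ i, i ≤ s.var b → I i (rounds P.run v (st.eval s) i s) := by
    intro i
    induction i with
    | zero => exact fun _ => h0
    | succ i ih => exact fun hi => hstep i _ hi (frame_rounds P.frame _ _ s) (ih (by omega))
  exact key _ le_rfl

/-! ### Compilation -/

open RAM

/-- The registers of the compiled program that hold intermediate results; the variable `v` is kept
in the register `2 * v`, and the register `1` holds the length of the input. -/
def tmp (d : ℕ) : ℕ := 2 * d + 3

@[simp] lemma tmp_inj {d e : ℕ} : tmp d = tmp e ↔ d = e := by unfold tmp; omega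
@[simp] lemma one_ne_tmp (d : ℕ) : (1 : ℕ) ≠ tmp d := by unfold tmp; omega

/-- `a`-fold doubling of a register. -/
def double (r : ℕ) : ℕ → Prog
  | 0 => .skip
  | a + 1 => .seq (double r a) (.instr (.add r r r))

/-- The address at which the entry `x` of the array `a` is kept, for inputs of length `l`. -/
def address (l a x : ℕ) : ℕ := 2 ^ a * (2 * x + 1) + l

/-- Replace the index in `tmp d` by the address in the array `a`. -/
def compileAddress (a d : ℕ) : Prog :=
  .seq (.instr (.add (tmp d) (tmp d) (tmp d)))
  (.seq (.instr (.const (tmp (d + 1)) 1))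
  (.seq (.instr (.add (tmp d) (tmp d) (tmp (d + 1))))
  (.seq (double (tmp d) a) (.instr (.add (tmp d) (tmp d) 1)))))

/-- Put the value of an expression into `tmp d`. -/
def Expr.compile (d : ℕ) : Expr → Prog
  | var v => .seq (.instr (.const (tmp d) 0)) (.instr (.add (tmp d) (2 * v) (tmp d)))
  | const c => .instr (.const (tmp d) c)
  | add e f => .seq (e.compile d) (.seq (f.compile (d + 1))
      (.instr (.add (tmp d) (tmp d) (tmp (d + 1)))))
  | sub e f => .seq (e.compile d) (.seq (f.compile (d + 1))
      (.instr (.sub (tmp d) (tmp d) (tmp (d + 1)))))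
  | read a e => .seq (e.compile d) (.seq (compileAddress a d) (.instr (.load (tmp d) (tmp d))))
  | input e => .seq (e.compile d)
      (.ifLt (tmp d) 1 (.instr (.load (tmp d) (tmp d))) (.instr (.const (tmp d) 0)))

/-- The number of steps in which an expression is evaluated. -/
def Expr.time : Expr → ℕ
  | var _ => 2
  | const _ => 1
  | add e f => e.time + (f.time + 1)
  | sub e f => e.time + (f.time + 1)
  | read a e => e.time + ((a + 5) + 1)
  | input e => e.time + (1 + 1)

/-- The program for a statement, with intermediate results in `tmp d, tmp (d + 1), …`. -/
def Stmt.compile (d : ℕ) : Stmt → Prog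
  | skip => .skip
  | assign v e => .seq (e.compile d) (.seq (.instr (.const (tmp (d + 1)) 0))
      (.instr (.add (2 * v) (tmp d) (tmp (d + 1)))))
  | write a i e => .seq (i.compile d) (.seq (compileAddress a d)
      (.seq (e.compile (d + 1)) (.instr (.store (tmp d) (tmp (d + 1))))))
  | output i e => .seq (i.compile d) (.seq (e.compile (d + 1))
      (.ifLt (tmp d) 1 (.instr (.store (tmp d) (tmp (d + 1)))) .skip))
  | seq P Q => .seq (P.compile d) (Q.compile d)
  | ifLt e f P Q => .seq (e.compile d) (.seq (f.compile (d + 1))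
      (.ifLt (tmp d) (tmp (d + 1)) (P.compile d) (Q.compile d)))
  | loop v b st P => .seq (st.compile (d + 2)) (.seq (.instr (.const (tmp d) 0))
      (.seq (.instr (.const (tmp (d + 3)) 0)) (.seq (.instr (.const (tmp (d + 4)) 1))
      (.seq (.instr (.add (tmp (d + 1)) (2 * b) (tmp d)))
      (.whileLt (tmp d) (tmp (d + 1))
        (.seq (.instr (.const (tmp (d + 5)) 0))
        (.seq (.instr (.add (2 * v) (tmp (d + 3)) (tmp (d + 5))))
        (.seq (P.compile (d + 5))
        (.seq (.instr (.add (tmp (d + 3)) (tmp (d + 3)) (tmp (d + 2))))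
        (.instr (.add (tmp d) (tmp d) (tmp (d + 4)))))))))))))

/-- A bound for the number of steps if no loop has more than `N` rounds. -/
def Stmt.time (N : ℕ) : Stmt → ℕ
  | skip => 1
  | assign _ e => e.time + 2
  | write a i e => i.time + ((a + 5) + (e.time + 1))
  | output i e => i.time + (e.time + 2)
  | seq P Q => P.time N + Q.time N
  | ifLt e f P Q => e.time + (f.time + (1 + (P.time N + Q.time N)))
  | loop _ _ st P => st.time + (4 + (N * (P.time N + 5) + 1))

/-- The variables below `p` are not changed, and only they bound loops. -/
def Stmt.Protects (p : ℕ) : Stmt → Prop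
  | assign v _ => p ≤ v
  | seq P Q => P.Protects p ∧ Q.Protects p
  | ifLt _ _ P Q => P.Protects p ∧ Q.Protects p
  | loop v b _ P => p ≤ v ∧ b < p ∧ P.Protects p
  | _ => True

/-- The machine state `σ` represents the store `s`. -/
structure Represents (σ : State) (s : Store) : Prop where
  var : ∀ v, σ.reg (2 * v) = s.var v
  len : σ.reg 1 = s.len
  io : ∀ x, x < s.len → σ.mem x = s.io x
  arr : ∀ a x, σ.mem (address s.len a x) = s.arr a x

/-- Unique factorisation into a power of two and an odd number lets unboundedly many infinite arrays
share one memory without overlap. -/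
lemma two_pow_mul_odd_inj {a b x y : ℕ} (h : 2 ^ a * (2 * x + 1) = 2 ^ b * (2 * y + 1)) :
    a = b ∧ x = y := by
  induction a generalizing b with
  | zero =>
    cases b with
    | zero => simpa using h
    | succ b =>
      rw [pow_succ, mul_right_comm, pow_zero] at h
      omega
  | succ a ih =>
    cases b with
    | zero =>
      rw [pow_succ, mul_right_comm, pow_zero] at h
      omega
    | succ b =>
      rw [pow_succ, pow_succ, mul_right_comm, mul_right_comm (2 ^ b)] at h
      obtain ⟨h₁, h₂⟩ := ih (Nat.eq_of_mul_eq_mul_right two_pos h)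
      exact ⟨by rw [h₁], h₂⟩

lemma address_inj {l a b x y : ℕ} : address l a x = address l b y ↔ a = b ∧ x = y := by
  constructor
  · intro h
    exact two_pow_mul_odd_inj (Nat.add_right_cancel h)
  · rintro ⟨rfl, rfl⟩
    rfl

/-- Keeps arrays clear of the input, which occupies the cells below `l`. -/
lemma lt_address (l a x : ℕ) : l < address l a x := by
  have : 0 < 2 ^ a * (2 * x + 1) := by positivity
  unfold address
  omega

/-! ### Scratch registers and the simulation of expressions and statements -/

/-- Agreement in the memory and in all registers but `tmp d, tmp (d + 1), …`. -/
structure Agree (d : ℕ) (σ τ : State) : Prop where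
  mem : τ.mem = σ.mem
  reg : ∀ r, (r % 2 = 0 ∨ r < tmp d) → τ.reg r = σ.reg r

/-- Variables sit in even registers and the input length in register 1, whereas scratch registers
are odd and at least 3, so scratch work never touches the represented store. -/
lemma Agree.represents {d : ℕ} {σ τ : State} {s : Store} (h : Agree d σ τ)
    (hs : Represents σ s) : Represents τ s where
  var v := by rw [h.reg _ (by omega), hs.var]
  len := by rw [h.reg _ (by right; simp only [tmp]; omega), hs.len]
  io x hx := by rw [h.mem, hs.io x hx]
  arr a x := by rw [h.mem, hs.arr a x]

lemma Agree.trans {d : ℕ} {σ τ υ : State} (h₁ : Agree d σ τ) (h₂ : Agree d τ υ) : Agree d σ υ :=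
  ⟨h₂.mem.trans h₁.mem, fun r hr => (h₂.reg r hr).trans (h₁.reg r hr)⟩

lemma Agree.mono {d d' : ℕ} {σ τ : State} (hd : d' ≤ d) (h : Agree d σ τ) : Agree d' σ τ :=
  ⟨h.mem, fun r hr => h.reg r (by simp only [tmp] at *; omega)⟩

/-- Assignment to a register. -/
def setReg (σ : State) (r x : ℕ) : State := { σ with reg := Function.update σ.reg r x }

@[simp] lemma reg_setReg (σ : State) (r x q : ℕ) :
    (setReg σ r x).reg q = if q = r then x else σ.reg q := by
  simp [setReg, Function.update_apply]

@[simp] lemma mem_setReg (σ : State) (r x : ℕ) : (setReg σ r x).mem = σ.mem := rfl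

lemma setReg_setReg (σ : State) (r x y : ℕ) : setReg (setReg σ r x) r y = setReg σ r y := by
  simp [setReg]

/-- Assignment to a memory cell. -/
def setMem (σ : State) (i x : ℕ) : State := { σ with mem := Function.update σ.mem i x }

@[simp] lemma mem_setMem (σ : State) (i x j : ℕ) :
    (setMem σ i x).mem j = if j = i then x else σ.mem j := by
  simp [setMem, Function.update_apply]

@[simp] lemma reg_setMem (σ : State) (i x : ℕ) : (setMem σ i x).reg = σ.reg := rfl

lemma Agree.refl (d : ℕ) (σ : State) : Agree d σ σ := ⟨rfl, fun _ _ => rfl⟩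

lemma Agree.setReg {d e : ℕ} {σ τ : State} (h : Agree d σ τ) (x : ℕ) (he : d ≤ e) :
    Agree d σ (setReg τ (tmp e) x) := by
  refine ⟨h.mem, fun r hr => ?_⟩
  have : r ≠ tmp e := by simp only [tmp] at *; omega
  simp [this, h.reg r hr]

/-- Execution at uniform cost. -/
abbrev UExec := Exec uniformCost

lemma exec_const (σ : State) (r c : ℕ) : UExec (.instr (.const r c)) σ 1 (setReg σ r c) :=
  Exec.instr _ σ

lemma exec_add (σ : State) (r a b : ℕ) :
    UExec (.instr (.add r a b)) σ 1 (setReg σ r (σ.reg a + σ.reg b)) :=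
  Exec.instr _ σ

lemma exec_sub (σ : State) (r a b : ℕ) :
    UExec (.instr (.sub r a b)) σ 1 (setReg σ r (σ.reg a - σ.reg b)) :=
  Exec.instr _ σ

lemma exec_load (σ : State) (r a : ℕ) :
    UExec (.instr (.load r a)) σ 1 (setReg σ r (σ.mem (σ.reg a))) :=
  Exec.instr _ σ

lemma exec_store (σ : State) (a b : ℕ) :
    UExec (.instr (.store a b)) σ 1 (setMem σ (σ.reg a) (σ.reg b)) :=
  Exec.instr _ σ

lemma exec_ifLt_true {a b t : ℕ} {P Q : Prog} {σ τ : State} (h : σ.reg a < σ.reg b)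
    (hP : UExec P σ t τ) : UExec (.ifLt a b P Q) σ (1 + t) τ :=
  Exec.ifLt_true h hP

lemma exec_ifLt_false {a b t : ℕ} {P Q : Prog} {σ τ : State} (h : ¬ σ.reg a < σ.reg b)
    (hQ : UExec Q σ t τ) : UExec (.ifLt a b P Q) σ (1 + t) τ :=
  Exec.ifLt_false h hQ

lemma exec_whileLt_true {a b t t' : ℕ} {P : Prog} {σ τ υ : State} (h : σ.reg a < σ.reg b)
    (hP : UExec P σ t τ) (hW : UExec (.whileLt a b P) τ t' υ) :
    UExec (.whileLt a b P) σ (1 + t + t') υ :=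
  Exec.whileLt_true h hP hW

lemma exec_whileLt_false {a b : ℕ} {P : Prog} {σ : State} (h : ¬ σ.reg a < σ.reg b) :
    UExec (.whileLt a b P) σ 1 σ :=
  Exec.whileLt_false h

/-- The machine cannot multiply, but `a` is fixed by the program text, so the factor `2 ^ a` costs a
constant number of additions. -/
lemma exec_double (r a : ℕ) (σ : State) :
    UExec (double r a) σ (a + 1) (setReg σ r (2 ^ a * σ.reg r)) := by
  induction a with
  | zero =>
    have : setReg σ r (2 ^ 0 * σ.reg r) = σ := by simp [setReg]
    rw [this]
    exact Exec.skip σ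
  | succ a ih =>
    have h := ih.seq (exec_add _ r r r)
    rw [setReg_setReg, reg_setReg, if_pos rfl, ← mul_two, mul_right_comm, ← pow_succ] at h
    exact h

lemma exec_compileAddress (a d : ℕ) (σ : State) : ∃ τ, UExec (compileAddress a d) σ (a + 5) τ ∧
    Agree d σ τ ∧ τ.reg (tmp d) = address (σ.reg 1) a (σ.reg (tmp d)) := by
  have h := (exec_add σ (tmp d) (tmp d) (tmp d)).seq ((exec_const _ (tmp (d + 1)) 1).seq
    ((exec_add _ (tmp d) (tmp d) (tmp (d + 1))).seq
    ((exec_double (tmp d) a _).seq (exec_add _ (tmp d) (tmp d) 1))))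
  have ht : a + 5 = 1 + (1 + (1 + (a + 1 + 1))) := by omega
  rw [ht]
  refine ⟨_, h, ?_, ?_⟩
  · exact ((((((Agree.refl d σ).setReg _ le_rfl).setReg _ (by omega)).setReg _ le_rfl).setReg _
      le_rfl).setReg _ le_rfl)
  · simp [address, two_mul]

/-- The second operand is evaluated with scratch space from `d + 1` on, so the first one survives in
`tmp d`. The step count is exact and depends on the expression only. -/
lemma Expr.exec_compile (e : Expr) : ∀ (d : ℕ) (σ : State) (s : Store), Represents σ s →
    ∃ τ, UExec (e.compile d) σ e.time τ ∧ Agree d σ τ ∧ τ.reg (tmp d) = e.eval s := by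
  induction e with
  | var v =>
    intro d σ s hs
    refine ⟨_, (exec_const σ (tmp d) 0).seq (exec_add _ (tmp d) (2 * v) (tmp d)), ?_, ?_⟩
    · exact ((Agree.refl d σ).setReg _ le_rfl).setReg _ le_rfl
    · have : 2 * v ≠ tmp d := by simp only [tmp]; omega
      simp [this, hs.var, eval]
  | const c =>
    intro d σ s hs
    exact ⟨_, exec_const σ (tmp d) c, (Agree.refl d σ).setReg _ le_rfl, by simp [eval]⟩
  | add e f he hf =>
    intro d σ s hs
    obtain ⟨τ, h₁, a₁, v₁⟩ := he d σ s hs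
    obtain ⟨υ, h₂, a₂, v₂⟩ := hf (d + 1) τ s (a₁.represents hs)
    refine ⟨_, h₁.seq (h₂.seq (exec_add υ _ _ _)),
      (a₁.trans (a₂.mono (by omega))).setReg _ le_rfl, ?_⟩
    rw [reg_setReg, if_pos rfl, v₂, a₂.reg _ (by simp only [tmp]; omega), v₁, eval]
  | sub e f he hf =>
    intro d σ s hs
    obtain ⟨τ, h₁, a₁, v₁⟩ := he d σ s hs
    obtain ⟨υ, h₂, a₂, v₂⟩ := hf (d + 1) τ s (a₁.represents hs)
    refine ⟨_, h₁.seq (h₂.seq (exec_sub υ _ _ _)),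
      (a₁.trans (a₂.mono (by omega))).setReg _ le_rfl, ?_⟩
    rw [reg_setReg, if_pos rfl, v₂, a₂.reg _ (by simp only [tmp]; omega), v₁, eval]
  | read a e he =>
    intro d σ s hs
    obtain ⟨τ, h₁, a₁, v₁⟩ := he d σ s hs
    obtain ⟨υ, h₂, a₂, v₂⟩ := exec_compileAddress a d τ
    refine ⟨_, h₁.seq (h₂.seq (exec_load υ _ _)), (a₁.trans a₂).setReg _ le_rfl, ?_⟩
    rw [reg_setReg, if_pos rfl, v₂, (a₁.trans a₂).mem, v₁, (a₁.represents hs).len, hs.arr, eval]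
  | input e he =>
    intro d σ s hs
    obtain ⟨τ, h₁, a₁, v₁⟩ := he d σ s hs
    by_cases h : e.eval s < s.len
    · refine ⟨_, h₁.seq (exec_ifLt_true ?_ (exec_load τ _ _)), a₁.setReg _ le_rfl, ?_⟩
      · rwa [v₁, (a₁.represents hs).len]
      · rw [reg_setReg, if_pos rfl, v₁, a₁.mem, hs.io _ h, eval, if_pos h]
    · refine ⟨_, h₁.seq (exec_ifLt_false ?_ (exec_const τ _ _)), a₁.setReg _ le_rfl, ?_⟩
      · rwa [v₁, (a₁.represents hs).len]
      · rw [reg_setReg, if_pos rfl, eval, if_neg h]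

lemma Stmt.Protects.notMem {p : ℕ} {P : Stmt} (hP : P.Protects p) {u : ℕ} (hu : u < p) :
    u ∉ P.writtenVars := by
  induction P with
  | skip | write | output => simp [writtenVars]
  | assign v e =>
    simp only [Protects] at hP
    simp only [writtenVars, List.mem_singleton]
    omega
  | seq P Q iP iQ | ifLt e f P Q iP iQ =>
    simp only [writtenVars, List.mem_append, not_or]
    exact ⟨iP hP.1, iQ hP.2⟩
  | loop v b st P ih =>
    have := hP.1
    simp only [writtenVars, List.mem_cons, not_or]
    exact ⟨by omega, ih hP.2.2⟩

lemma Stmt.Protects.run_var {p : ℕ} {P : Stmt} (hP : P.Protects p) (s : Store) {u : ℕ}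
    (hu : u < p) : (P.run s).var u = s.var u :=
  (P.frame s).var u (hP.notMem hu)

lemma Represents.setVar {σ : State} {s : Store} (h : Represents σ s) (v x : ℕ) :
    Represents (setReg σ (2 * v) x) (s.setVar v x) where
  var u := by
    have : 2 * u = 2 * v ↔ u = v := by omega
    simp [this, h.var]
  len := by
    have : 1 ≠ 2 * v := by omega
    simp [this, h.len]
  io y hy := h.io y hy
  arr a y := h.arr a y

lemma Represents.setArr {σ : State} {s : Store} (h : Represents σ s) (a i x : ℕ) :
    Represents (setMem σ (address s.len a i) x) (s.setArr a i x) where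
  var u := h.var u
  len := h.len
  io y hy := by
    have h₁ := lt_address s.len a i
    have : y ≠ address s.len a i := by
      simp only [Store.len_setArr] at hy
      omega
    simpa [this] using h.io y hy
  arr b y := by
    simp only [mem_setMem, Store.len_setArr, address_inj, Store.arr_setArr]
    by_cases hb : b = a
    · subst hb
      simp [h.arr, Function.update_apply]
    · simp [hb, h.arr]

lemma Represents.setCell {σ : State} {s : Store} (h : Represents σ s) {i : ℕ} (x : ℕ)
    (hi : i < s.len) : Represents (setMem σ i x) (s.setCell i x) where
  var u := by simpa using h.var u
  len := by simpa using h.len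
  io y hy := by
    simp only [Store.len_setCell] at hy
    simp [Store.io_setCell, hi, Function.update_apply, h.io y hy]
  arr b y := by
    have h₁ := lt_address s.len b y
    have : address s.len b y ≠ i := by omega
    simp [this, h.arr]

/-- The compiled program simulates the statement. -/
theorem Stmt.exec_compile {p N : ℕ} (P : Stmt) : P.Protects p → ∀ (d : ℕ) (σ : State) (s : Store),
    Represents σ s → (∀ v < p, s.var v ≤ N) →
    ∃ t τ, UExec (P.compile d) σ t τ ∧ t ≤ P.time N ∧ Represents τ (P.run s) ∧
      ∀ e < d, τ.reg (tmp e) = σ.reg (tmp e) := by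
  induction P with
  | skip => exact fun _ d σ s hs _ => ⟨_, _, Exec.skip σ, le_rfl, hs, fun _ _ => rfl⟩
  | assign v e =>
    intro _ d σ s hs _
    obtain ⟨τ, h₁, a₁, v₁⟩ := e.exec_compile d σ s hs
    have a₂ := a₁.setReg (e := d + 1) 0 (by omega)
    refine ⟨_, _, h₁.seq ((exec_const τ (tmp (d + 1)) 0).seq (exec_add _ _ _ _)), le_rfl, ?_, ?_⟩
    · have := (a₂.represents hs).setVar v (e.eval s)
      simpa [v₁, run] using this
    · intro i hi
      rw [reg_setReg, if_neg (by simp only [tmp]; omega), a₂.reg _ (by simp only [tmp]; omega)]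
  | write a i e =>
    intro _ d σ s hs _
    obtain ⟨τ, h₁, a₁, v₁⟩ := i.exec_compile d σ s hs
    obtain ⟨υ, h₂, a₂, v₂⟩ := exec_compileAddress a d τ
    have a₂' := a₁.trans a₂
    obtain ⟨φ, h₃, a₃, v₃⟩ := e.exec_compile (d + 1) υ s (a₂'.represents hs)
    have a₃' := a₂'.trans (a₃.mono (by omega))
    refine ⟨_, _, h₁.seq (h₂.seq (h₃.seq (exec_store φ _ _))), le_rfl, ?_, ?_⟩
    · have := (a₃'.represents hs).setArr a (i.eval s) (e.eval s)
      rwa [v₃, a₃.reg _ (by simp only [tmp]; omega), v₂, v₁, (a₁.represents hs).len]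
    · intro j hj
      rw [reg_setMem, a₃'.reg _ (by simp only [tmp]; omega)]
  | output i e =>
    intro _ d σ s hs _
    obtain ⟨τ, h₁, a₁, v₁⟩ := i.exec_compile d σ s hs
    obtain ⟨υ, h₂, a₂, v₂⟩ := e.exec_compile (d + 1) τ s (a₁.represents hs)
    have a₂' := a₁.trans (a₂.mono (by omega))
    have hr : υ.reg (tmp d) = i.eval s := by rw [a₂.reg _ (by simp only [tmp]; omega), v₁]
    by_cases h : i.eval s < s.len
    · refine ⟨_, _, h₁.seq (h₂.seq (exec_ifLt_true ?_ (exec_store υ _ _))), le_rfl, ?_, ?_⟩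
      · rwa [hr, (a₂'.represents hs).len]
      · rw [hr, v₂]
        exact (a₂'.represents hs).setCell _ h
      · intro j hj
        rw [reg_setMem, a₂'.reg _ (by simp only [tmp]; omega)]
    · refine ⟨_, _, h₁.seq (h₂.seq (exec_ifLt_false ?_ (Exec.skip υ))), le_rfl, ?_, ?_⟩
      · rwa [hr, (a₂'.represents hs).len]
      · rw [run, Store.setCell, if_neg h]
        exact a₂'.represents hs
      · intro j hj
        rw [a₂'.reg _ (by simp only [tmp]; omega)]
  | seq P Q iP iQ =>
    intro hp d σ s hs hN
    obtain ⟨t, τ, h₁, l₁, r₁, f₁⟩ := iP hp.1 d σ s hs hN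
    obtain ⟨t', υ, h₂, l₂, r₂, f₂⟩ := iQ hp.2 d τ _ r₁ fun v hv => by
      rw [hp.1.run_var s hv]; exact hN v hv
    exact ⟨_, _, h₁.seq h₂, Nat.add_le_add l₁ l₂, r₂, fun e he => (f₂ e he).trans (f₁ e he)⟩
  | ifLt e f P Q iP iQ =>
    intro hp d σ s hs hN
    obtain ⟨τ, h₁, a₁, v₁⟩ := e.exec_compile d σ s hs
    obtain ⟨υ, h₂, a₂, v₂⟩ := f.exec_compile (d + 1) τ s (a₁.represents hs)
    have a₂' := a₁.trans (a₂.mono (by omega))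
    have hr : υ.reg (tmp d) = e.eval s := by rw [a₂.reg _ (by simp only [tmp]; omega), v₁]
    by_cases h : e.eval s < f.eval s
    · obtain ⟨t, φ, h₃, l₃, r₃, f₃⟩ := iP hp.1 d υ s (a₂'.represents hs) hN
      refine ⟨_, _, h₁.seq (h₂.seq (exec_ifLt_true ?_ h₃)), ?_, ?_, ?_⟩
      · rwa [hr, v₂]
      · simp only [time]; omega
      · rwa [run, if_pos h]
      · intro j hj
        rw [f₃ j hj, a₂'.reg _ (by simp only [tmp]; omega)]
    · obtain ⟨t, φ, h₃, l₃, r₃, f₃⟩ := iQ hp.2 d υ s (a₂'.represents hs) hN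
      refine ⟨_, _, h₁.seq (h₂.seq (exec_ifLt_false ?_ h₃)), ?_, ?_, ?_⟩
      · rwa [hr, v₂]
      · simp only [time]; omega
      · rwa [run, if_neg h]
      · intro j hj
        rw [f₃ j hj, a₂'.reg _ (by simp only [tmp]; omega)]
  | loop v b st P ih =>
    intro hp d σ s hs hN
    obtain ⟨τ, h₁, a₁, v₁⟩ := st.exec_compile (d + 2) σ s hs
    set B := s.var b with hB
    set c := st.eval s with hc
    have hBN : B ≤ N := hN b hp.2.1
    -- Induction on the number `j` of rounds still to come. From `tmp d` on, the registers hold the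
    -- round counter, the bound, the step `c`, the product `i * c` (accumulated by addition) and the
    -- constant 1. The body is compiled with scratch space from `d + 5` on and cannot disturb them.
    have key : ∀ j i, i + j = B → ∀ ρ : State, Represents ρ (rounds P.run v c i s) →
        ρ.reg (tmp d) = i → ρ.reg (tmp (d + 1)) = B → ρ.reg (tmp (d + 2)) = c →
        ρ.reg (tmp (d + 3)) = i * c → ρ.reg (tmp (d + 4)) = 1 →
        (∀ e < d, ρ.reg (tmp e) = σ.reg (tmp e)) → ∃ t υ,
        UExec (.whileLt (tmp d) (tmp (d + 1))
          (.seq (.instr (.const (tmp (d + 5)) 0))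
          (.seq (.instr (.add (2 * v) (tmp (d + 3)) (tmp (d + 5))))
          (.seq (P.compile (d + 5))
          (.seq (.instr (.add (tmp (d + 3)) (tmp (d + 3)) (tmp (d + 2))))
          (.instr (.add (tmp d) (tmp d) (tmp (d + 4))))))))) ρ t υ ∧
        t ≤ j * (P.time N + 5) + 1 ∧ Represents υ (rounds P.run v c B s) ∧
        ∀ e < d, υ.reg (tmp e) = σ.reg (tmp e) := by
      intro j
      induction j with
      | zero =>
        intro i hi ρ hρ h0 h1 _ _ _ hf
        refine ⟨_, _, exec_whileLt_false (by omega), by omega, ?_, hf⟩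
        rwa [show B = i by omega]
      | succ j ihj =>
        intro i hi ρ hρ h0 h1 h2 h3 h4 hf
        have A := (Agree.refl (d + 5) ρ).setReg 0 (le_refl (d + 5))
        have R := (A.represents hρ).setVar v (i * c)
        -- Protected variables still have their initial values in this round, so the bounds of inner
        -- loops remain at most `N`.
        obtain ⟨t, υ, hx, hl, hr, hfr⟩ := ih hp.2.2 (d + 5) _ _ R fun u hu => by
          have huv : u ≠ v := by have := hp.1; omega
          have := (frame_rounds (v := v) (b := b) (st := st) P.frame c i s).var u (by
            simp only [writtenVars, List.mem_cons, not_or]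
            exact ⟨huv, hp.2.2.notMem hu⟩)
          rw [Store.var_setVar, if_neg huv, this]
          exact hN u hu
        have keep : ∀ e < d + 5, υ.reg (tmp e) = ρ.reg (tmp e) := by
          intro e he
          rw [hfr e he, reg_setReg, if_neg (by simp only [tmp]; omega),
            A.reg _ (by simp only [tmp]; omega)]
        have A' := ((Agree.refl d υ).setReg (e := d + 3)
          (υ.reg (tmp (d + 3)) + υ.reg (tmp (d + 2))) (by omega)).setReg (e := d)
          (υ.reg (tmp d) + υ.reg (tmp (d + 4))) le_rfl
        obtain ⟨t', φ, hx', hl', hr', hf'⟩ := ihj (i + 1) (by omega) _ (A'.represents hr)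
          (by simp [keep d (by omega), keep (d + 4) (by omega), h0, h4])
          (by simp [keep (d + 1) (by omega), h1])
          (by simp [keep (d + 2) (by omega), h2])
          (by simp [keep (d + 2) (by omega), keep (d + 3) (by omega), h2, h3, Nat.succ_mul])
          (by simp [keep (d + 4) (by omega), h4])
          (fun e he => by
            rw [A'.reg _ (by simp only [tmp]; omega), keep e (by omega), hf e he])
        have e₁ := exec_const ρ (tmp (d + 5)) 0
        have e₂ := exec_add (setReg ρ (tmp (d + 5)) 0) (2 * v) (tmp (d + 3)) (tmp (d + 5))
        have hv : (setReg ρ (tmp (d + 5)) 0).reg (tmp (d + 3)) +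
            (setReg ρ (tmp (d + 5)) 0).reg (tmp (d + 5)) = i * c := by
          simp [h3]
        rw [hv] at e₂
        have e₃ := exec_add υ (tmp (d + 3)) (tmp (d + 3)) (tmp (d + 2))
        have e₄ := exec_add (setReg υ (tmp (d + 3)) (υ.reg (tmp (d + 3)) + υ.reg (tmp (d + 2))))
          (tmp d) (tmp d) (tmp (d + 4))
        have hw : (setReg υ (tmp (d + 3)) (υ.reg (tmp (d + 3)) + υ.reg (tmp (d + 2)))).reg (tmp d) +
            (setReg υ (tmp (d + 3)) (υ.reg (tmp (d + 3)) + υ.reg (tmp (d + 2)))).reg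
              (tmp (d + 4)) = υ.reg (tmp d) + υ.reg (tmp (d + 4)) := by
          simp
        rw [hw] at e₄
        refine ⟨_, _, exec_whileLt_true (by omega)
          (e₁.seq (e₂.seq (hx.seq (e₃.seq e₄)))) hx', ?_, hr', hf'⟩
        rw [Nat.succ_mul]
        omega
    have A := (((a₁.mono (d' := d) (by omega)).setReg (e := d) 0 le_rfl).setReg (e := d + 3) 0
      (by omega)).setReg (e := d + 4) 1 (by omega)
    have A' := A.setReg (e := d + 1) B (by omega)
    obtain ⟨t, υ, hx, hl, hr, hf⟩ := key B 0 (by omega) _ (A'.represents hs) (by simp) (by simp)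
      (by simp [v₁]) (by simp) (by simp) fun e he => by
        rw [A'.reg _ (by simp only [tmp]; omega)]
    have e₅ := exec_add (setReg (setReg (setReg τ (tmp d) 0) (tmp (d + 3)) 0) (tmp (d + 4)) 1)
      (tmp (d + 1)) (2 * b) (tmp d)
    have hv : (setReg (setReg (setReg τ (tmp d) 0) (tmp (d + 3)) 0) (tmp (d + 4)) 1).reg (2 * b) +
        (setReg (setReg (setReg τ (tmp d) 0) (tmp (d + 3)) 0) (tmp (d + 4)) 1).reg (tmp d) = B := by
      rw [(A.represents hs).var]
      simp [hB]
    rw [hv] at e₅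
    refine ⟨_, _, h₁.seq ((exec_const _ _ _).seq ((exec_const _ _ _).seq ((exec_const _ _ _).seq
      (e₅.seq hx)))), ?_, hr, hf⟩
    have := Nat.mul_le_mul_right (P.time N + 5) hBN
    simp only [time]
    omega

/-! ### Composition of time bounds -/

/-- Started in the store `s`, the compiled program simulates the statement within the time bound. -/
def Executes (N : ℕ) (P : Stmt) (s : Store) : Prop :=
  ∀ σ, Represents σ s → ∃ t τ, UExec (P.compile 0) σ t τ ∧ t ≤ P.time N ∧ Represents τ (P.run s)

lemma Stmt.Protects.executes {p N : ℕ} {P : Stmt} (hP : P.Protects p) {s : Store}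
    (hs : ∀ v < p, s.var v ≤ N) : Executes N P s := by
  intro σ hσ
  obtain ⟨t, τ, h₁, h₂, h₃, -⟩ := P.exec_compile hP 0 σ s hσ hs
  exact ⟨t, τ, h₁, h₂, h₃⟩

/-- Phases joined in this way may protect different initial segments of the variables. This is
needed because some phases compute loop bounds for later ones, such as the number of assignments. -/
lemma Executes.seq {N : ℕ} {P Q : Stmt} {s : Store} (hP : Executes N P s)
    (hQ : Executes N Q (P.run s)) : Executes N (.seq P Q) s := by
  intro σ hσ
  obtain ⟨t, τ, h₁, h₂, h₃⟩ := hP σ hσ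
  obtain ⟨t', τ', h₁', h₂', h₃'⟩ := hQ τ h₃
  exact ⟨_, _, h₁.seq h₁', Nat.add_le_add h₂ h₂', h₃'⟩

/-- Each branch has to meet the time bound only if it is taken: exhaustive search is affordable only
after the polynomial part has failed. -/
lemma Executes.ifLt {N : ℕ} {e f : Expr} {P Q : Stmt} {s : Store}
    (hP : e.eval s < f.eval s → Executes N P s) (hQ : ¬ e.eval s < f.eval s → Executes N Q s) :
    Executes N (.ifLt e f P Q) s := by
  intro σ hσ
  obtain ⟨τ, h₁, a₁, v₁⟩ := e.exec_compile 0 σ s hσ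
  obtain ⟨υ, h₂, a₂, v₂⟩ := f.exec_compile 1 τ s (a₁.represents hσ)
  have R := a₂.represents (a₁.represents hσ)
  have hr : υ.reg (tmp 0) = e.eval s := by rw [a₂.reg _ (by simp only [tmp]; omega), v₁]
  by_cases h : e.eval s < f.eval s
  · obtain ⟨t, φ, h₃, l₃, r₃⟩ := hP h υ R
    refine ⟨_, _, h₁.seq (h₂.seq (exec_ifLt_true (by rwa [hr, v₂]) h₃)), ?_, ?_⟩
    · simp only [Stmt.time]; omega
    · rwa [Stmt.run, if_pos h]
  · obtain ⟨t, φ, h₃, l₃, r₃⟩ := hQ h υ R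
    refine ⟨_, _, h₁.seq (h₂.seq (exec_ifLt_false (by rwa [hr, v₂]) h₃)), ?_, ?_⟩
    · simp only [Stmt.time]; omega
    · rwa [Stmt.run, if_neg h]

/-- The number of steps is bounded by a polynomial in the number of rounds. -/
lemma Stmt.exists_time_le (P : Stmt) : ∃ C c, ∀ N, P.time N ≤ C * (N + 1) ^ c := by
  have mono : ∀ {C C' c c' N : ℕ}, C ≤ C' → c ≤ c' → C * (N + 1) ^ c ≤ C' * (N + 1) ^ c' :=
    fun h h' => Nat.mul_le_mul h (Nat.pow_le_pow_right (by omega) h')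
  have pos : ∀ c N : ℕ, 1 ≤ (N + 1) ^ c := fun c N => Nat.one_le_pow _ _ (by omega)
  induction P with
  | skip => exact ⟨1, 0, by simp [time]⟩
  | assign v e => exact ⟨e.time + 2, 0, by simp [time]⟩
  | write a i e => exact ⟨i.time + ((a + 5) + (e.time + 1)), 0, by simp [time]⟩
  | output i e => exact ⟨i.time + (e.time + 2), 0, by simp [time]⟩
  | seq P Q hP hQ =>
    obtain ⟨C, c, h⟩ := hP
    obtain ⟨C', c', h'⟩ := hQ
    refine ⟨C + C', max c c', fun N => ?_⟩
    have h₁ := (h N).trans (mono le_rfl (le_max_left c c'))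
    have h₂ := (h' N).trans (mono le_rfl (le_max_right c c'))
    rw [time, add_mul]
    omega
  | ifLt e f P Q hP hQ =>
    obtain ⟨C, c, h⟩ := hP
    obtain ⟨C', c', h'⟩ := hQ
    refine ⟨e.time + f.time + 1 + C + C', max c c', fun N => ?_⟩
    have h₁ := (h N).trans (mono le_rfl (le_max_left c c'))
    have h₂ := (h' N).trans (mono le_rfl (le_max_right c c'))
    have h₃ := Nat.mul_le_mul_left (e.time + f.time + 1) (pos (max c c') N)
    rw [time, add_mul, add_mul]
    omega
  | loop v b st P hP =>
    obtain ⟨C, c, h⟩ := hP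
    refine ⟨st.time + 5 + (C + 5), c + 1, fun N => ?_⟩
    have h₁ : N * (P.time N + 5) ≤ (C + 5) * (N + 1) ^ (c + 1) := by
      calc N * (P.time N + 5) ≤ (N + 1) * ((C + 5) * (N + 1) ^ c) := by
            refine Nat.mul_le_mul (by omega) ?_
            have := h N
            have := Nat.mul_le_mul_left 5 (pos c N)
            rw [add_mul]
            omega
        _ = _ := by ring
    have h₃ := Nat.mul_le_mul_left (st.time + 5) (pos (c + 1) N)
    rw [time, add_mul]
    omega

end LoopLang

/-! ## Elimination over the field with two elements -/

namespace MaxLin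

open Finset Matrix

variable {n : ℕ}

/-- The sign of a bit. -/
def sgn (x : ZMod 2) : ℤ := if x = 0 then 1 else -1

lemma sgn_add_one (x : ZMod 2) : sgn (x + 1) = -sgn x := by
  revert x; decide

lemma zmod_two_eq_zero_or_one (x : ZMod 2) : x = 0 ∨ x = 1 := by
  revert x; decide

lemma add_self_eq_zero' (x : Fin n → ZMod 2) : x + x = 0 :=
  funext fun _ => CharTwo.add_self_eq_zero _

lemma sub_eq_add' (x y : Fin n → ZMod 2) : x - y = x + y :=
  funext fun _ => CharTwo.sub_eq_add _ _

/-- One round of elimination on the first `M` rows: the row `r` with right-hand side `c` is added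
to all rows that have a `1` in a certain column where the row `r` has a `1`. -/
def Elim (M : ℕ) (A : ℕ → Fin n → ZMod 2) (b : ℕ → ZMod 2) (r : ℕ) (c : ZMod 2)
    (A' : ℕ → Fin n → ZMod 2) (b' : ℕ → ZMod 2) : Prop :=
  ∃ j, A r j = 1 ∧ ∀ i < M, A' i = (if A i j = 1 then A i + A r else A i) ∧
    b' i = if A i j = 1 then b i + c else b i

/-- Elimination with the row `r`, if it is not zero, where the right-hand side is chosen according
to the weighted majority of the rows among the first `m` that are equal to it. -/
def Clears (m M : ℕ) (w : ℕ → ℕ) (A : ℕ → Fin n → ZMod 2) (b : ℕ → ZMod 2) (r : ℕ)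
    (A' : ℕ → Fin n → ZMod 2) (b' : ℕ → ZMod 2) : Prop :=
  (A r = 0 ∧ ∀ i < M, A' i = A i ∧ b' i = b i) ∨
  ∃ c, Elim M A b r c A' b' ∧ 0 ≤ ∑ i ∈ range m with A i = A r, sgn (b i + c) * w i

/-- The total signed weight of the zero rows. -/
def zeroValue (m : ℕ) (w : ℕ → ℕ) (A : ℕ → Fin n → ZMod 2) (b : ℕ → ZMod 2) : ℤ :=
  ∑ i ∈ range m with A i = 0, sgn (b i) * w i

/-- Every assignment to the variables of the system `(A, b)` gives rise to one of `(A₀, b₀)` with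
the same values. -/
def Lifts (M : ℕ) (A₀ : ℕ → Fin n → ZMod 2) (b₀ : ℕ → ZMod 2) (A : ℕ → Fin n → ZMod 2)
    (b : ℕ → ZMod 2) : Prop :=
  ∀ z', ∃ z, ∀ i < M, A i ⬝ᵥ z' + b i = A₀ i ⬝ᵥ z + b₀ i

/-- The rows `A i` are the rows `A₀ i` modulo the subspace `W`. -/
def Reduces (M : ℕ) (A₀ A : ℕ → Fin n → ZMod 2) (W : Submodule (ZMod 2) (Fin n → ZMod 2)) : Prop :=
  ∃ T : (Fin n → ZMod 2) →ₗ[ZMod 2] (Fin n → ZMod 2), (∀ i < M, A i = T (A₀ i)) ∧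
    LinearMap.ker T = W

section

variable {m M : ℕ} {w : ℕ → ℕ} {A₀ A A' : ℕ → Fin n → ZMod 2} {b₀ b b' : ℕ → ZMod 2} {r : ℕ}
  {c : ZMod 2} {W : Submodule (ZMod 2) (Fin n → ZMod 2)}

/-- Change the coordinate `j` of `z'` by `A r ⬝ᵥ z' + c`, which is what makes `A r ⬝ᵥ z = c` hold. A
row with entry 1 in column `j` then changes its value by `A r ⬝ᵥ z' + c`, and the other rows keep
theirs. -/
lemma Elim.lifts (h : Elim M A b r c A' b') : Lifts M A b A' b' := by
  obtain ⟨j, -, h⟩ := h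
  intro z'
  refine ⟨z' + (A r ⬝ᵥ z' + c) • Pi.single j 1, fun i hi => ?_⟩
  rw [(h i hi).1, (h i hi).2, dotProduct_add, dotProduct_smul, dotProduct_single_one, smul_eq_mul]
  rcases zmod_two_eq_zero_or_one (A i j) with h0 | h1
  · simp [h0]
  · simp only [h1, if_true, add_dotProduct]
    ring

lemma Clears.lifts (h : Clears m M w A b r A' b') : Lifts M A b A' b' := by
  rcases h with ⟨-, h⟩ | ⟨c, h, -⟩
  · exact fun z' => ⟨z', fun i hi => by rw [(h i hi).1, (h i hi).2]⟩
  · exact h.lifts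

lemma Lifts.trans (h : Lifts M A₀ b₀ A b) (h' : Lifts M A b A' b') : Lifts M A₀ b₀ A' b' := by
  intro z'
  obtain ⟨z, hz⟩ := h' z'
  obtain ⟨y, hy⟩ := h z
  exact ⟨y, fun i hi => (hz i hi).trans (hy i hi)⟩

/-- The rows that newly become zero are exactly those equal to `A r`. Rows that were zero have entry
0 in the pivot column and do not change; the other rows with entry 0 there also differ from `A r`.
-/
lemma Elim.zeroValue_eq (h : Elim M A b r c A' b') (hm : m ≤ M) :
    zeroValue m w A' b' = zeroValue m w A b + ∑ i ∈ range m with A i = A r, sgn (b i + c) * w i := by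
  obtain ⟨j, hj, h⟩ := h
  simp only [zeroValue, sum_filter]
  rw [← sum_add_distrib]
  refine sum_congr rfl fun i hi => ?_
  obtain ⟨h₁, h₂⟩ := h i ((mem_range.1 hi).trans_le hm)
  rw [h₁, h₂]
  by_cases hij : A i j = 1
  · have h0 : A i ≠ 0 := fun h => by simp [h] at hij
    have h1 : A i + A r = 0 ↔ A i = A r := by
      rw [← sub_eq_add', sub_eq_zero]
    simp [hij, h0, h1]
  · have h1 : A i ≠ A r := fun h => hij (h ▸ hj)
    simp [hij, h1]

lemma Clears.zeroValue_le (h : Clears m M w A b r A' b') (hm : m ≤ M) :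
    zeroValue m w A b ≤ zeroValue m w A' b' := by
  rcases h with ⟨-, h⟩ | ⟨c, h, hc⟩
  · refine le_of_eq ?_
    simp only [zeroValue, sum_filter]
    refine sum_congr rfl fun i hi => ?_
    obtain ⟨h₁, h₂⟩ := h i ((mem_range.1 hi).trans_le hm)
    rw [h₁, h₂]
  · rw [h.zeroValue_eq hm]
    omega

/-- If no other row equals `A r`, the majority sum is the single term `± w r`. Being nonnegative, it
equals `w r`, which is at least 1. -/
lemma Clears.zeroValue_lt (h : Clears m M w A b r A' b') (hm : m ≤ M) (hr : r < m)
    (hw : 0 < w r) (h0 : A r ≠ 0) (hu : ∀ i < m, A i = A r → i = r) :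
    zeroValue m w A b + 1 ≤ zeroValue m w A' b' := by
  rcases h with ⟨h, -⟩ | ⟨c, h, hc⟩
  · exact absurd h h0
  · have hs : (range m).filter (fun i => A i = A r) = {r} := by
      ext i
      simp only [mem_filter, mem_range, mem_singleton]
      exact ⟨fun h => hu i h.1 h.2, fun h => by subst h; exact ⟨hr, rfl⟩⟩
    rw [h.zeroValue_eq hm]
    rw [hs, sum_singleton] at hc ⊢
    have : sgn (b r + c) = 1 ∨ sgn (b r + c) = -1 := by
      unfold sgn; split_ifs <;> simp
    rcases this with h | h <;> rw [h] at hc ⊢ <;> omega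

lemma Clears.congr_weight {w' : ℕ → ℕ} (h : Clears m M w A b r A' b')
    (hw : ∀ i < m, w i = w' i) : Clears m M w' A b r A' b' := by
  rcases h with h | ⟨c, h, hc⟩
  · exact .inl h
  · refine .inr ⟨c, h, hc.trans_eq (sum_congr rfl fun i hi => ?_)⟩
    rw [hw i (mem_range.1 (mem_filter.1 hi).1)]

lemma Reduces.eq_iff (h : Reduces M A₀ A W) {i j : ℕ} (hi : i < M) (hj : j < M) :
    A i = A j ↔ A₀ i + A₀ j ∈ W := by
  obtain ⟨T, hT, rfl⟩ := h
  rw [hT i hi, hT j hj, ← sub_eq_add', LinearMap.mem_ker, map_sub, sub_eq_zero]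

lemma Reduces.eq_zero_iff (h : Reduces M A₀ A W) {i : ℕ} (hi : i < M) : A i = 0 ↔ A₀ i ∈ W := by
  obtain ⟨T, hT, rfl⟩ := h
  rw [hT i hi, LinearMap.mem_ker]

lemma Reduces.refl (M : ℕ) (A₀ : ℕ → Fin n → ZMod 2) : Reduces M A₀ A₀ ⊥ :=
  ⟨LinearMap.id, fun _ _ => rfl, LinearMap.ker_id⟩

lemma Reduces.congr (h : Reduces M A₀ A W) (hA : ∀ i < M, A' i = A i) : Reduces M A₀ A' W := by
  obtain ⟨T, hT, hW⟩ := h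
  exact ⟨T, fun i hi => (hA i hi).trans (hT i hi), hW⟩

/-- Elimination applies the linear map `y ↦ y + y j • A r` to the rows. As `A r j = 1`, its kernel
is spanned by `A r`, the image of `A₀ r`, so the kernel of the composite is enlarged by precisely
`A₀ r`. -/
lemma Elim.reduces (h : Elim M A b r c A' b') (hr : r < M) (hA : Reduces M A₀ A W) :
    Reduces M A₀ A' (W ⊔ Submodule.span (ZMod 2) {A₀ r}) := by
  obtain ⟨j, hj, h⟩ := h
  obtain ⟨T, hT, rfl⟩ := hA
  refine ⟨(LinearMap.id + (LinearMap.proj j).smulRight (A r)).comp T, fun i hi => ?_, ?_⟩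
  · rw [(h i hi).1, hT i hi]
    rcases zmod_two_eq_zero_or_one (T (A₀ i) j) with h0 | h1
    · simp [h0]
    · simp [h1]
  · ext x
    rw [LinearMap.mem_ker, Submodule.mem_sup]
    simp only [LinearMap.comp_apply, LinearMap.add_apply, LinearMap.id_apply,
      LinearMap.smulRight_apply, LinearMap.proj_apply, LinearMap.mem_ker,
      Submodule.mem_span_singleton]
    have hrr := hT r hr
    constructor
    · intro hx
      -- In characteristic two, adding `T x j • A₀ r` twice restores `x`, and the first summand is
      -- killed by `T` because of `hx`.
      refine ⟨x + T x j • A₀ r, ?_, T x j • A₀ r, ⟨_, rfl⟩, ?_⟩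
      · rw [map_add, map_smul, ← hrr, hx]
      · rw [add_assoc, add_self_eq_zero', add_zero]
    · rintro ⟨y, hy, _, ⟨a, rfl⟩, rfl⟩
      rw [map_add, map_smul, hy, zero_add, ← hrr]
      simp only [Pi.smul_apply, hj, smul_eq_mul, mul_one]
      exact add_self_eq_zero' _

/-- A row that is already zero is skipped by the program, but then `A₀ r` lies in `W` and the
description of the new subspace is the same in both cases. -/
lemma Clears.reduces (h : Clears m M w A b r A' b') (hr : r < M) (hA : Reduces M A₀ A W) :
    Reduces M A₀ A' (W ⊔ Submodule.span (ZMod 2) {A₀ r}) := by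
  rcases h with ⟨h0, h⟩ | ⟨c, h, -⟩
  · have : A₀ r ∈ W := (hA.eq_zero_iff hr).1 h0
    rw [sup_eq_left.2 (by simpa using this)]
    exact hA.congr fun i hi => (h i hi).1
  · exact h.reduces hr hA

end

/-! ### Sum-free sequences of rows -/

/-- The span of the rows with indices `K 0, …, K (s - 1)`. -/
def rowSpan (A₀ : ℕ → Fin n → ZMod 2) (K : ℕ → ℕ) (s : ℕ) : Submodule (ZMod 2) (Fin n → ZMod 2) :=
  Submodule.span (ZMod 2) ↑((range s).image fun t => A₀ (K t))

lemma rowSpan_zero (A₀ : ℕ → Fin n → ZMod 2) (K : ℕ → ℕ) : rowSpan A₀ K 0 = ⊥ := by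
  simp [rowSpan]

lemma rowSpan_succ (A₀ : ℕ → Fin n → ZMod 2) (K : ℕ → ℕ) (s : ℕ) :
    rowSpan A₀ K (s + 1) = rowSpan A₀ K s ⊔ Submodule.span (ZMod 2) {A₀ (K s)} := by
  rw [rowSpan, rowSpan, range_add_one, image_insert, coe_insert, Submodule.span_insert, sup_comm]

lemma rowSpan_congr {A₀ : ℕ → Fin n → ZMod 2} {K K' : ℕ → ℕ} {s : ℕ}
    (h : ∀ t < s, K' t = K t) : rowSpan A₀ K' s = rowSpan A₀ K s := by
  rw [rowSpan, rowSpan, image_congr]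
  intro t ht
  simp only [coe_range, Set.mem_Iio] at ht
  simp only [h t ht]

lemma finrank_rowSpan_le (A₀ : ℕ → Fin n → ZMod 2) (K : ℕ → ℕ) (s : ℕ) :
    Module.finrank (ZMod 2) (rowSpan A₀ K s) ≤ s :=
  (finrank_span_finset_le_card _).trans (card_image_le.trans_eq (card_range s))

/-- The rows `K 0, …, K (s - 1)` are linearly independent, and no sum of two or more of them is
among the first `m` rows. -/
def SumFree (m : ℕ) (A₀ : ℕ → Fin n → ZMod 2) (K : ℕ → ℕ) (s : ℕ) : Prop :=
  ∀ t < s, K t < m ∧ A₀ (K t) ∉ rowSpan A₀ K t ∧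
    ∀ i < m, A₀ i + A₀ (K t) ∈ rowSpan A₀ K t → i = K t

/-! ### The value secured by the majority algorithm -/

/-- The progress of the majority algorithm: the rows have been reduced modulo `W`, and the value
`v` has been secured. -/
structure Progress (m M : ℕ) (w : ℕ → ℕ) (A₀ : ℕ → Fin n → ZMod 2) (b₀ : ℕ → ZMod 2)
    (A : ℕ → Fin n → ZMod 2) (b : ℕ → ZMod 2) (W : Submodule (ZMod 2) (Fin n → ZMod 2))
    (v : ℤ) : Prop where
  reduces : Reduces M A₀ A W
  lifts : Lifts M A₀ b₀ A b
  le_value : v ≤ zeroValue m w A b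

section

variable {m M : ℕ} {w : ℕ → ℕ} {A₀ A A' : ℕ → Fin n → ZMod 2} {b₀ b b' : ℕ → ZMod 2} {r : ℕ}
  {W : Submodule (ZMod 2) (Fin n → ZMod 2)} {v : ℤ}

lemma Progress.init (hm : m ≤ M) (h0 : ∀ i < m, A₀ i ≠ 0) (hA : ∀ i < M, A i = A₀ i)
    (hb : ∀ i < M, b i = b₀ i) : Progress m M w A₀ b₀ A b ⊥ 0 where
  reduces := (Reduces.refl M A₀).congr hA
  lifts z' := ⟨z', fun i hi => by rw [hA i hi, hb i hi]⟩
  le_value := by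
    rw [zeroValue, filter_false_of_mem, sum_empty]
    intro i hi
    rw [mem_range] at hi
    rw [hA i (by omega)]
    exact h0 i hi

lemma Progress.process (h : Progress m M w A₀ b₀ A b W v) (hm : m ≤ M) (hr : r < m)
    (hp : Clears m M w A b r A' b') :
    Progress m M w A₀ b₀ A' b' (W ⊔ Submodule.span (ZMod 2) {A₀ r}) v where
  reduces := hp.reduces (by omega) h.reduces
  lifts := h.lifts.trans hp.lifts
  le_value := h.le_value.trans (hp.zeroValue_le hm)

/-- Sum-freeness says exactly that, modulo the rows before it, the row `K t` is nonzero and equal to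
no other row. So it is alone in its majority vote and contributes its full weight. -/
lemma Progress.process_sumFree {K : ℕ → ℕ} {s t : ℕ}
    (h : Progress m M w A₀ b₀ A b (rowSpan A₀ K t) v) (hm : m ≤ M) (hw : ∀ i < m, 0 < w i)
    (hK : SumFree m A₀ K s) (ht : t < s) (hp : Clears m M w A b (K t) A' b') :
    Progress m M w A₀ b₀ A' b' (rowSpan A₀ K (t + 1)) (v + 1) := by
  obtain ⟨h₁, h₂, h₃⟩ := hK t ht
  refine ⟨?_, h.lifts.trans hp.lifts, ?_⟩
  · rw [rowSpan_succ]
    exact hp.reduces (by omega) h.reduces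
  · refine (add_le_add_left h.le_value 1).trans
      (hp.zeroValue_lt hm h₁ (hw _ h₁) ?_ fun i hi he => ?_)
    · rwa [Ne, h.reduces.eq_zero_iff (by omega)]
    · exact h₃ i hi ((h.reduces.eq_iff (by omega) (by omega)).1 he)

/-- When the rows have been reduced to zero, the right-hand sides encode a good assignment. -/
lemma Progress.exists_assignment (h : Progress m M w A₀ b₀ A b ⊤ v) (hm : m ≤ M) :
    ∃ z, (∀ i < M, b i = A₀ i ⬝ᵥ z + b₀ i) ∧ v ≤ ∑ i ∈ range m, sgn (A₀ i ⬝ᵥ z + b₀ i) * w i := by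
  -- All reduced rows are zero, so the assignment to the reduced system is irrelevant and 0 will do.
  obtain ⟨z, hz⟩ := h.lifts 0
  have h0 : ∀ i < M, A i = 0 := fun i hi => (h.reduces.eq_zero_iff hi).2 trivial
  have hb : ∀ i < M, b i = A₀ i ⬝ᵥ z + b₀ i := fun i hi => by
    rw [← hz i hi, h0 i hi, zero_dotProduct, zero_add]
  refine ⟨z, hb, h.le_value.trans_eq ?_⟩
  rw [zeroValue, filter_true_of_mem fun i hi => h0 i ((mem_range.1 hi).trans_le hm)]
  exact sum_congr rfl fun i hi => by rw [hb i ((mem_range.1 hi).trans_le hm)]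

end

/-! ### The search for a sum-free sequence -/

/-- The number of distinct nonzero rows. -/
def numNonzero (m : ℕ) (A : ℕ → Fin n → ZMod 2) : ℕ := #(((range m).image A).erase 0)

lemma numNonzero_congr {m : ℕ} {A A' : ℕ → Fin n → ZMod 2} (h : ∀ i < m, A i = A' i) :
    numNonzero m A = numNonzero m A' := by
  rw [numNonzero, numNonzero, image_congr fun i hi => h i (by simpa using hi)]

lemma numNonzero_le (m : ℕ) (A : ℕ → Fin n → ZMod 2) : numNonzero m A ≤ m :=
  (card_le_card (erase_subset _ _)).trans (card_image_le.trans_eq (card_range m))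

/-- The invariant of a pass over the rows that extends the sequence `K 0, …, K (c - 1)` greedily:
`AU` are the rows modulo `W`, `AV` the rows modulo `W` and the sequence, and `i < l` passes have
failed before, each of which halved the number of nonzero rows. -/
structure Pass (m M k l i : ℕ) (A₀ AU AV : ℕ → Fin n → ZMod 2)
    (W : Submodule (ZMod 2) (Fin n → ZMod 2)) (K : ℕ → ℕ) (c pos : ℕ) : Prop where
  le : c ≤ k
  sumFree : SumFree m A₀ K c
  reducesU : c < k → Reduces M A₀ AU W
  reducesV : c < k → Reduces M A₀ AV (W ⊔ rowSpan A₀ K c)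
  disjoint : c < k → Disjoint W (rowSpan A₀ K c)
  failed : c < k → i < l ∧ 2 ^ i * numNonzero m AU ≤ m ∧ Module.finrank (ZMod 2) W ≤ i * k
  bad : c < k → ∀ u < pos, AV u = 0 ∨ ∃ i < m, AV i = AV u ∧ AU i ≠ AU u

section

variable {m M k l i : ℕ} {w : ℕ → ℕ} {A₀ AU AV AV' : ℕ → Fin n → ZMod 2} {b b' : ℕ → ZMod 2}
  {W : Submodule (ZMod 2) (Fin n → ZMod 2)} {K K' : ℕ → ℕ} {c pos : ℕ}

lemma Pass.reject (h : Pass m M k l i A₀ AU AV W K c pos)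
    (hp : c < k → AV pos = 0 ∨ ∃ i < m, AV i = AV pos ∧ AU i ≠ AU pos) :
    Pass m M k l i A₀ AU AV W K c (pos + 1) where
  le := h.le
  sumFree := h.sumFree
  reducesU := h.reducesU
  reducesV := h.reducesV
  disjoint := h.disjoint
  failed := h.failed
  bad hc u hu := by
    rcases Nat.lt_succ_iff_lt_or_eq.1 hu with hu | rfl
    · exact h.bad hc u hu
    · exact hp hc

/-- The crux is the independence of `W` and the sequence. If a row is congruent to `A₀ pos` modulo
the sequence, it equals it in `AV`, hence by the acceptance test in `AU`, so the sum of the two rows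
lies in `W` as well as in the span of the sequence. That intersection is zero, and the rows of the
system are distinct. -/
lemma Pass.accept (h : Pass m M k l i A₀ AU AV W K c pos) (hm : m ≤ M) (hpos : pos < m) (hc : c < k)
    (hinj : ∀ i < m, ∀ j < m, A₀ i = A₀ j → i = j) (h0 : AV pos ≠ 0)
    (hgood : ∀ i < m, AV i = AV pos → AU i = AU pos) (hK : ∀ t < c, K' t = K t) (hKc : K' c = pos)
    (hp : Clears m M w AV b pos AV' b') :
    Pass m M k l i A₀ AU AV' W K' (c + 1) (pos + 1) := by
  have hV := h.reducesV hc
  have hU := h.reducesU hc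
  have hd := h.disjoint hc
  have hnot : A₀ pos ∉ W ⊔ rowSpan A₀ K c := by rwa [← hV.eq_zero_iff (by omega)]
  have hspan : rowSpan A₀ K' (c + 1) = rowSpan A₀ K c ⊔ Submodule.span (ZMod 2) {A₀ pos} := by
    rw [rowSpan_succ, rowSpan_congr hK, hKc]
  have hV' : Reduces M A₀ AV' (W ⊔ rowSpan A₀ K' (c + 1)) := by
    rw [hspan, ← sup_assoc]
    exact hp.reduces (by omega) hV
  refine ⟨hc, ?_, fun _ => hU, fun _ => hV', fun _ => ?_, fun _ => h.failed hc,
    fun _ u hu => ?_⟩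
  · intro t ht
    rcases Nat.lt_succ_iff_lt_or_eq.1 ht with ht | rfl
    · rw [hK t ht, rowSpan_congr fun s hs => hK s (hs.trans ht)]
      exact h.sumFree t ht
    · rw [hKc, rowSpan_congr hK]
      refine ⟨hpos, fun hx => hnot (Submodule.mem_sup_right hx), fun i hi hx => ?_⟩
      refine hinj i hi pos hpos ?_
      have hx' : A₀ i + A₀ pos ∈ W := (hU.eq_iff (by omega) (by omega)).1
        (hgood i hi ((hV.eq_iff (by omega) (by omega)).2 (Submodule.mem_sup_right hx)))
      have := Submodule.disjoint_def.1 hd _ hx' hx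
      rwa [← sub_eq_add', sub_eq_zero] at this
  · rw [hspan, Submodule.disjoint_def]
    intro x hxW hx
    obtain ⟨y, hy, _, hz, rfl⟩ := Submodule.mem_sup.1 hx
    obtain ⟨a, rfl⟩ := Submodule.mem_span_singleton.1 hz
    rcases zmod_two_eq_zero_or_one a with rfl | rfl
    · rw [zero_smul, add_zero] at hxW ⊢
      exact Submodule.disjoint_def.1 hd _ hxW hy
    · rw [one_smul] at hxW
      -- An element `y + A₀ pos` of `W` with `y` in the old span would put `A₀ pos` into `W ⊔
      -- rowSpan A₀ K c`, making it a zero row of `AV`.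
      refine absurd ?_ hnot
      have : A₀ pos = (y + A₀ pos) - y := by abel
      rw [this]
      exact Submodule.sub_mem _ (Submodule.mem_sup_left hxW) (Submodule.mem_sup_right hy)
  -- Enlarging the subspace preserves zero rows and coincidences of rows in `AV`, while `AU` is
  -- untouched, so rejected rows stay bad. The accepted row itself becomes zero.
  · have hle : W ⊔ rowSpan A₀ K c ≤ W ⊔ rowSpan A₀ K' (c + 1) := by
      rw [hspan, ← sup_assoc]
      exact le_sup_left
    rcases Nat.lt_succ_iff_lt_or_eq.1 hu with hu | rfl
    · rcases h.bad hc u hu with h₁ | ⟨i, hi, h₁, h₂⟩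
      · exact .inl ((hV'.eq_zero_iff (by omega)).2 (hle ((hV.eq_zero_iff (by omega)).1 h₁)))
      · exact .inr ⟨i, hi, (hV'.eq_iff (by omega) (by omega)).2
          (hle ((hV.eq_iff (by omega) (by omega)).1 h₁)), h₂⟩
    · refine .inl ((hV'.eq_zero_iff (by omega)).2 (Submodule.mem_sup_right ?_))
      rw [hspan]
      exact Submodule.mem_sup_right (Submodule.mem_span_singleton_self _)

/-- Double counting between values in `AV` and in `AU`: at the end of a pass all rows are bad, so
each nonzero value in `AV` arises from at least two values in `AU`, which are nonzero too, whereas a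
value in `AU` determines the one in `AV`. -/
lemma Pass.two_mul_numNonzero_le (h : Pass m M k l i A₀ AU AV W K c m) (hc : c < k) (hm : m ≤ M) :
    2 * numNonzero m AV ≤ numNonzero m AU := by
  have hV := h.reducesV hc
  have hU := h.reducesU hc
  have key : ∀ i < M, ∀ j < M, AU i = AU j → AV i = AV j := fun i hi j hj he =>
    (hV.eq_iff hi hj).2 (Submodule.mem_sup_left ((hU.eq_iff hi hj).1 he))
  have key0 : ∀ i < M, AU i = 0 → AV i = 0 := fun i hi he =>
    (hV.eq_zero_iff hi).2 (Submodule.mem_sup_left ((hU.eq_zero_iff hi).1 he))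
  have := card_mul_le_card_mul (s := ((range m).image AV).erase 0)
    (t := ((range m).image AU).erase 0) (fun y x => ∃ i < m, AV i = y ∧ AU i = x) (m := 2) (n := 1)
    ?_ ?_
  · rw [numNonzero, numNonzero]
    omega
  · intro y hy
    obtain ⟨hy0, hy⟩ := mem_erase.1 hy
    obtain ⟨u, hu, rfl⟩ := mem_image.1 hy
    rw [mem_range] at hu
    obtain ⟨i, hi, h₁, h₂⟩ := (h.bad hc u hu).resolve_left hy0
    refine one_lt_card.2 ⟨AU u, ?_, AU i, ?_, h₂.symm⟩
    · simp only [mem_bipartiteAbove, mem_erase, mem_image, mem_range]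
      exact ⟨⟨fun he => hy0 (key0 u (by omega) he), u, hu, rfl⟩, u, hu, rfl, rfl⟩
    · simp only [mem_bipartiteAbove, mem_erase, mem_image, mem_range]
      exact ⟨⟨fun he => hy0 (h₁ ▸ key0 i (by omega) he), i, hi, rfl⟩, i, hi, h₁, rfl⟩
  · intro x hx
    refine card_le_one.2 fun y hy y' hy' => ?_
    simp only [mem_bipartiteBelow] at hy hy'
    obtain ⟨-, i, hi, rfl, hix⟩ := hy
    obtain ⟨-, j, hj, rfl, hjx⟩ := hy'
    exact key i (by omega) j (by omega) (hix.trans hjx.symm)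

end

/-! ### Halving of classes against growth of dimension -/

/-- The invariant of the search between the passes: either a sum-free sequence of length `k` has been
found, or `i < l` passes have failed, each of which halved the number of nonzero rows. -/
def Search (m M k l : ℕ) (A₀ AU AV : ℕ → Fin n → ZMod 2) (K : ℕ → ℕ) (c i : ℕ) : Prop :=
  (c = k ∧ SumFree m A₀ K k) ∨
  (c = 0 ∧ 0 < k ∧ i < l ∧ ∃ W, Reduces M A₀ AU W ∧ Reduces M A₀ AV W ∧
    2 ^ i * numNonzero m AU ≤ m ∧ Module.finrank (ZMod 2) W ≤ i * k)

section

variable {m M k l : ℕ} {A₀ AU AV AU' : ℕ → Fin n → ZMod 2}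
  {W : Submodule (ZMod 2) (Fin n → ZMod 2)} {K : ℕ → ℕ} {c i : ℕ}

/-- Were `i = l`, then `2 ^ l` times the number of nonzero classes would be at most `m < 2 ^ l`, so
every row would lie in `W`. But the rows span, and `W` has dimension at most `l * k < n`. -/
lemma lt_of_reduces (hm : m ≤ M) (hspan : Submodule.span (ZMod 2) (A₀ '' Set.Iio m) = ⊤)
    (hl : m < 2 ^ l) (hlk : l * k < n) (hU : Reduces M A₀ AU W)
    (hnum : 2 ^ i * numNonzero m AU ≤ m) (hrank : Module.finrank (ZMod 2) W ≤ i * k)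
    (hi : i ≤ l) : i < l := by
  refine lt_of_le_of_ne hi ?_
  rintro rfl
  have h0 : numNonzero m AU = 0 := by
    by_contra h
    have := Nat.le_mul_of_pos_right (2 ^ i) (Nat.pos_of_ne_zero h)
    omega
  have hW : W = ⊤ := by
    rw [eq_top_iff, ← hspan, Submodule.span_le]
    rintro _ ⟨j, hj, rfl⟩
    rw [Set.mem_Iio] at hj
    refine (hU.eq_zero_iff (by omega)).1 ?_
    by_contra h
    rw [numNonzero, card_eq_zero] at h0
    have : AU j ∈ ((range m).image AU).erase 0 :=
      mem_erase.2 ⟨h, mem_image_of_mem _ (mem_range.2 hj)⟩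
    rw [h0] at this
    simp at this
  rw [hW, finrank_top, Module.finrank_fin_fun] at hrank
  omega

lemma Search.init (hm : m ≤ M) (hspan : Submodule.span (ZMod 2) (A₀ '' Set.Iio m) = ⊤)
    (hl : m < 2 ^ l) (hlk : l * k < n) (hAU : ∀ i < M, AU i = A₀ i) (hAV : ∀ i < M, AV i = A₀ i) :
    Search m M k l A₀ AU AV K 0 0 := by
  rcases Nat.eq_zero_or_pos k with rfl | hk
  · exact .inl ⟨rfl, fun t ht => by omega⟩
  · have hU := (Reduces.refl M A₀).congr hAU
    have hV := (Reduces.refl M A₀).congr hAV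
    have hnum : 2 ^ 0 * numNonzero m AU ≤ m := by simpa using numNonzero_le m AU
    have hrank : Module.finrank (ZMod 2) (⊥ : Submodule (ZMod 2) (Fin n → ZMod 2)) ≤ 0 * k := by
      simp
    exact .inr ⟨rfl, hk, lt_of_reduces hm hspan hl hlk hU hnum hrank (by omega), ⊥, hU, hV, hnum,
      hrank⟩

/-- Once `k` rows have been found, the remaining passes run idly: all conditions on `W` assume `c <
k`, and any subspace will do. -/
lemma Search.pass_init (h : Search m M k l A₀ AU AV K c i) :
    ∃ W, Pass m M k l i A₀ AU AV W K c 0 := by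
  rcases h with ⟨rfl, h⟩ | ⟨rfl, hk, hi, W, hU, hV, hnum, hrank⟩
  · exact ⟨⊥, ⟨le_rfl, h, fun h => by omega, fun h => by omega, fun h => by omega,
      fun h => by omega, fun h => by omega⟩⟩
  · refine ⟨W, ⟨by omega, fun t ht => by omega, fun _ => hU, fun _ => ?_, fun _ => ?_,
      fun _ => ⟨hi, hnum, hrank⟩, fun _ u hu => by omega⟩⟩
    · rwa [rowSpan_zero, sup_bot_eq]
    · rw [rowSpan_zero]
      exact disjoint_bot_right

lemma Pass.search_of_eq (h : Pass m M k l i A₀ AU AV W K c m) (hc : ¬ c < k) :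
    Search m M k l A₀ AU AV K c (i + 1) := by
  have : c = k := le_antisymm h.le (by omega)
  exact .inl ⟨this, this ▸ h.sumFree⟩

/-- After a failed pass its incomplete sequence, of fewer than `k` rows, is absorbed into `W` and
the count restarts at zero. -/
lemma Pass.search_of_lt (h : Pass m M k l i A₀ AU AV W K c m) (hc : c < k) (hm : m ≤ M)
    (hspan : Submodule.span (ZMod 2) (A₀ '' Set.Iio m) = ⊤) (hl : m < 2 ^ l) (hlk : l * k < n)
    (hU' : ∀ i < M, AU' i = AV i) :
    Search m M k l A₀ AU' AV K 0 (i + 1) := by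
  obtain ⟨hi, hnum, hrank⟩ := h.failed hc
  have hV := h.reducesV hc
  have hU := hV.congr hU'
  have hnum' : 2 ^ (i + 1) * numNonzero m AU' ≤ m := by
    rw [numNonzero_congr fun i hi => hU' i (by omega), pow_succ, mul_assoc]
    exact (Nat.mul_le_mul_left _ (h.two_mul_numNonzero_le hc hm)).trans hnum
  have hrank' : Module.finrank (ZMod 2) ↥(W ⊔ rowSpan A₀ K c) ≤ (i + 1) * k := by
    have h₁ := Submodule.finrank_add_le_finrank_add_finrank W (rowSpan A₀ K c)
    have h₂ := finrank_rowSpan_le A₀ K c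
    rw [Nat.succ_mul]
    omega
  exact .inr ⟨rfl, by omega, lt_of_reduces hm hspan hl hlk hU hnum' hrank' hi, _, hU, hV, hnum',
    hrank'⟩

/-- For positive `k`, fewer than `l ≤ l * k < n` passes can fail. So `n` passes always suffice, and
the program need not know `l`. -/
lemma Search.sumFree (h : Search m M k l A₀ AU AV K c n) (hlk : l * k < n) :
    c = k ∧ SumFree m A₀ K k := by
  rcases h with h | ⟨-, hk, hi, -⟩
  · exact h
  · have := Nat.le_mul_of_pos_right l hk
    omega

end

end MaxLin

/-! ## The program -/

namespace MaxLin

open Finset Matrix LoopLang LoopLang.Stmt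

/-- Sequential composition. -/
local notation:60 P:61 ";;" Q:60 => Stmt.seq P Q

local notation "v_k" => (0 : ℕ)
local notation "v_n" => (1 : ℕ)
local notation "v_m" => (2 : ℕ)
local notation "v_width" => (3 : ℕ)
local notation "v_rows" => (4 : ℕ)
local notation "v_last" => (5 : ℕ)
local notation "v_pow" => (6 : ℕ)
local notation "v_r" => (7 : ℕ)
local notation "v_q" => (8 : ℕ)
local notation "v_j" => (9 : ℕ)
local notation "v_piv" => (10 : ℕ)
local notation "v_nz" => (11 : ℕ)
local notation "v_eq" => (12 : ℕ)
local notation "v_pos" => (13 : ℕ)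
local notation "v_neg" => (14 : ℕ)
local notation "v_c" => (15 : ℕ)
local notation "v_good" => (16 : ℕ)
local notation "v_cnt" => (17 : ℕ)
local notation "v_it" => (18 : ℕ)
local notation "v_par" => (19 : ℕ)
local notation "v_found" => (20 : ℕ)
local notation "v_carry" => (21 : ℕ)
local notation "v_off" => (22 : ℕ)
local notation "a_X" => (0 : ℕ)
local notation "a_U" => (1 : ℕ)
local notation "a_V" => (2 : ℕ)
local notation "a_T" => (3 : ℕ)
local notation "a_K" => (4 : ℕ)
local notation "a_Z" => (5 : ℕ)

@[simp] lemma run_skip (s : Store) : Stmt.skip.run s = s := rfl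
@[simp] lemma run_assign (v : ℕ) (e : Expr) (s : Store) :
    (assign v e).run s = s.setVar v (e.eval s) := rfl
@[simp] lemma run_write (a : ℕ) (i e : Expr) (s : Store) :
    (write a i e).run s = s.setArr a (i.eval s) (e.eval s) := rfl
@[simp] lemma run_output (i e : Expr) (s : Store) :
    (output i e).run s = s.setCell (i.eval s) (e.eval s) := rfl
@[simp] lemma run_seq (P Q : Stmt) (s : Store) : (P ;; Q).run s = Q.run (P.run s) := rfl
@[simp] lemma run_ifLt (e f : Expr) (P Q : Stmt) (s : Store) :
    (ifLt e f P Q).run s = if e.eval s < f.eval s then P.run s else Q.run s := rfl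

instance : Add Expr := ⟨.add⟩
instance : Sub Expr := ⟨.sub⟩

/-- The sum modulo two of two bits. -/
def bxor (e f : Expr) : Expr := e - f + (f - e)

@[simp] lemma eval_const (c : ℕ) (s : Store) : (Expr.const c).eval s = c := rfl
@[simp] lemma eval_add (e f : Expr) (s : Store) : (e + f).eval s = e.eval s + f.eval s := rfl
@[simp] lemma eval_sub (e f : Expr) (s : Store) : (e - f).eval s = e.eval s - f.eval s := rfl
@[simp] lemma eval_var (v : ℕ) (s : Store) : (Expr.var v).eval s = s.var v := rfl
@[simp] lemma eval_read (a : ℕ) (e : Expr) (s : Store) :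
    (Expr.read a e).eval s = s.arr a (e.eval s) := rfl
@[simp] lemma eval_input (e : Expr) (s : Store) :
    (Expr.input e).eval s = if e.eval s < s.len then s.io (e.eval s) else 0 := rfl
@[simp] lemma eval_bxor (e f : Expr) (s : Store) :
    (bxor e f).eval s = e.eval s - f.eval s + (f.eval s - e.eval s) := rfl

lemma cast_bxor {x y : ℕ} (hx : x ≤ 1) (hy : y ≤ 1) :
    ((x - y + (y - x) : ℕ) : ZMod 2) = x + y := by
  interval_cases x <;> interval_cases y <;> decide

lemma bxor_le_one {x y : ℕ} (hx : x ≤ 1) (hy : y ≤ 1) : x - y + (y - x) ≤ 1 := by omega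

lemma cast_inj_of_le_one {x y : ℕ} (hx : x ≤ 1) (hy : y ≤ 1) : (x : ZMod 2) = y ↔ x = y := by
  interval_cases x <;> interval_cases y <;> decide

/-! ### Matrices in arrays -/

/-- The coefficients of the `i`-th equation. -/
def rowOf (n : ℕ) (f : ℕ → ℕ) (i : ℕ) : Fin n → ZMod 2 := fun j => (f (i * (n + 2) + j) : ZMod 2)

/-- The right-hand side of the `i`-th equation. -/
def rhsOf (n : ℕ) (f : ℕ → ℕ) (i : ℕ) : ZMod 2 := (f (i * (n + 2) + n) : ZMod 2)

/-- The weight of the `i`-th equation. -/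
def weightOf (n : ℕ) (f : ℕ → ℕ) (i : ℕ) : ℕ := f (i * (n + 2) + (n + 1))

/-- The coefficients and right-hand sides of the first `M` equations are bits. -/
def Bits (n M : ℕ) (f : ℕ → ℕ) : Prop := ∀ i < M, ∀ j ≤ n, f (i * (n + 2) + j) ≤ 1

lemma rowOf_eq_iff {n M : ℕ} {f g : ℕ → ℕ} (hf : Bits n M f) (hg : Bits n M g) {i i' : ℕ}
    (hi : i < M) (hi' : i' < M) : rowOf n f i = rowOf n g i' ↔
      ∀ j < n, f (i * (n + 2) + j) = g (i' * (n + 2) + j) := by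
  constructor
  · intro h j hj
    have := congrFun h ⟨j, hj⟩
    exact (cast_inj_of_le_one (hf i hi j hj.le) (hg i' hi' j hj.le)).1 this
  · intro h
    funext j
    simp only [rowOf, h j j.2]

lemma rowOf_eq_zero_iff {n M : ℕ} {f : ℕ → ℕ} (hf : Bits n M f) {i : ℕ} (hi : i < M) :
    rowOf n f i = 0 ↔ ∀ j < n, f (i * (n + 2) + j) = 0 := by
  constructor
  · intro h j hj
    have := congrFun h ⟨j, hj⟩
    exact (cast_inj_of_le_one (hf i hi j hj.le) zero_le_one).1 (by simpa [rowOf] using this)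
  · intro h
    funext j
    simp [rowOf, h j j.2]

/-- Rows have width `n + 2`: coefficients, right-hand side, weight. Row operations act on the first
`n + 1` entries and spare the weight. -/
lemma index_mem_iff {n i i' j : ℕ} (hj : j < n + 2) :
    (i * (n + 2) ≤ i' * (n + 2) + j ∧ i' * (n + 2) + j < i * (n + 2) + (n + 1)) ↔
      i' = i ∧ j < n + 1 := by
  constructor
  · rintro ⟨h₁, h₂⟩
    rcases lt_trichotomy i' i with h | h | h
    · have := Nat.mul_le_mul_right (n + 2) (Nat.succ_le_of_lt h)
      rw [Nat.succ_mul] at this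
      omega
    · subst h
      omega
    · have := Nat.mul_le_mul_right (n + 2) (Nat.succ_le_of_lt h)
      rw [Nat.succ_mul] at this
      omega
  · rintro ⟨rfl, h⟩
    omega

/-- The parameters of the instance are in their variables. -/
structure Params (n m k : ℕ) (s : Store) : Prop where
  var_k : s.var v_k = k
  var_n : s.var v_n = n
  var_m : s.var v_m = m
  var_width : s.var v_width = n + 2
  var_rows : s.var v_rows = m + n
  var_last : s.var v_last = n + 1

lemma Params.frame {n m k : ℕ} {s t : Store} {P : Stmt} (h : Params n m k s) (hF : Frame P s t)
    (hP : ∀ v < 6, v ∉ P.writtenVars) : Params n m k t where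
  var_k := (hF.var _ (hP _ (by decide))).trans h.var_k
  var_n := (hF.var _ (hP _ (by decide))).trans h.var_n
  var_m := (hF.var _ (hP _ (by decide))).trans h.var_m
  var_width := (hF.var _ (hP _ (by decide))).trans h.var_width
  var_rows := (hF.var _ (hP _ (by decide))).trans h.var_rows
  var_last := (hF.var _ (hP _ (by decide))).trans h.var_last

lemma Params.setVar {n m k : ℕ} {s : Store} (h : Params n m k s) {v : ℕ} (hv : 6 ≤ v) (x : ℕ) :
    Params n m k (s.setVar v x) where
  var_k := by rw [Store.var_setVar, if_neg (by omega), h.var_k]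
  var_n := by rw [Store.var_setVar, if_neg (by omega), h.var_n]
  var_m := by rw [Store.var_setVar, if_neg (by omega), h.var_m]
  var_width := by rw [Store.var_setVar, if_neg (by omega), h.var_width]
  var_rows := by rw [Store.var_setVar, if_neg (by omega), h.var_rows]
  var_last := by rw [Store.var_setVar, if_neg (by omega), h.var_last]

/-! ### Elimination -/

/-- Find a nonzero entry of the row `v_r` of `V`. -/
def findPivot : Stmt :=
  assign v_nz (.const 0) ;;
  loop v_j v_n (.const 1) (ifLt (.const 0) (.read a_V (.var v_r + .var v_j))
    (assign v_piv (.var v_j) ;; assign v_nz (.const 1)) skip)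

lemma findPivot_spec (s : Store) :
    ((findPivot.run s).var v_nz = 0 ∧ ∀ j < s.var v_n, s.arr a_V (s.var v_r + j) = 0) ∨
    ((findPivot.run s).var v_nz = 1 ∧ (findPivot.run s).var v_piv < s.var v_n ∧
      0 < s.arr a_V (s.var v_r + (findPivot.run s).var v_piv)) := by
  rw [findPivot, run_seq, run_assign]
  have := loop_induct (v := v_j) (b := v_n) (st := .const 1)
    (P := ifLt (.const 0) (.read a_V (.var v_r + .var v_j))
    (assign v_piv (.var v_j) ;; assign v_nz (.const 1)) skip) (s.setVar v_nz 0)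
    (fun i t => (t.var v_nz = 0 ∧ ∀ j < i, s.arr a_V (s.var v_r + j) = 0) ∨
      (t.var v_nz = 1 ∧ t.var v_piv < s.var v_n ∧ 0 < s.arr a_V (s.var v_r + t.var v_piv)))
    (by simp) ?_
  · simpa using this
  · intro i t hi hF ht
    have hr : t.var v_r = s.var v_r := hF.var _ (by decide)
    have hV : t.arr a_V = s.arr a_V := hF.arr _ (by decide)
    have hi' : i < s.var v_n := by simpa using hi
    by_cases h : 0 < s.arr a_V (s.var v_r + i)
    · right
      simp [hr, hV, h, hi']
    · have h' : s.arr a_V (s.var v_r + i) = 0 := by omega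
      rcases ht with ⟨h0, hz⟩ | ⟨h1, h2, h3⟩
      · refine .inl ⟨by simp [hr, hV, h', h0], fun j hj => ?_⟩
        rcases Nat.lt_succ_iff_lt_or_eq.1 hj with hj | rfl
        · exact hz j hj
        · exact h'
      · right
        simp [hr, hV, h', h1, h2, h3]

/-- Compare the rows `v_r` and `v_q` of the array `a`. -/
def compareRows (a : ℕ) : Stmt :=
  assign v_eq (.const 1) ;;
  loop v_j v_n (.const 1) (ifLt (.const 0)
    (bxor (.read a (.var v_r + .var v_j)) (.read a (.var v_q + .var v_j)))
    (assign v_eq (.const 0)) skip)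

lemma compareRows_spec (a : ℕ) (s : Store) :
    (((compareRows a).run s).var v_eq = 1 ∧
      ∀ j < s.var v_n, s.arr a (s.var v_r + j) = s.arr a (s.var v_q + j)) ∨
    (((compareRows a).run s).var v_eq = 0 ∧
      ¬ ∀ j < s.var v_n, s.arr a (s.var v_r + j) = s.arr a (s.var v_q + j)) := by
  rw [compareRows, run_seq, run_assign]
  have := loop_induct (v := v_j) (b := v_n) (st := .const 1)
    (P := ifLt (.const 0) (bxor (.read a (.var v_r + .var v_j)) (.read a (.var v_q + .var v_j)))
      (assign v_eq (.const 0)) skip) (s.setVar v_eq 1)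
    (fun i t => (t.var v_eq = 1 ∧ ∀ j < i, s.arr a (s.var v_r + j) = s.arr a (s.var v_q + j)) ∨
      (t.var v_eq = 0 ∧ ¬ ∀ j < i, s.arr a (s.var v_r + j) = s.arr a (s.var v_q + j)))
    (by simp) ?_
  · simpa using this
  · intro i t hi hF ht
    have hr : t.var v_r = s.var v_r := hF.var _ (by simp [writtenVars])
    have hq : t.var v_q = s.var v_q := hF.var _ (by simp [writtenVars])
    have hV : t.arr a = s.arr a := hF.arr _ (by simp [writtenArrs])
    by_cases h : s.arr a (s.var v_r + i) = s.arr a (s.var v_q + i)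
    · rcases ht with ⟨h1, hz⟩ | ⟨h0, hz⟩
      · refine .inl ⟨by simp [hr, hq, hV, h, h1], fun j hj => ?_⟩
        rcases Nat.lt_succ_iff_lt_or_eq.1 hj with hj | rfl
        · exact hz j hj
        · exact h
      · exact .inr ⟨by simp [hr, hq, hV, h, h0], fun hall => hz fun j hj => hall j (by omega)⟩
    · refine .inr ⟨?_, fun hall => h (hall i (by omega))⟩
      have : 0 < s.arr a (s.var v_r + i) - s.arr a (s.var v_q + i) +
        (s.arr a (s.var v_q + i) - s.arr a (s.var v_r + i)) := by omega
      simp only [run_ifLt, eval_bxor, eval_const, eval_read, eval_add, eval_var, Store.arr_setVar, hV]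
      rw [if_pos (by simpa [hr, hq] using this)]
      simp

/-- For the rows of `V` that are equal to the row `v_r`, add up the weights according to whether
their right-hand sides agree with that of the row `v_r`. -/
def countMajority : Stmt :=
  assign v_pos (.const 0) ;; assign v_neg (.const 0) ;;
  loop v_q v_m (.var v_width) (compareRows a_V ;; ifLt (.const 0) (.var v_eq)
    (ifLt (.const 0) (bxor (.read a_V (.var v_q + .var v_n)) (.read a_V (.var v_r + .var v_n)))
      (assign v_neg (.var v_neg + .read a_V (.var v_q + .var v_last)))
      (assign v_pos (.var v_pos + .read a_V (.var v_q + .var v_last)))) skip)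

/-- Only the first `m` rows vote; the unit rows behind them are transformed but carry no weight.
Signs are taken relative to the right-hand side of row `r`, and the difference is formed only in
`ℤ`. -/
lemma countMajority_spec {n m k r : ℕ} {s : Store} (hs : Params n m k s)
    (hf : Bits n (m + n) (s.arr a_V)) (hr : r < m) (hvr : s.var v_r = r * (n + 2)) :
    ((countMajority.run s).var v_pos : ℤ) - (countMajority.run s).var v_neg =
      ∑ i ∈ range m with rowOf n (s.arr a_V) i = rowOf n (s.arr a_V) r,
        sgn (rhsOf n (s.arr a_V) i + rhsOf n (s.arr a_V) r) * weightOf n (s.arr a_V) i := by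
  rw [countMajority, run_seq, run_seq, run_assign, run_assign]
  set s₀ := ((s.setVar v_pos ((Expr.const 0).eval s)).setVar v_neg
    ((Expr.const 0).eval (s.setVar v_pos ((Expr.const 0).eval s)))) with hs₀
  have hp₀ : Params n m k s₀ := (hs.setVar (by decide) _).setVar (by decide) _
  have hw : (Expr.var v_width).eval s₀ = n + 2 := hp₀.var_width
  have := loop_induct (v := v_q) (b := v_m) (st := .var v_width) (P := compareRows a_V ;;
    ifLt (.const 0) (.var v_eq)
    (ifLt (.const 0) (bxor (.read a_V (.var v_q + .var v_n)) (.read a_V (.var v_r + .var v_n)))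
      (assign v_neg (.var v_neg + .read a_V (.var v_q + .var v_last)))
      (assign v_pos (.var v_pos + .read a_V (.var v_q + .var v_last)))) skip) s₀
    (fun i t => (t.var v_pos : ℤ) - t.var v_neg =
      ∑ i ∈ range i with rowOf n (s.arr a_V) i = rowOf n (s.arr a_V) r,
        sgn (rhsOf n (s.arr a_V) i + rhsOf n (s.arr a_V) r) * weightOf n (s.arr a_V) i)
    (by simp [hs₀]) ?_
  · rwa [hp₀.var_m] at this
  · intro i t hi hF ht
    rw [hp₀.var_m] at hi
    rw [hw, run_seq]
    have hpt : Params n m k (t.setVar v_q (i * (n + 2))) :=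
      (hp₀.frame hF (by decide)).setVar (by decide) _
    have hV : t.arr a_V = s.arr a_V := hF.arr _ (by decide)
    have hspec := compareRows_spec a_V (t.setVar v_q (i * (n + 2)))
    have hFc := (compareRows a_V).frame (t.setVar v_q (i * (n + 2)))
    set u := (compareRows a_V).run (t.setVar v_q (i * (n + 2))) with hu
    have hpu := hpt.frame hFc (by decide)
    have uV : u.arr a_V = s.arr a_V := (hFc.arr _ (by decide)).trans hV
    have tr : t.var v_r = r * (n + 2) := (hF.var _ (by decide)).trans (by simp [hs₀, hvr])
    have ur : u.var v_r = r * (n + 2) := (hFc.var _ (by decide)).trans (by simp [tr])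
    have uq : u.var v_q = i * (n + 2) := (hFc.var _ (by decide)).trans (by simp)
    have up : u.var v_pos = t.var v_pos := (hFc.var _ (by decide)).trans (by simp)
    have un : u.var v_neg = t.var v_neg := (hFc.var _ (by decide)).trans (by simp)
    rw [hpt.var_n] at hspec
    simp only [Store.arr_setVar, hV, Store.var_setVar, if_true, tr] at hspec
    rw [sum_filter] at ht ⊢
    rw [sum_range_succ, ← ht]
    rcases hspec with ⟨he, heq⟩ | ⟨he, hne⟩
    · have hrow : rowOf n (s.arr a_V) i = rowOf n (s.arr a_V) r :=
        (rowOf_eq_iff hf hf (by omega) (by omega)).2 fun j hj => by simpa using (heq j hj).symm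
      rw [if_pos hrow]
      have hbi := hf i (by omega) n le_rfl
      have hbr := hf r (by omega) n le_rfl
      by_cases hb : s.arr a_V (i * (n + 2) + n) = s.arr a_V (r * (n + 2) + n)
      · have : rhsOf n (s.arr a_V) i + rhsOf n (s.arr a_V) r = 0 := by
          rw [rhsOf, rhsOf, hb]
          exact CharTwo.add_self_eq_zero _
        simp only [run_ifLt, eval_const, eval_var, he, eval_bxor, eval_read, eval_add, uV, uq, ur,
          hpu.var_n, hb]
        simp [run_assign, uV, uq, hpu.var_last, up, un, this, sgn, weightOf]
        ring
      · have : rhsOf n (s.arr a_V) i + rhsOf n (s.arr a_V) r ≠ 0 := by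
          rw [rhsOf, rhsOf, Ne, CharTwo.add_eq_zero, cast_inj_of_le_one hbi hbr]
          exact hb
        have hx : 0 < s.arr a_V (i * (n + 2) + n) - s.arr a_V (r * (n + 2) + n) +
          (s.arr a_V (r * (n + 2) + n) - s.arr a_V (i * (n + 2) + n)) := by omega
        simp only [run_ifLt, eval_const, eval_var, he, eval_bxor, eval_read, eval_add, uV, uq, ur,
          hpu.var_n, if_pos hx]
        simp [run_assign, uV, uq, hpu.var_last, up, un, this, sgn, weightOf]
        ring
    · have hrow : rowOf n (s.arr a_V) i ≠ rowOf n (s.arr a_V) r := fun h =>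
        hne fun j hj => by
          simpa using ((rowOf_eq_iff hf hf (by omega) (by omega)).1 h j hj).symm
      rw [if_neg hrow]
      simp [he, up, un]

/-- Save the row `v_r` of `V` in `T`, with right-hand side `v_c`. -/
def saveRow : Stmt :=
  loop v_j v_n (.const 1) (write a_T (.var v_j) (.read a_V (.var v_r + .var v_j))) ;;
  write a_T (.var v_n) (.var v_c)

/-- The pivot row is itself among the rows that elimination changes, so it has to be saved together
with the chosen right-hand side. -/
lemma saveRow_spec (s : Store) :
    (∀ j < s.var v_n, (saveRow.run s).arr a_T j = s.arr a_V (s.var v_r + j)) ∧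
      (saveRow.run s).arr a_T (s.var v_n) = s.var v_c := by
  rw [saveRow, run_seq]
  have := loop_induct (v := v_j) (b := v_n) (st := .const 1)
    (P := write a_T (.var v_j) (.read a_V (.var v_r + .var v_j))) s
    (fun i t => ∀ j < i, t.arr a_T j = s.arr a_V (s.var v_r + j)) (by simp) ?_
  · have hF := (loop v_j v_n (.const 1)
      (write a_T (.var v_j) (.read a_V (.var v_r + .var v_j)))).frame s
    have hn := hF.var v_n (by decide)
    have hc := hF.var v_c (by decide)
    constructor
    · intro j hj
      rw [run_write, Store.arr_setArr, if_pos rfl, eval_var, hn, Function.update_of_ne (by omega),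
        this j hj]
    · rw [run_write, Store.arr_setArr, if_pos rfl, eval_var, hn, Function.update_self, eval_var, hc]
  · intro i t hi hF ht j hj
    have hr : t.var v_r = s.var v_r := hF.var _ (by decide)
    have hV : t.arr a_V = s.arr a_V := hF.arr _ (by decide)
    by_cases h : j = i
    · subst h
      simp [hr, hV]
    · simp [h, ht j (by omega)]

/-- Add the row saved in `T` to the row `v_q` of `V`. -/
def addRow : Stmt :=
  loop v_j v_last (.const 1) (write a_V (.var v_q + .var v_j)
    (bxor (.read a_V (.var v_q + .var v_j)) (.read a_T (.var v_j))))

lemma addRow_spec (s : Store) (x : ℕ) : (addRow.run s).arr a_V x =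
    if s.var v_q ≤ x ∧ x < s.var v_q + s.var v_last then
      s.arr a_V x - s.arr a_T (x - s.var v_q) + (s.arr a_T (x - s.var v_q) - s.arr a_V x)
    else s.arr a_V x := by
  rw [addRow]
  have := loop_induct (v := v_j) (b := v_last) (st := .const 1)
    (P := write a_V (.var v_q + .var v_j)
      (bxor (.read a_V (.var v_q + .var v_j)) (.read a_T (.var v_j)))) s
    (fun i t => ∀ x, t.arr a_V x = if s.var v_q ≤ x ∧ x < s.var v_q + i then
      s.arr a_V x - s.arr a_T (x - s.var v_q) + (s.arr a_T (x - s.var v_q) - s.arr a_V x)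
      else s.arr a_V x) ?_ ?_
  · exact this x
  · intro x
    rw [if_neg (by omega)]
  · intro i t hi hF ht x
    have hq : t.var v_q = s.var v_q := hF.var _ (by decide)
    have hT : t.arr a_T = s.arr a_T := hF.arr _ (by decide)
    have h₁ := ht (s.var v_q + i)
    rw [if_neg (by omega)] at h₁
    have h₂ := ht x
    by_cases hx : x = s.var v_q + i
    · subst hx
      rw [if_pos (by omega)]
      simp [hq, hT, h₁]
    · have : (s.var v_q ≤ x ∧ x < s.var v_q + (i + 1)) ↔ (s.var v_q ≤ x ∧ x < s.var v_q + i) := by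
        omega
      simp only [this]
      rw [← h₂]
      simp [hq, Function.update_of_ne hx]

/-- Add the row saved in `T` to all rows of `V` with a nonzero entry in the column `v_piv`. -/
def eliminate : Stmt :=
  loop v_q v_rows (.var v_width)
    (ifLt (.const 0) (.read a_V (.var v_q + .var v_piv)) addRow skip)

lemma eliminate_spec {n m k : ℕ} {s : Store} (hs : Params n m k s) (hpiv : s.var v_piv < n) {i j : ℕ}
    (hj : j < n + 2) : (eliminate.run s).arr a_V (i * (n + 2) + j) =
      if i < m + n ∧ 0 < s.arr a_V (i * (n + 2) + s.var v_piv) ∧ j < n + 1 then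
        s.arr a_V (i * (n + 2) + j) - s.arr a_T j + (s.arr a_T j - s.arr a_V (i * (n + 2) + j))
      else s.arr a_V (i * (n + 2) + j) := by
  rw [eliminate]
  have hw : (Expr.var v_width).eval s = n + 2 := hs.var_width
  have := loop_induct (v := v_q) (b := v_rows) (st := .var v_width)
    (P := ifLt (.const 0) (.read a_V (.var v_q + .var v_piv)) addRow skip) s
    (fun l t => ∀ i j, j < n + 2 → t.arr a_V (i * (n + 2) + j) =
      if i < l ∧ 0 < s.arr a_V (i * (n + 2) + s.var v_piv) ∧ j < n + 1 then
        s.arr a_V (i * (n + 2) + j) - s.arr a_T j + (s.arr a_T j - s.arr a_V (i * (n + 2) + j))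
      else s.arr a_V (i * (n + 2) + j)) ?_ ?_
  · rw [hs.var_rows] at this
    exact this i j hj
  · intro i j _
    rw [if_neg (by omega)]
  · intro l t hl hF ht i j hj
    rw [hw]
    have hpt : Params n m k (t.setVar v_q (l * (n + 2))) :=
      (hs.frame hF (by decide)).setVar (by decide) _
    have hp : t.var v_piv = s.var v_piv := hF.var _ (by decide)
    have hT : t.arr a_T = s.arr a_T := hF.arr _ (by decide)
    -- Row `l` has not been reached yet, so the test sees its original pivot entry.
    have h₁ := ht l (s.var v_piv) (by omega)
    rw [if_neg (by omega)] at h₁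
    have h₂ := ht i j hj
    have hcond : (0 < (t.setVar v_q (l * (n + 2))).arr a_V
        ((t.setVar v_q (l * (n + 2))).var v_q + (t.setVar v_q (l * (n + 2))).var v_piv)) ↔
        0 < s.arr a_V (l * (n + 2) + s.var v_piv) := by
      simp [hp, h₁]
    simp only [run_ifLt, eval_const, eval_read, eval_add, eval_var, hcond, run_skip]
    by_cases hc : 0 < s.arr a_V (l * (n + 2) + s.var v_piv)
    · rw [if_pos hc, addRow_spec, hpt.var_last]
      simp only [Store.var_setVar, if_true, Store.arr_setVar, index_mem_iff hj, hT]
      by_cases hil : i = l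
      · subst hil
        rw [if_neg (by omega)] at h₂
        rw [h₂, Nat.add_sub_cancel_left]
        simp [hc]
      · rw [if_neg (by omega), h₂]
        have : i < l + 1 ↔ i < l := by omega
        simp only [this]
    · rw [if_neg hc, Store.arr_setVar, h₂]
      by_cases hil : i = l
      · subst hil
        simp [hc]
      · have : i < l + 1 ↔ i < l := by omega
        simp only [this]

/-- Eliminate with the row `v_r` of `V`, if it is not zero. -/
def process : Stmt :=
  findPivot ;;
  ifLt (.const 0) (.var v_nz)
    (countMajority ;; assign v_c (.read a_V (.var v_r + .var v_n)) ;;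
      ifLt (.var v_pos) (.var v_neg) (assign v_c (.const 1 - .var v_c)) skip ;;
      saveRow ;; eliminate) skip

/-- The interface between program and linear algebra: from here on only `Clears` is used. That the
weights survive is recorded separately, since they are read from the same array. -/
lemma process_spec {n m k r : ℕ} {s : Store} (hs : Params n m k s)
    (hf : Bits n (m + n) (s.arr a_V)) (hr : r < m) (hvr : s.var v_r = r * (n + 2)) :
    Bits n (m + n) ((process.run s).arr a_V) ∧
    weightOf n ((process.run s).arr a_V) = weightOf n (s.arr a_V) ∧
    Clears m (m + n) (weightOf n (s.arr a_V)) (rowOf n (s.arr a_V)) (rhsOf n (s.arr a_V)) r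
      (rowOf n ((process.run s).arr a_V)) (rhsOf n ((process.run s).arr a_V)) := by
  rw [process, run_seq, run_ifLt]
  have hspec := findPivot_spec s
  have hF₁ := findPivot.frame s
  set s₁ := findPivot.run s
  have hp₁ := hs.frame hF₁ (by decide)
  have V₁ : s₁.arr a_V = s.arr a_V := hF₁.arr _ (by decide)
  have r₁ : s₁.var v_r = r * (n + 2) := (hF₁.var _ (by decide)).trans hvr
  rw [hs.var_n, hvr] at hspec
  rcases hspec with ⟨hnz, hz⟩ | ⟨hnz, hpiv, hpos⟩
  · rw [if_neg (by simp [hnz]), run_skip, V₁]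
    exact ⟨hf, rfl, .inl ⟨(rowOf_eq_zero_iff hf (by omega)).2 hz, fun i hi => ⟨rfl, rfl⟩⟩⟩
  · rw [if_pos (by simp [hnz]), run_seq, run_seq, run_seq, run_seq]
    have hmaj := countMajority_spec hp₁ (V₁ ▸ hf) hr r₁
    have hF₂ := countMajority.frame s₁
    set s₂ := countMajority.run s₁
    have hp₂ := hp₁.frame hF₂ (by decide)
    have V₂ : s₂.arr a_V = s.arr a_V := (hF₂.arr _ (by decide)).trans V₁
    have r₂ : s₂.var v_r = r * (n + 2) := (hF₂.var _ (by decide)).trans r₁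
    have p₂ : s₂.var v_piv = s₁.var v_piv := hF₂.var _ (by decide)
    rw [V₁] at hmaj
    set f := s.arr a_V with hfdef
    have hbr := hf r (by omega) n le_rfl
    -- the choice of the right-hand side
    obtain ⟨s₃, hs₃, hp₃, V₃, r₃, p₃, c₃, hc₃⟩ : ∃ s₃, (ifLt (.var v_pos) (.var v_neg)
        (assign v_c (.const 1 - .var v_c)) skip).run
          ((assign v_c (.read a_V (.var v_r + .var v_n))).run s₂) = s₃ ∧ Params n m k s₃ ∧
        s₃.arr a_V = f ∧ s₃.var v_r = r * (n + 2) ∧ s₃.var v_piv = s₁.var v_piv ∧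
        s₃.var v_c ≤ 1 ∧ 0 ≤ ∑ i ∈ range m with rowOf n f i = rowOf n f r,
          sgn (rhsOf n f i + (s₃.var v_c : ZMod 2)) * weightOf n f i := by
      refine ⟨_, rfl, ?_, ?_⟩
      · refine Params.frame (P := assign v_c (.read a_V (.var v_r + .var v_n)) ;;
          ifLt (.var v_pos) (.var v_neg) (assign v_c (.const 1 - .var v_c)) skip) hp₂ ?_ (by decide)
        exact Stmt.frame _ _
      · by_cases hlt : s₂.var v_pos < s₂.var v_neg
        · simp only [run_ifLt, run_assign, eval_var, Store.var_setVar, Nat.reduceEqDiff, if_false,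
            hlt, if_true, eval_sub, eval_const, Store.arr_setVar, V₂, r₂, p₂, eval_read, eval_add,
            hp₂.var_n]
          refine ⟨trivial, trivial, trivial, by omega, ?_⟩
          -- The row's own right-hand side is outvoted; the opposite bit reverses every sign and
          -- makes the sum nonnegative.
          have h₁ : ((1 - f (r * (n + 2) + n) : ℕ) : ZMod 2) = rhsOf n f r + 1 := by
            rw [rhsOf]
            generalize f (r * (n + 2) + n) = x at hbr
            interval_cases x <;> decide
          rw [h₁]
          simp only [← add_assoc, sgn_add_one, neg_mul, sum_neg_distrib]
          rw [← hmaj]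
          omega
        · simp only [run_ifLt, run_assign, eval_var, Store.var_setVar, Nat.reduceEqDiff, if_false,
            hlt, if_true, run_skip, Store.arr_setVar, V₂, r₂, p₂, eval_read, eval_add, hp₂.var_n]
          refine ⟨trivial, trivial, trivial, hbr, ?_⟩
          change 0 ≤ ∑ i ∈ range m with rowOf n f i = rowOf n f r,
            sgn (rhsOf n f i + rhsOf n f r) * weightOf n f i
          rw [← hmaj]
          omega
    rw [hs₃]
    have hsave := saveRow_spec s₃
    have hF₄ := saveRow.frame s₃
    set s₄ := saveRow.run s₃
    have hp₄ := hp₃.frame hF₄ (by decide)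
    have V₄ : s₄.arr a_V = f := (hF₄.arr _ (by decide)).trans V₃
    have p₄ : s₄.var v_piv = s₁.var v_piv := (hF₄.var _ (by decide)).trans p₃
    rw [hp₃.var_n, V₃, r₃] at hsave
    have hel : ∀ i j, j < n + 2 → _ := fun i j hj =>
      eliminate_spec (i := i) hp₄ (p₄ ▸ hpiv) hj
    rw [V₄, p₄] at hel
    set g := (eliminate.run s₄).arr a_V with hg
    set piv := s₁.var v_piv with hpivdef
    have hT : ∀ j, j ≤ n → s₄.arr a_T j ≤ 1 := by
      intro j hj
      rcases hj.lt_or_eq with hj | rfl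
      · rw [hsave.1 j hj]
        exact hf r (by omega) j hj.le
      · rw [hsave.2]
        exact c₃
    have hone : ∀ i < m + n, rowOf n f i ⟨piv, hpiv⟩ = 1 ↔ 0 < f (i * (n + 2) + piv) := by
      intro i hi
      have := hf i hi piv hpiv.le
      simp only [rowOf]
      generalize f (i * (n + 2) + piv) = x at this
      interval_cases x <;> simp
    refine ⟨?_, ?_, .inr ⟨(s₃.var v_c : ZMod 2), ⟨⟨piv, hpiv⟩, ?_, fun i hi => ⟨?_, ?_⟩⟩, hc₃⟩⟩
    · intro i hi j hj
      rw [hel i j (by omega)]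
      split_ifs
      · exact bxor_le_one (hf i hi j hj) (hT j hj)
      · exact hf i hi j hj
    · funext i
      simp only [weightOf]
      rw [hel i (n + 1) (by omega), if_neg (by omega)]
    · exact (hone r (by omega)).2 hpos
    · funext j
      have hj := j.2
      simp only [hone i hi]
      have h₁ := hel i j (by omega)
      by_cases hc : 0 < f (i * (n + 2) + piv)
      · rw [if_pos ⟨hi, hc, by omega⟩] at h₁
        rw [if_pos hc, rowOf, h₁, cast_bxor (hf i hi j hj.le) (hT j hj.le), hsave.1 j hj]
        rfl
      · rw [if_neg (fun h => hc h.2.1)] at h₁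
        rw [if_neg hc, rowOf, h₁, rowOf]
    · simp only [hone i hi]
      have h₁ := hel i n (by omega)
      by_cases hc : 0 < f (i * (n + 2) + piv)
      · rw [if_pos ⟨hi, hc, by omega⟩] at h₁
        rw [if_pos hc, rhsOf, h₁, cast_bxor (hf i hi n le_rfl) (hT n le_rfl), hsave.2]
        rfl
      · rw [if_neg (fun h => hc h.2.1)] at h₁
        rw [if_neg hc, rhsOf, h₁, rhsOf]

/-! ### The search for a sum-free sequence as a program -/

/-- Copy the rows of the array `a` to the array `b`. -/
def copyRows (a b : ℕ) : Stmt :=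
  loop v_r v_rows (.var v_width) (loop v_j v_width (.const 1)
    (write b (.var v_r + .var v_j) (.read a (.var v_r + .var v_j))))

lemma copyRows_spec {n m k a b : ℕ} (hab : a ≠ b) {s : Store} (hs : Params n m k s) {x : ℕ}
    (hx : x < (m + n) * (n + 2)) : ((copyRows a b).run s).arr b x = s.arr a x := by
  rw [copyRows]
  have hw : (Expr.var v_width).eval s = n + 2 := hs.var_width
  have := loop_induct (v := v_r) (b := v_rows) (st := .var v_width) (P := loop v_j v_width (.const 1)
    (write b (.var v_r + .var v_j) (.read a (.var v_r + .var v_j)))) s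
    (fun i t => ∀ x < i * (n + 2), t.arr b x = s.arr a x) (by simp) ?_
  · rw [hs.var_rows] at this
    exact this x hx
  · intro i t hi hF ht x hx
    rw [hw]
    set t₀ := t.setVar v_r (i * (n + 2)) with ht₀
    have tw : t.var v_width = n + 2 := (hF.var _ (by simp [writtenVars])).trans hs.var_width
    have ta : t.arr a = s.arr a := hF.arr _ (by simp [writtenArrs, hab])
    have := loop_induct (v := v_j) (b := v_width) (st := .const 1)
      (P := write b (.var v_r + .var v_j) (.read a (.var v_r + .var v_j))) t₀
      (fun j u => ∀ x < i * (n + 2) + j, u.arr b x = s.arr a x) (by simpa [ht₀] using ht) ?_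
    · rw [show t₀.var v_width = n + 2 by simp [ht₀, tw]] at this
      exact this x (by rw [Nat.succ_mul] at hx; exact hx)
    · intro j u hj hF' hu x hx
      have ur : u.var v_r = i * (n + 2) :=
        (hF'.var _ (by simp [writtenVars])).trans (by simp [ht₀])
      have ua : u.arr a = s.arr a :=
        (hF'.arr _ (by simp [writtenArrs, hab])).trans (by simp [ht₀, ta])
      by_cases h : x = i * (n + 2) + j
      · subst h
        simp [ur, ua]
      · have := hu x (by omega)
        simp [ur, h, this]

lemma copyRows_index {n m k a b : ℕ} (hab : a ≠ b) {s : Store} (hs : Params n m k s) {i j : ℕ}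
    (hi : i < m + n) (hj : j < n + 2) :
    ((copyRows a b).run s).arr b (i * (n + 2) + j) = s.arr a (i * (n + 2) + j) := by
  refine copyRows_spec hab hs ?_
  have := Nat.mul_le_mul_right (n + 2) (Nat.succ_le_of_lt hi)
  rw [Nat.succ_mul] at this
  omega

lemma copyRows_bits {n m k a b : ℕ} (hab : a ≠ b) {s : Store} (hs : Params n m k s)
    (hf : Bits n (m + n) (s.arr a)) : Bits n (m + n) (((copyRows a b).run s).arr b) := by
  intro i hi j hj
  rw [copyRows_index hab hs hi (by omega)]
  exact hf i hi j hj

lemma copyRows_row {n m k a b : ℕ} (hab : a ≠ b) {s : Store} (hs : Params n m k s) {i : ℕ}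
    (hi : i < m + n) : rowOf n (((copyRows a b).run s).arr b) i = rowOf n (s.arr a) i := by
  funext j
  rw [rowOf, copyRows_index hab hs hi (by omega), rowOf]

/-- Check that any row of `V` that is equal to the row `v_r` is also equal to it in `U`. -/
def checkRow : Stmt :=
  assign v_good (.const 1) ;;
  loop v_q v_m (.var v_width) (compareRows a_V ;; ifLt (.const 0) (.var v_eq)
    (compareRows a_U ;; ifLt (.const 0) (.var v_eq) skip (assign v_good (.const 0))) skip)

lemma checkRow_spec {n m k r : ℕ} {s : Store} (hs : Params n m k s)
    (hU : Bits n (m + n) (s.arr a_U)) (hV : Bits n (m + n) (s.arr a_V)) (hr : r < m)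
    (hvr : s.var v_r = r * (n + 2)) :
    ((checkRow.run s).var v_good = 1 ∧
      ∀ i < m, rowOf n (s.arr a_V) i = rowOf n (s.arr a_V) r →
        rowOf n (s.arr a_U) i = rowOf n (s.arr a_U) r) ∨
    ((checkRow.run s).var v_good = 0 ∧
      ∃ i < m, rowOf n (s.arr a_V) i = rowOf n (s.arr a_V) r ∧
        rowOf n (s.arr a_U) i ≠ rowOf n (s.arr a_U) r) := by
  rw [checkRow, run_seq, run_assign, eval_const]
  have hp₀ : Params n m k (s.setVar v_good 1) := hs.setVar (by decide) _
  have hw : (Expr.var v_width).eval (s.setVar v_good 1) = n + 2 := hp₀.var_width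
  have := loop_induct (v := v_q) (b := v_m) (st := .var v_width) (P := compareRows a_V ;;
    ifLt (.const 0) (.var v_eq)
    (compareRows a_U ;; ifLt (.const 0) (.var v_eq) skip (assign v_good (.const 0))) skip)
    (s.setVar v_good 1)
    (fun l t => (t.var v_good = 1 ∧ ∀ i < l, rowOf n (s.arr a_V) i = rowOf n (s.arr a_V) r →
        rowOf n (s.arr a_U) i = rowOf n (s.arr a_U) r) ∨ (t.var v_good = 0 ∧
      ∃ i < m, rowOf n (s.arr a_V) i = rowOf n (s.arr a_V) r ∧
        rowOf n (s.arr a_U) i ≠ rowOf n (s.arr a_U) r)) (by simp) ?_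
  · rwa [hp₀.var_m] at this
  · intro i t hi hF ht
    rw [hp₀.var_m] at hi
    rw [hw, run_seq, run_ifLt]
    have row : ∀ f, Bits n (m + n) f → (rowOf n f i = rowOf n f r ↔
        ∀ j < n, f (r * (n + 2) + j) = f (i * (n + 2) + j)) := fun f hf => by
      rw [rowOf_eq_iff hf hf (by omega) (by omega)]
      exact forall₂_congr fun _ _ => eq_comm
    set t₀ := t.setVar v_q (i * (n + 2)) with ht₀
    have hpt : Params n m k t₀ := (hp₀.frame hF (by decide)).setVar (by decide) _
    have tV : t₀.arr a_V = s.arr a_V := hF.arr _ (by decide)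
    have tU : t₀.arr a_U = s.arr a_U := hF.arr _ (by decide)
    have tr : t₀.var v_r = r * (n + 2) := by
      simp [ht₀, (hF.var v_r (by decide)).trans (by simpa using hvr)]
    have tq : t₀.var v_q = i * (n + 2) := by simp [ht₀]
    have tg : t₀.var v_good = t.var v_good := by simp [ht₀]
    have hspec := compareRows_spec a_V t₀
    have hFc := (compareRows a_V).frame t₀
    set u := (compareRows a_V).run t₀
    have hpu := hpt.frame hFc (by decide)
    have uU : u.arr a_U = s.arr a_U := (hFc.arr _ (by decide)).trans tU
    have ur : u.var v_r = r * (n + 2) := (hFc.var _ (by decide)).trans tr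
    have uq : u.var v_q = i * (n + 2) := (hFc.var _ (by decide)).trans tq
    have ug : u.var v_good = t.var v_good := (hFc.var _ (by decide)).trans tg
    rw [hpt.var_n, tV, tr, tq, ← row _ hV] at hspec
    rcases hspec with ⟨he, heq⟩ | ⟨he, hne⟩
    · rw [if_pos (by simp [he]), run_seq, run_ifLt]
      have hspec := compareRows_spec a_U u
      have hFd := (compareRows a_U).frame u
      set u' := (compareRows a_U).run u
      have ug' : u'.var v_good = t.var v_good := (hFd.var _ (by decide)).trans ug
      rw [hpu.var_n, uU, ur, uq, ← row _ hU] at hspec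
      rcases hspec with ⟨he', heq'⟩ | ⟨he', hne'⟩
      · rw [if_pos (by simp [he']), run_skip, ug']
        rcases ht with ⟨hg, hall⟩ | h
        · refine .inl ⟨hg, fun j hj hj' => ?_⟩
          rcases Nat.lt_succ_iff_lt_or_eq.1 hj with hj | rfl
          · exact hall j hj hj'
          · exact heq'
        · exact .inr h
      · rw [if_neg (by simp [he'])]
        exact .inr ⟨by simp, i, hi, heq, hne'⟩
    · rw [if_neg (by simp [he]), run_skip, ug]
      rcases ht with ⟨hg, hall⟩ | h
      · refine .inl ⟨hg, fun j hj hj' => ?_⟩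
        rcases Nat.lt_succ_iff_lt_or_eq.1 hj with hj | rfl
        · exact hall j hj hj'
        · exact absurd hj' hne
      · exact .inr h

/-- Put the row `v_r` into the sequence `K` if the sequence remains sum-free modulo `U`. -/
def examineRow : Stmt :=
  ifLt (.var v_cnt) (.var v_k)
    (findPivot ;; ifLt (.const 0) (.var v_nz)
      (checkRow ;; ifLt (.const 0) (.var v_good)
        (write a_K (.var v_cnt) (.var v_r) ;; assign v_cnt (.var v_cnt + .const 1) ;; process)
        skip) skip) skip

/-- The sequence `K`, of which the array holds the offsets, is in the midst of a pass. -/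
def PassState (n m k l i : ℕ) (A₀ : ℕ → Fin n → ZMod 2)
    (W : Submodule (ZMod 2) (Fin n → ZMod 2)) (pos : ℕ) (s : Store) : Prop :=
  Bits n (m + n) (s.arr a_U) ∧ Bits n (m + n) (s.arr a_V) ∧
  ∃ K : ℕ → ℕ, (∀ t < s.var v_cnt, s.arr a_K t = K t * (n + 2)) ∧
    Pass m (m + n) k l i A₀ (rowOf n (s.arr a_U)) (rowOf n (s.arr a_V)) W K (s.var v_cnt) pos

/-- The tests match `Pass`: a zero row, or one equal in `V` but not in `U` to some other row, is
rejected by `Pass.reject`; any other row meets the hypotheses of `Pass.accept`. -/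
lemma examineRow_spec {n m k l i r : ℕ} {A₀ : ℕ → Fin n → ZMod 2}
    {W : Submodule (ZMod 2) (Fin n → ZMod 2)} {s : Store}
    (hinj : ∀ i < m, ∀ j < m, A₀ i = A₀ j → i = j) (hs : Params n m k s) (hr : r < m)
    (hvr : s.var v_r = r * (n + 2)) (hP : PassState n m k l i A₀ W r s) :
    PassState n m k l i A₀ W (r + 1) (examineRow.run s) := by
  obtain ⟨hU, hV, K, hK, hP⟩ := hP
  rw [examineRow, run_ifLt, eval_var, eval_var, hs.var_k]
  by_cases hc : s.var v_cnt < k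
  swap
  · rw [if_neg hc]
    exact ⟨hU, hV, K, hK, hP.reject fun h => absurd h hc⟩
  rw [if_pos hc, run_seq, run_ifLt]
  have hspec := findPivot_spec s
  have hF₁ := findPivot.frame s
  set s₁ := findPivot.run s
  have hp₁ := hs.frame hF₁ (by decide)
  have V₁ : s₁.arr a_V = s.arr a_V := hF₁.arr _ (by decide)
  have U₁ : s₁.arr a_U = s.arr a_U := hF₁.arr _ (by decide)
  have K₁ : s₁.arr a_K = s.arr a_K := hF₁.arr _ (by decide)
  have c₁ : s₁.var v_cnt = s.var v_cnt := hF₁.var _ (by decide)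
  have r₁ : s₁.var v_r = r * (n + 2) := (hF₁.var _ (by decide)).trans hvr
  rw [hs.var_n, hvr] at hspec
  rcases hspec with ⟨hnz, hz⟩ | ⟨hnz, hpiv, hpos⟩
  · rw [if_neg (by simp [hnz]), run_skip, PassState, V₁, U₁, K₁, c₁]
    exact ⟨hU, hV, K, hK, hP.reject fun _ => .inl ((rowOf_eq_zero_iff hV (by omega)).2 hz)⟩
  have hne : rowOf n (s.arr a_V) r ≠ 0 := fun h => by
    have := (rowOf_eq_zero_iff hV (by omega)).1 h _ hpiv
    omega
  rw [if_pos (by simp [hnz]), run_seq, run_ifLt]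
  have hspec := checkRow_spec hp₁ (U₁ ▸ hU) (V₁ ▸ hV) hr r₁
  have hF₂ := checkRow.frame s₁
  set s₂ := checkRow.run s₁
  have hp₂ := hp₁.frame hF₂ (by decide)
  have V₂ : s₂.arr a_V = s.arr a_V := (hF₂.arr _ (by decide)).trans V₁
  have U₂ : s₂.arr a_U = s.arr a_U := (hF₂.arr _ (by decide)).trans U₁
  have K₂ : s₂.arr a_K = s.arr a_K := (hF₂.arr _ (by decide)).trans K₁
  have c₂ : s₂.var v_cnt = s.var v_cnt := (hF₂.var _ (by decide)).trans c₁
  have r₂ : s₂.var v_r = r * (n + 2) := (hF₂.var _ (by decide)).trans r₁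
  rw [U₁, V₁] at hspec
  rcases hspec with ⟨hg, hall⟩ | ⟨hg, hex⟩
  swap
  · rw [if_neg (by simp [hg]), run_skip, PassState, V₂, U₂, K₂, c₂]
    exact ⟨hU, hV, K, hK, hP.reject fun _ => .inr hex⟩
  rw [if_pos (by simp [hg]), run_seq, run_seq]
  obtain ⟨s₃, hs₃⟩ : ∃ s₃, (assign v_cnt (.var v_cnt + .const 1)).run
    ((write a_K (.var v_cnt) (.var v_r)).run s₂) = s₃ := ⟨_, rfl⟩
  have hp₃ : Params n m k s₃ := by
    rw [← hs₃]
    refine Params.frame (P := write a_K (.var v_cnt) (.var v_r) ;;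
      assign v_cnt (.var v_cnt + .const 1)) hp₂ ?_ (by decide)
    exact Stmt.frame _ _
  have V₃ : s₃.arr a_V = s.arr a_V := by simp [← hs₃, V₂]
  have U₃ : s₃.arr a_U = s.arr a_U := by simp [← hs₃, U₂]
  have K₃ : s₃.arr a_K = Function.update (s.arr a_K) (s.var v_cnt) (r * (n + 2)) := by
    simp [← hs₃, K₂, c₂, r₂]
  have c₃ : s₃.var v_cnt = s.var v_cnt + 1 := by simp [← hs₃, c₂]
  have r₃ : s₃.var v_r = r * (n + 2) := by simp [← hs₃, r₂]
  rw [hs₃]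
  have hproc := process_spec hp₃ (V₃ ▸ hV) hr r₃
  have hF₄ := process.frame s₃
  set s₄ := process.run s₃
  have U₄ : s₄.arr a_U = s.arr a_U := (hF₄.arr _ (by decide)).trans U₃
  have K₄ : s₄.arr a_K = Function.update (s.arr a_K) (s.var v_cnt) (r * (n + 2)) :=
    (hF₄.arr _ (by decide)).trans K₃
  have c₄ : s₄.var v_cnt = s.var v_cnt + 1 := (hF₄.var _ (by decide)).trans c₃
  rw [V₃] at hproc
  refine ⟨U₄ ▸ hU, hproc.1, Function.update K (s.var v_cnt) r, fun t ht => ?_, ?_⟩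
  · rw [c₄] at ht
    rw [K₄]
    by_cases h : t = s.var v_cnt
    · simp [h]
    · simp [h, hK t (by omega)]
  · rw [U₄, c₄]
    refine hP.accept (by omega) hr hc hinj hne hall (fun t ht => ?_) (by simp) hproc.2.2
    rw [Function.update_of_ne (by omega)]

/-- The search for a sum-free sequence of `k` rows. -/
def search : Stmt :=
  copyRows a_X a_U ;; copyRows a_X a_V ;; assign v_cnt (.const 0) ;;
  loop v_it v_n (.const 1)
    (loop v_r v_m (.var v_width) examineRow ;;
      ifLt (.var v_cnt) (.var v_k) (copyRows a_V a_U ;; assign v_cnt (.const 0)) skip)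

/-- The number `l` occurs in the invariant only; the program makes `n` passes in any case. -/
lemma search_spec {n m k l : ℕ} {s : Store} (hs : Params n m k s)
    (hf : Bits n (m + n) (s.arr a_X))
    (hinj : ∀ i < m, ∀ j < m, rowOf n (s.arr a_X) i = rowOf n (s.arr a_X) j → i = j)
    (hspan : Submodule.span (ZMod 2) (rowOf n (s.arr a_X) '' Set.Iio m) = ⊤)
    (hl : m < 2 ^ l) (hlk : l * k < n) :
    (search.run s).var v_cnt = k ∧ ∃ K : ℕ → ℕ, SumFree m (rowOf n (s.arr a_X)) K k ∧
      ∀ t < k, (search.run s).arr a_K t = K t * (n + 2) := by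
  rw [search, run_seq, run_seq, run_seq]
  set A₀ := rowOf n (s.arr a_X) with hA₀
  have hF₁ := (copyRows a_X a_U).frame s
  have U₁ : ∀ i < m + n, rowOf n (((copyRows a_X a_U).run s).arr a_U) i = A₀ i :=
    fun i hi => copyRows_row (by decide) hs hi
  have hU₁ := copyRows_bits (b := a_U) (by decide) hs hf
  set s₁ := (copyRows a_X a_U).run s
  have hp₁ := hs.frame hF₁ (by decide)
  have X₁ : s₁.arr a_X = s.arr a_X := hF₁.arr _ (by decide)
  have hF₂ := (copyRows a_X a_V).frame s₁
  have V₂ : ∀ i < m + n, rowOf n (((copyRows a_X a_V).run s₁).arr a_V) i = A₀ i :=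
    fun i hi => (copyRows_row (by decide) hp₁ hi).trans (by rw [X₁])
  have hV₂ := copyRows_bits (b := a_V) (by decide) hp₁ (X₁ ▸ hf)
  set s₂ := (copyRows a_X a_V).run s₁
  have hp₂ := hp₁.frame hF₂ (by decide)
  have U₂ : s₂.arr a_U = s₁.arr a_U := hF₂.arr _ (by decide)
  rw [run_assign, eval_const]
  have hp₃ : Params n m k (s₂.setVar v_cnt 0) := hp₂.setVar (by decide) _
  have := loop_induct (v := v_it) (b := v_n) (st := .const 1)
    (P := loop v_r v_m (.var v_width) examineRow ;;
      ifLt (.var v_cnt) (.var v_k) (copyRows a_V a_U ;; assign v_cnt (.const 0)) skip)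
    (s₂.setVar v_cnt 0)
    (fun i t => Bits n (m + n) (t.arr a_U) ∧ Bits n (m + n) (t.arr a_V) ∧
      ∃ K : ℕ → ℕ, (∀ j < t.var v_cnt, t.arr a_K j = K j * (n + 2)) ∧
        Search m (m + n) k l A₀ (rowOf n (t.arr a_U)) (rowOf n (t.arr a_V)) K (t.var v_cnt) i)
    ?_ ?_
  · rw [hp₃.var_n] at this
    obtain ⟨-, -, K, hK, hS⟩ := this
    obtain ⟨hc, hS⟩ := hS.sumFree hlk
    exact ⟨hc, K, hS, fun t ht => hK t (hc ▸ ht)⟩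
  · refine ⟨?_, hV₂, fun _ => 0, by simp, ?_⟩
    · rw [Store.arr_setVar, U₂]
      exact hU₁
    · refine Search.init (by omega) hspan hl hlk (fun i hi => ?_) V₂
      rw [Store.arr_setVar, U₂]
      exact U₁ i hi
  · rintro i t hi hF ⟨hU, hV, K, hK, hS⟩
    rw [run_seq, eval_const]
    set t₀ := t.setVar v_it (i * 1) with ht₀
    have hp : Params n m k t₀ := (hp₃.frame hF (by decide)).setVar (by decide) _
    have hw : (Expr.var v_width).eval t₀ = n + 2 := hp.var_width
    obtain ⟨W, hPass⟩ := hS.pass_init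
    have hpass := loop_induct (v := v_r) (b := v_m) (st := .var v_width) (P := examineRow) t₀
      (fun r u => PassState n m k l i A₀ W r u) ?_ ?_
    rotate_left
    · exact ⟨hU, hV, K, by simpa [ht₀] using hK, by simpa [ht₀] using hPass⟩
    · intro r u hr hF' hu
      rw [hp.var_m] at hr
      rw [hw]
      refine examineRow_spec hinj ((hp.frame hF' (by decide)).setVar (by decide) _) hr (by simp) ?_
      simpa [PassState] using hu
    rw [hp.var_m] at hpass
    have hF₅ := (loop v_r v_m (.var v_width) examineRow).frame t₀
    set t₁ := (loop v_r v_m (.var v_width) examineRow).run t₀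
    have hp₅ := hp.frame hF₅ (by decide)
    obtain ⟨hU', hV', K', hK', hPass'⟩ := hpass
    rw [run_ifLt, eval_var, eval_var, hp₅.var_k]
    by_cases hc : t₁.var v_cnt < k
    · rw [if_pos hc, run_seq, run_assign, eval_const]
      have hrow : ∀ i < m + n, _ := fun i hi => copyRows_row (a := a_V) (b := a_U) (by decide) hp₅ hi
      have hbits := copyRows_bits (b := a_U) (by decide) hp₅ hV'
      have hF₆ := (copyRows a_V a_U).frame t₁
      set t₂ := (copyRows a_V a_U).run t₁
      have V₆ : t₂.arr a_V = t₁.arr a_V := hF₆.arr _ (by decide)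
      refine ⟨hbits, ?_, K', by simp, ?_⟩
      · rw [Store.arr_setVar, V₆]
        exact hV'
      · simp only [Store.arr_setVar, Store.var_setVar, if_true, V₆]
        exact hPass'.search_of_lt hc (by omega) hspan hl hlk hrow
    · rw [if_neg hc, run_skip]
      exact ⟨hU', hV', K', hK', hPass'.search_of_eq hc⟩

/-! ### The majority algorithm -/

/-- The excess of the assignment `z` for the first `m` rows. -/
def value (n m : ℕ) (f : ℕ → ℕ) (z : Fin n → ZMod 2) : ℤ :=
  ∑ i ∈ range m, sgn (rowOf n f i ⬝ᵥ z + rhsOf n f i) * weightOf n f i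

/-- The assignment in an array. -/
def assignmentOf (n : ℕ) (g : ℕ → ℕ) : Fin n → ZMod 2 := fun j => (g j : ZMod 2)

/-- Read off the assignment from the right-hand sides of the last `n` rows of `V`. -/
def extract : Stmt :=
  assign v_off (.const 0) ;;
  loop v_j v_m (.const 1) (assign v_off (.var v_off + .var v_width)) ;;
  loop v_j v_n (.const 1)
    (ifLt (.const 0) (.read a_V (.var v_off + .var v_n)) (write a_Z (.var v_j) (.const 1))
      (write a_Z (.var v_j) (.const 0)) ;;
    assign v_off (.var v_off + .var v_width))

lemma extract_spec {n m k : ℕ} {s : Store} (hs : Params n m k s) :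
    ∀ j < n, (extract.run s).arr a_Z j =
      if 0 < s.arr a_V ((m + j) * (n + 2) + n) then 1 else 0 := by
  rw [extract, run_seq, run_seq, run_assign, eval_const]
  have hp₀ : Params n m k (s.setVar v_off 0) := hs.setVar (by decide) _
  have h₁ := loop_induct (v := v_j) (b := v_m) (st := .const 1)
    (P := assign v_off (.var v_off + .var v_width)) (s.setVar v_off 0)
    (fun i t => t.var v_off = i * (n + 2)) (by simp) ?_
  swap
  · intro i t hi hF ht
    have hw : t.var v_width = n + 2 := (hF.var _ (by decide)).trans hp₀.var_width
    simp [ht, hw, Nat.succ_mul]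
  rw [hp₀.var_m] at h₁
  have hF := (loop v_j v_m (.const 1) (assign v_off (.var v_off + .var v_width))).frame
    (s.setVar v_off 0)
  set s₁ := (loop v_j v_m (.const 1) (assign v_off (.var v_off + .var v_width))).run
    (s.setVar v_off 0)
  have hp₁ := hp₀.frame hF (by decide)
  have V₁ : s₁.arr a_V = s.arr a_V := hF.arr _ (by decide)
  have h₂ := loop_induct (v := v_j) (b := v_n) (st := .const 1)
    (P := ifLt (.const 0) (.read a_V (.var v_off + .var v_n)) (write a_Z (.var v_j) (.const 1))
      (write a_Z (.var v_j) (.const 0)) ;;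
    assign v_off (.var v_off + .var v_width)) s₁
    (fun i t => t.var v_off = (m + i) * (n + 2) ∧ ∀ j < i, t.arr a_Z j =
      if 0 < s.arr a_V ((m + j) * (n + 2) + n) then 1 else 0) (by simp [h₁]) ?_
  · rw [hp₁.var_n] at h₂
    exact h₂.2
  · rintro i t hi hF' ⟨ho, hz⟩
    have hw : t.var v_width = n + 2 := (hF'.var _ (by decide)).trans hp₁.var_width
    have hn : t.var v_n = n := (hF'.var _ (by decide)).trans hp₁.var_n
    have V₂ : t.arr a_V = s.arr a_V := (hF'.arr _ (by decide)).trans V₁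
    constructor
    · rw [run_seq, run_ifLt]
      split_ifs <;> simp [ho, hw, ← add_assoc, Nat.succ_mul]
    · intro j hj
      rw [run_seq, run_ifLt]
      simp only [eval_const, eval_read, eval_add, eval_var, Store.arr_setVar, V₂, Store.var_setVar,
        Nat.reduceEqDiff, if_false, ho, hn]
      by_cases h : j = i
      · subst h
        split_ifs <;> simp
      · rw [← hz j (by omega)]
        split_ifs <;> simp [h]

/-- The majority algorithm, starting with the sequence `K`. -/
def majority : Stmt :=
  copyRows a_X a_V ;;
  loop v_it v_k (.const 1) (ifLt (.var v_it) (.var v_cnt)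
    (assign v_r (.read a_K (.var v_it)) ;; process) skip) ;;
  loop v_r v_m (.var v_width) process ;;
  extract

/-- Needed independently of any success of the search, because the resulting assignment is evaluated
in every case. -/
lemma majority_bits {n m k : ℕ} {s : Store} (hs : Params n m k s) :
    ∀ j < n, (majority.run s).arr a_Z j ≤ 1 := by
  intro j hj
  rw [majority, run_seq, run_seq, run_seq]
  have hp := ((hs.frame ((copyRows a_X a_V).frame s) (by decide)).frame
    ((loop v_it v_k (.const 1) (ifLt (.var v_it) (.var v_cnt)
      (assign v_r (.read a_K (.var v_it)) ;; process) skip)).frame _) (by decide)).frame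
    ((loop v_r v_m (.var v_width) process).frame _) (by decide)
  rw [extract_spec hp j hj]
  split_ifs <;> omega

/-- The first loop gains at least 1 in each of its `k` rounds. The second one loses nothing and
reduces all rows to zero, since the rows span. -/
lemma majority_spec {n m k : ℕ} {s : Store} (hs : Params n m k s)
    (hf : Bits n (m + n) (s.arr a_X)) (h0 : ∀ i < m, rowOf n (s.arr a_X) i ≠ 0)
    (hw : ∀ i < m, 0 < weightOf n (s.arr a_X) i)
    (hspan : Submodule.span (ZMod 2) (rowOf n (s.arr a_X) '' Set.Iio m) = ⊤)
    (hunit : ∀ j : Fin n, rowOf n (s.arr a_X) (m + j) = Pi.single j 1)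
    (hunit' : ∀ j < n, rhsOf n (s.arr a_X) (m + j) = 0)
    {K : ℕ → ℕ} (hcnt : s.var v_cnt = k) (hK : SumFree m (rowOf n (s.arr a_X)) K k)
    (hKs : ∀ t < k, s.arr a_K t = K t * (n + 2)) :
    k ≤ value n m (s.arr a_X) (assignmentOf n ((majority.run s).arr a_Z)) := by
  rw [majority, run_seq, run_seq, run_seq]
  set f := s.arr a_X with hfdef
  have hF₁ := (copyRows a_X a_V).frame s
  have hidx : ∀ i < m + n, ∀ j < n + 2, _ := fun i hi j hj =>
    copyRows_index (a := a_X) (b := a_V) (by decide) hs hi hj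
  have hrow : ∀ i < m + n, _ := fun i hi => copyRows_row (a := a_X) (b := a_V) (by decide) hs hi
  have hV₁ := copyRows_bits (b := a_V) (by decide) hs hf
  set s₁ := (copyRows a_X a_V).run s
  have hp₁ := hs.frame hF₁ (by decide)
  have X₁ : s₁.arr a_X = f := hF₁.arr _ (by decide)
  have K₁ : s₁.arr a_K = s.arr a_K := hF₁.arr _ (by decide)
  have c₁ : s₁.var v_cnt = k := (hF₁.var _ (by decide)).trans hcnt
  have h₁ := loop_induct (v := v_it) (b := v_k) (st := .const 1)
    (P := ifLt (.var v_it) (.var v_cnt) (assign v_r (.read a_K (.var v_it)) ;; process) skip) s₁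
    (fun i t => Bits n (m + n) (t.arr a_V) ∧ (∀ i < m, weightOf n (t.arr a_V) i = weightOf n f i) ∧
      Progress m (m + n) (weightOf n f) (rowOf n f) (rhsOf n f) (rowOf n (t.arr a_V))
        (rhsOf n (t.arr a_V)) (rowSpan (rowOf n f) K i) i) ?_ ?_
  rotate_left
  · refine ⟨hV₁, fun i hi => hidx i (by omega) _ (by omega), ?_⟩
    rw [rowSpan_zero]
    refine Progress.init (by omega) h0 hrow fun i hi => ?_
    rw [rhsOf, hidx i hi n (by omega), rhsOf]
  · rintro i t hi hF ⟨hb, hwt, hpr⟩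
    rw [hp₁.var_k] at hi
    have tK : t.arr a_K i = K i * (n + 2) := by
      rw [hF.arr a_K (by decide), K₁, hKs i hi]
    have tc : t.var v_cnt = k := (hF.var _ (by decide)).trans c₁
    have hpt := hp₁.frame hF (by decide)
    rw [run_ifLt, if_pos (by simpa [tc] using hi), run_seq]
    obtain ⟨t₁, ht₁⟩ : ∃ t₁, (assign v_r (.read a_K (.var v_it))).run
      (t.setVar v_it (i * (Expr.const 1).eval s₁)) = t₁ := ⟨_, rfl⟩
    rw [ht₁]
    have hpt₁ : Params n m k t₁ := ht₁ ▸ (hpt.setVar (by decide) _).setVar (by decide) _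
    have V : t₁.arr a_V = t.arr a_V := by simp [← ht₁]
    have r : t₁.var v_r = K i * (n + 2) := by simp [← ht₁, tK]
    obtain ⟨hb', hw', hpr'⟩ := process_spec hpt₁ (V ▸ hb) (hK i hi).1 r
    rw [V] at hpr' hw'
    refine ⟨hb', fun j hj => by rw [hw', hwt j hj], ?_⟩
    push_cast
    exact hpr.process_sumFree (by omega) hw hK hi (hpr'.congr_weight hwt)
  have hF₂ := (loop v_it v_k (.const 1) (ifLt (.var v_it) (.var v_cnt)
    (assign v_r (.read a_K (.var v_it)) ;; process) skip)).frame s₁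
  set s₂ := (loop v_it v_k (.const 1) (ifLt (.var v_it) (.var v_cnt)
    (assign v_r (.read a_K (.var v_it)) ;; process) skip)).run s₁
  have hp₂ := hp₁.frame hF₂ (by decide)
  rw [hp₁.var_k] at h₁
  have hw₂ : (Expr.var v_width).eval s₂ = n + 2 := hp₂.var_width
  have h₂ := loop_induct (v := v_r) (b := v_m) (st := .var v_width) (P := process) s₂
    (fun i t => Bits n (m + n) (t.arr a_V) ∧ (∀ i < m, weightOf n (t.arr a_V) i = weightOf n f i) ∧
      ∃ W, (∀ j < i, rowOf n f j ∈ W) ∧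
      Progress m (m + n) (weightOf n f) (rowOf n f) (rhsOf n f) (rowOf n (t.arr a_V))
        (rhsOf n (t.arr a_V)) W k) ⟨h₁.1, h₁.2.1, _, by simp, h₁.2.2⟩ ?_
  swap
  · rintro i t hi hF ⟨hb, hwt, W, hW, hpr⟩
    rw [hp₂.var_m] at hi
    rw [hw₂]
    have hpt : Params n m k (t.setVar v_r (i * (n + 2))) :=
      (hp₂.frame hF (by decide)).setVar (by decide) _
    obtain ⟨hb', hw', hpr'⟩ := process_spec hpt hb hi (by simp)
    refine ⟨hb', fun j hj => (congrFun hw' j).trans (hwt j hj), _, fun j hj => ?_,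
      hpr.process (by omega) hi (hpr'.congr_weight hwt)⟩
    rcases Nat.lt_succ_iff_lt_or_eq.1 hj with hj | rfl
    · exact Submodule.mem_sup_left (hW j hj)
    · exact Submodule.mem_sup_right (Submodule.mem_span_singleton_self _)
  have hF₃ := (loop v_r v_m (.var v_width) process).frame s₂
  set s₃ := (loop v_r v_m (.var v_width) process).run s₂
  have hp₃ := hp₂.frame hF₃ (by decide)
  rw [hp₂.var_m] at h₂
  obtain ⟨hb, -, W, hW, hpr⟩ := h₂
  have hWtop : W = ⊤ := by
    rw [eq_top_iff, ← hspan, Submodule.span_le]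
    rintro _ ⟨j, hj, rfl⟩
    exact hW j hj
  rw [hWtop] at hpr
  obtain ⟨z, hz, hk⟩ := hpr.exists_assignment (by omega)
  -- Row `m + j` began as the `j`-th unit vector with right-hand side 0, so its final right-hand
  -- side is `z j`.
  have hzz : assignmentOf n ((extract.run s₃).arr a_Z) = z := by
    funext j
    have h₁ := hz (m + j) (by omega)
    rw [hunit, hunit' _ j.2, add_zero, single_one_dotProduct] at h₁
    rw [← h₁, assignmentOf, extract_spec hp₃ j j.2, rhsOf]
    have := hb (m + j) (by omega) n le_rfl
    generalize s₃.arr a_V ((m + j) * (n + 2) + n) = x at this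
    interval_cases x <;> simp
  rw [hzz]
  exact hk

/-! ### Evaluation of assignments -/

/-- Add to `v_par` the value of the row `v_r` of `X` at the assignment in `Z`. -/
def parity : Stmt :=
  loop v_j v_n (.const 1) (ifLt (.const 0) (.read a_Z (.var v_j))
    (assign v_par (bxor (.var v_par) (.read a_X (.var v_r + .var v_j)))) skip)

lemma parity_spec {n m k i : ℕ} {s : Store} (hs : Params n m k s)
    (hf : Bits n (m + n) (s.arr a_X)) (hZ : ∀ j < n, s.arr a_Z j ≤ 1) (hi : i < m)
    (hr : s.var v_r = i * (n + 2)) (hpar : s.var v_par ≤ 1) :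
    (parity.run s).var v_par ≤ 1 ∧ ((parity.run s).var v_par : ZMod 2) =
      rowOf n (s.arr a_X) i ⬝ᵥ assignmentOf n (s.arr a_Z) + s.var v_par := by
  rw [parity]
  have := loop_induct (v := v_j) (b := v_n) (st := .const 1)
    (P := ifLt (.const 0) (.read a_Z (.var v_j))
      (assign v_par (bxor (.var v_par) (.read a_X (.var v_r + .var v_j)))) skip) s
    (fun l t => t.var v_par ≤ 1 ∧ (t.var v_par : ZMod 2) =
      ∑ j ∈ range l, (s.arr a_X (i * (n + 2) + j) : ZMod 2) * (s.arr a_Z j : ZMod 2) +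
        s.var v_par) (by simpa using hpar) ?_
  · rw [hs.var_n] at this
    rw [dotProduct]
    simp only [rowOf, assignmentOf]
    rw [Fin.sum_univ_eq_sum_range (fun j =>
      (s.arr a_X (i * (n + 2) + j) : ZMod 2) * (s.arr a_Z j : ZMod 2)) n]
    exact this
  · rintro l t hl hF ⟨h₁, h₂⟩
    rw [hs.var_n] at hl
    have tX : t.arr a_X = s.arr a_X := hF.arr _ (by decide)
    have tZ : t.arr a_Z = s.arr a_Z := hF.arr _ (by decide)
    have tr : t.var v_r = i * (n + 2) := (hF.var _ (by decide)).trans hr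
    have hb := hf i (by omega) l hl.le
    have hz := hZ l hl
    rw [sum_range_succ]
    by_cases h : s.arr a_Z l = 0
    · simp [tZ, h, h₁, h₂]
    · have h' : s.arr a_Z l = 1 := by omega
      have : (ifLt (.const 0) (.read a_Z (.var v_j)) (assign v_par (bxor (.var v_par)
          (.read a_X (.var v_r + .var v_j)))) skip).run
            (t.setVar v_j (l * (Expr.const 1).eval s)) = (t.setVar v_j l).setVar v_par
              (t.var v_par - s.arr a_X (i * (n + 2) + l) +
                (s.arr a_X (i * (n + 2) + l) - t.var v_par)) := by
        simp [tZ, h', tX, tr]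
      rw [this]
      simp only [Store.var_setVar, if_true]
      refine ⟨bxor_le_one h₁ hb, ?_⟩
      rw [cast_bxor h₁ hb, h₂, h']
      push_cast
      ring

/-- Compute the weights of the equations satisfied and falsified by the assignment in `Z`. -/
def evaluate : Stmt :=
  assign v_pos (.const 0) ;; assign v_neg (.const 0) ;;
  loop v_r v_m (.var v_width) (assign v_par (.read a_X (.var v_r + .var v_n)) ;; parity ;;
    ifLt (.const 0) (.var v_par)
      (assign v_neg (.var v_neg + .read a_X (.var v_r + .var v_last)))
      (assign v_pos (.var v_pos + .read a_X (.var v_r + .var v_last))))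

lemma evaluate_spec {n m k : ℕ} {s : Store} (hs : Params n m k s)
    (hf : Bits n (m + n) (s.arr a_X)) (hZ : ∀ j < n, s.arr a_Z j ≤ 1) :
    ((evaluate.run s).var v_pos : ℤ) - (evaluate.run s).var v_neg =
      value n m (s.arr a_X) (assignmentOf n (s.arr a_Z)) := by
  rw [evaluate, run_seq, run_seq, run_assign, run_assign]
  set s₀ := ((s.setVar v_pos ((Expr.const 0).eval s)).setVar v_neg
    ((Expr.const 0).eval (s.setVar v_pos ((Expr.const 0).eval s)))) with hs₀
  have hp₀ : Params n m k s₀ := (hs.setVar (by decide) _).setVar (by decide) _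
  have hw : (Expr.var v_width).eval s₀ = n + 2 := hp₀.var_width
  have := loop_induct (v := v_r) (b := v_m) (st := .var v_width)
    (P := assign v_par (.read a_X (.var v_r + .var v_n)) ;; parity ;;
    ifLt (.const 0) (.var v_par)
      (assign v_neg (.var v_neg + .read a_X (.var v_r + .var v_last)))
      (assign v_pos (.var v_pos + .read a_X (.var v_r + .var v_last)))) s₀
    (fun i t => (t.var v_pos : ℤ) - t.var v_neg =
      value n i (s.arr a_X) (assignmentOf n (s.arr a_Z))) (by simp [hs₀, value]) ?_
  · rwa [hp₀.var_m] at this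
  · intro i t hi hF ht
    rw [hp₀.var_m] at hi
    rw [hw, run_seq, run_seq]
    have hpt : Params n m k t := hp₀.frame hF (by decide)
    have tX : t.arr a_X = s.arr a_X := hF.arr _ (by decide)
    have tZ : t.arr a_Z = s.arr a_Z := hF.arr _ (by decide)
    obtain ⟨t₁, ht₁⟩ : ∃ t₁, (assign v_par (.read a_X (.var v_r + .var v_n))).run
      (t.setVar v_r (i * (n + 2))) = t₁ := ⟨_, rfl⟩
    have hp₁ : Params n m k t₁ := ht₁ ▸ (hpt.setVar (by decide) _).setVar (by decide) _
    have X₁ : t₁.arr a_X = s.arr a_X := by simp [← ht₁, tX]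
    have Z₁ : t₁.arr a_Z = s.arr a_Z := by simp [← ht₁, tZ]
    have r₁ : t₁.var v_r = i * (n + 2) := by simp [← ht₁]
    have par₁ : t₁.var v_par = s.arr a_X (i * (n + 2) + n) := by simp [← ht₁, tX, hpt.var_n]
    have pos₁ : t₁.var v_pos = t.var v_pos := by simp [← ht₁]
    have neg₁ : t₁.var v_neg = t.var v_neg := by simp [← ht₁]
    rw [ht₁]
    obtain ⟨h₁, h₂⟩ := parity_spec hp₁ (X₁ ▸ hf) (Z₁ ▸ hZ) hi r₁
      (by rw [par₁]; exact hf i (by omega) n le_rfl)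
    have hF₂ := parity.frame t₁
    set t₂ := parity.run t₁
    have hp₂ := hp₁.frame hF₂ (by decide)
    have X₂ : t₂.arr a_X = s.arr a_X := (hF₂.arr _ (by decide)).trans X₁
    have r₂ : t₂.var v_r = i * (n + 2) := (hF₂.var _ (by decide)).trans r₁
    have pos₂ : t₂.var v_pos = t.var v_pos := (hF₂.var _ (by decide)).trans pos₁
    have neg₂ : t₂.var v_neg = t.var v_neg := (hF₂.var _ (by decide)).trans neg₁
    rw [X₁, Z₁, par₁] at h₂
    rw [value, sum_range_succ, ← value, ← ht, rhsOf, ← h₂]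
    by_cases h : t₂.var v_par = 0
    · simp [h, X₂, r₂, hp₂.var_last, pos₂, neg₂, sgn, weightOf]
      ring
    · have h' : t₂.var v_par = 1 := by omega
      simp [h', X₂, r₂, hp₂.var_last, pos₂, neg₂, sgn, weightOf]
      ring

/-- If the assignment in `Z` is good enough, output it. -/
def tryAssignment : Stmt :=
  evaluate ;;
  ifLt (.var v_pos) (.var v_neg + .var v_k) skip
    (assign v_found (.const 1) ;; loop v_j v_n (.const 1) (output (.var v_j) (.read a_Z (.var v_j))))

/-- A failed trial leaves `v_found` and the output alone, so an earlier success is not lost. The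
bound on `n` is needed because output beyond the input cells is discarded. -/
lemma tryAssignment_spec {n m k : ℕ} {s : Store} (hs : Params n m k s)
    (hf : Bits n (m + n) (s.arr a_X)) (hZ : ∀ j < n, s.arr a_Z j ≤ 1) (hlen : n ≤ s.len) :
    (value n m (s.arr a_X) (assignmentOf n (s.arr a_Z)) < k ∧
      (tryAssignment.run s).var v_found = s.var v_found ∧ (tryAssignment.run s).io = s.io) ∨
    (k ≤ value n m (s.arr a_X) (assignmentOf n (s.arr a_Z)) ∧
      (tryAssignment.run s).var v_found = 1 ∧
      ∀ j < n, (tryAssignment.run s).io j = s.arr a_Z j) := by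
  rw [tryAssignment, run_seq, run_ifLt]
  have hv := evaluate_spec hs hf hZ
  have hF₁ := evaluate.frame s
  set s₁ := evaluate.run s
  have hp₁ := hs.frame hF₁ (by decide)
  have Z₁ : s₁.arr a_Z = s.arr a_Z := hF₁.arr _ (by decide)
  have f₁ : s₁.var v_found = s.var v_found := hF₁.var _ (by decide)
  simp only [eval_var, eval_add, hp₁.var_k]
  split_ifs with h
  · exact .inl ⟨by omega, f₁, hF₁.io (by decide)⟩
  · refine .inr ⟨by omega, ?_⟩
    rw [run_seq, run_assign, eval_const]
    have hF₂ := (loop v_j v_n (.const 1) (output (.var v_j) (.read a_Z (.var v_j)))).frame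
      (s₁.setVar v_found 1)
    refine ⟨(hF₂.var _ (by decide)).trans (by simp), ?_⟩
    have := loop_induct (v := v_j) (b := v_n) (st := .const 1)
      (P := output (.var v_j) (.read a_Z (.var v_j))) (s₁.setVar v_found 1)
      (fun i t => ∀ j < i, t.io j = s.arr a_Z j) (by simp) ?_
    · rwa [show (s₁.setVar v_found 1).var v_n = n by simp [hp₁.var_n]] at this
    · intro i t hi hF ht j hj
      have hi' : i < n := by simpa [hp₁.var_n] using hi
      have tZ : t.arr a_Z = s.arr a_Z := (hF.arr _ (by decide)).trans Z₁
      have tl : t.len = s.len := hF.len.trans hF₁.len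
      rw [run_output, Store.io_setCell, if_pos (by simp [tl]; omega)]
      by_cases h : j = i
      · subst h
        simp [tZ]
      · simp [h, ht j (by omega)]

/-! ### Exhaustive search -/

lemma sum_bits_lt {n : ℕ} {f : ℕ → ℕ} (hf : ∀ j < n, f j ≤ 1) :
    ∑ j ∈ range n, f j * 2 ^ j < 2 ^ n := by
  induction n with
  | zero => simp
  | succ n ih =>
    rw [sum_range_succ, pow_succ]
    have h₁ := ih fun j hj => hf j (by omega)
    have h₂ := Nat.mul_le_mul_right (2 ^ n) (hf n (by omega))
    omega

/-- Identifies the assignment tried in round `c` of the exhaustive search as the only one with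
binary value `c`. -/
lemma eq_of_sum_bits_eq {n : ℕ} {f g : ℕ → ℕ} (hf : ∀ j < n, f j ≤ 1) (hg : ∀ j < n, g j ≤ 1)
    (h : ∑ j ∈ range n, f j * 2 ^ j = ∑ j ∈ range n, g j * 2 ^ j) : ∀ j < n, f j = g j := by
  induction n with
  | zero => intro j hj; omega
  | succ n ih =>
    rw [sum_range_succ, sum_range_succ] at h
    have h₁ := sum_bits_lt fun j (hj : j < n) => hf j (by omega)
    have h₂ := sum_bits_lt fun j (hj : j < n) => hg j (by omega)
    have hfn := hf n (by omega)
    have hgn := hg n (by omega)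
    have hn : f n = g n := by
      generalize f n = x at *
      generalize g n = y at *
      interval_cases x <;> interval_cases y <;> omega
    rw [hn] at h
    intro j hj
    rcases Nat.lt_succ_iff_lt_or_eq.1 hj with hj | rfl
    · exact ih (fun j hj => hf j (by omega)) (fun j hj => hg j (by omega)) (by omega) j hj
    · exact hn

/-- Add one to the number with the binary digits `Z`. -/
def increment : Stmt :=
  assign v_carry (.const 1) ;;
  loop v_j v_n (.const 1) (ifLt (.const 0) (.var v_carry)
    (ifLt (.const 0) (.read a_Z (.var v_j)) (write a_Z (.var v_j) (.const 0))
      (write a_Z (.var v_j) (.const 1) ;; assign v_carry (.const 0))) skip)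

lemma increment_spec {n : ℕ} {s : Store} (hn : s.var v_n = n) (hZ : ∀ j < n, s.arr a_Z j ≤ 1) :
    (∀ j < n, (increment.run s).arr a_Z j ≤ 1) ∧
    (∑ j ∈ range n, s.arr a_Z j * 2 ^ j + 1 < 2 ^ n →
      ∑ j ∈ range n, (increment.run s).arr a_Z j * 2 ^ j =
        ∑ j ∈ range n, s.arr a_Z j * 2 ^ j + 1) := by
  rw [increment, run_seq, run_assign, eval_const]
  have := loop_induct (v := v_j) (b := v_n) (st := .const 1)
    (P := ifLt (.const 0) (.var v_carry)
    (ifLt (.const 0) (.read a_Z (.var v_j)) (write a_Z (.var v_j) (.const 0))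
      (write a_Z (.var v_j) (.const 1) ;; assign v_carry (.const 0))) skip) (s.setVar v_carry 1)
    -- The carry counts as a digit of weight `2 ^ i`, so that the value of the first `i` digits plus
    -- the carry is the old value plus 1. At the end a nonzero carry would contradict the assumption
    -- that there is no overflow.
    (fun i t => t.var v_carry ≤ 1 ∧ (∀ j < n, t.arr a_Z j ≤ 1) ∧
      (∀ j, i ≤ j → t.arr a_Z j = s.arr a_Z j) ∧
      ∑ j ∈ range i, t.arr a_Z j * 2 ^ j + t.var v_carry * 2 ^ i =
        ∑ j ∈ range i, s.arr a_Z j * 2 ^ j + 1) ?_ ?_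
  · rw [show (s.setVar v_carry 1).var v_n = n by simp [hn]] at this
    obtain ⟨h₁, h₂, -, h₄⟩ := this
    refine ⟨h₂, fun hlt => ?_⟩
    rw [← h₄] at hlt ⊢
    rcases Nat.le_one_iff_eq_zero_or_eq_one.1 h₁ with h | h
    · rw [h]
      omega
    · rw [h] at hlt
      omega
  · exact ⟨by simp, hZ, fun _ _ => rfl, by simp⟩
  · rintro i t hi hF ⟨h₁, h₂, h₃, h₄⟩
    have hi' : i < n := by simpa [hn] using hi
    have hzi := h₃ i le_rfl
    have hb := hZ i hi'
    have upd : ∀ x, ∑ j ∈ range i, Function.update (t.arr a_Z) i x j * 2 ^ j =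
        ∑ j ∈ range i, t.arr a_Z j * 2 ^ j := fun x => sum_congr rfl fun j hj => by
      rw [Function.update_of_ne (mem_range.1 hj).ne]
    rw [sum_range_succ, sum_range_succ]
    have bit : ∀ x ≤ 1, (∀ j < n, Function.update (t.arr a_Z) i x j ≤ 1) := fun x hx j hj => by
      by_cases h : j = i
      · simp [h, hx]
      · simp [h, h₂ j hj]
    have tail : ∀ x j, i + 1 ≤ j → Function.update (t.arr a_Z) i x j = s.arr a_Z j :=
      fun x j hj => by
        rw [Function.update_of_ne (by omega), h₃ j (by omega)]
    rcases Nat.le_one_iff_eq_zero_or_eq_one.1 h₁ with hc | hc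
    · have : (ifLt (.const 0) (.var v_carry)
          (ifLt (.const 0) (.read a_Z (.var v_j)) (write a_Z (.var v_j) (.const 0))
          (write a_Z (.var v_j) (.const 1) ;; assign v_carry (.const 0))) skip).run
          (t.setVar v_j (i * (Expr.const 1).eval (s.setVar v_carry 1))) = t.setVar v_j i := by
        simp [hc]
      rw [this]
      refine ⟨by simp [hc], h₂, fun j hj => h₃ j (by omega), ?_⟩
      rw [hc] at h₄
      simp only [Store.arr_setVar, Store.var_setVar, Nat.reduceEqDiff, if_false, hc, hzi]
      omega
    · rcases Nat.le_one_iff_eq_zero_or_eq_one.1 hb with hz | hz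
      · have : (ifLt (.const 0) (.var v_carry)
            (ifLt (.const 0) (.read a_Z (.var v_j)) (write a_Z (.var v_j) (.const 0))
            (write a_Z (.var v_j) (.const 1) ;; assign v_carry (.const 0))) skip).run
            (t.setVar v_j (i * (Expr.const 1).eval (s.setVar v_carry 1))) =
            ((t.setVar v_j i).setArr a_Z i 1).setVar v_carry 0 := by
          simp [hc, hzi, hz]
        rw [this]
        simp only [Store.arr_setVar, Store.var_setVar, Store.arr_setArr, if_true]
        refine ⟨by omega, bit 1 le_rfl, tail 1, ?_⟩
        rw [hc] at h₄
        rw [upd, Function.update_self, hz]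
        omega
      · have : (ifLt (.const 0) (.var v_carry)
            (ifLt (.const 0) (.read a_Z (.var v_j)) (write a_Z (.var v_j) (.const 0))
            (write a_Z (.var v_j) (.const 1) ;; assign v_carry (.const 0))) skip).run
            (t.setVar v_j (i * (Expr.const 1).eval (s.setVar v_carry 1))) =
            (t.setVar v_j i).setArr a_Z i 0 := by
          simp [hc, hzi, hz]
        rw [this]
        simp only [Store.arr_setVar, Store.var_setVar, Store.var_setArr, Store.arr_setArr, if_true,
          Nat.reduceEqDiff, if_false]
        refine ⟨h₁, bit 0 (by omega), tail 0, ?_⟩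
        rw [hc] at h₄ ⊢
        rw [upd, Function.update_self, hz, pow_succ]
        omega

/-- Try all assignments. -/
def exhaust : Stmt :=
  loop v_j v_n (.const 1) (write a_Z (.var v_j) (.const 0)) ;;
  loop v_it v_pow (.const 1) (tryAssignment ;; increment)

/-- The outcome of the search among the assignments with property `p`. -/
def Outcome (n m k : ℕ) (f : ℕ → ℕ) (p : (Fin n → ZMod 2) → Prop) (s : Store) : Prop :=
  (s.var v_found = 1 ∧ ∃ z : Fin n → ZMod 2, k ≤ value n m f z ∧ ∀ j : Fin n, s.io j = (z j).val) ∨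
  (s.var v_found = 0 ∧ ∀ z, p z → value n m f z < k)

lemma val_assignmentOf {n : ℕ} {g : ℕ → ℕ} (hg : ∀ j < n, g j ≤ 1) (j : Fin n) :
    (assignmentOf n g j).val = g j := by
  have := hg j j.2
  rw [assignmentOf]
  generalize g j = x at this
  interval_cases x <;> rfl

lemma exhaust_spec {n m k : ℕ} {s : Store} (hs : Params n m k s) (hpow : s.var v_pow = 2 ^ n)
    (hf : Bits n (m + n) (s.arr a_X)) (hlen : n ≤ s.len) (hfound : s.var v_found = 0) :
    Outcome n m k (s.arr a_X) (fun _ => True) (exhaust.run s) := by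
  rw [exhaust, run_seq]
  have h₁ := loop_induct (v := v_j) (b := v_n) (st := .const 1)
    (P := write a_Z (.var v_j) (.const 0)) s (fun i t => ∀ j < i, t.arr a_Z j = 0) (by simp) ?_
  swap
  · intro i t hi hF ht j hj
    by_cases h : j = i
    · simp [h]
    · simp [h, ht j (by omega)]
  rw [hs.var_n] at h₁
  have hF₁ := (loop v_j v_n (.const 1) (write a_Z (.var v_j) (.const 0))).frame s
  set s₁ := (loop v_j v_n (.const 1) (write a_Z (.var v_j) (.const 0))).run s
  have hp₁ := hs.frame hF₁ (by decide)
  have X₁ : s₁.arr a_X = s.arr a_X := hF₁.arr _ (by decide)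
  have f₁ : s₁.var v_found = 0 := (hF₁.var _ (by decide)).trans hfound
  have pow₁ : s₁.var v_pow = 2 ^ n := (hF₁.var _ (by decide)).trans hpow
  have h₂ := loop_induct (v := v_it) (b := v_pow) (st := .const 1)
    (P := tryAssignment ;; increment) s₁
    -- The value of `Z` is claimed only while `c < 2 ^ n`, because the last increment overflows. The
    -- outcome speaks of all assignments with binary value below `c`, that is, of those already
    -- tried.
    (fun c t => (∀ j < n, t.arr a_Z j ≤ 1) ∧
      (c < 2 ^ n → ∑ j ∈ range n, t.arr a_Z j * 2 ^ j = c) ∧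
      Outcome n m k (s.arr a_X) (fun z => ∑ j, (z j).val * 2 ^ (j : ℕ) < c) t) ?_ ?_
  · rw [pow₁] at h₂
    rcases h₂.2.2 with h | ⟨h, hall⟩
    · exact .inl h
    · refine .inr ⟨h, fun z _ => hall z ?_⟩
      have := sum_bits_lt (n := n) (f := fun j => if h : j < n then (z ⟨j, h⟩).val else 0)
        (fun j hj => by
          rw [dif_pos hj]
          exact Nat.lt_succ_iff.1 (ZMod.val_lt _))
      rw [← Fin.sum_univ_eq_sum_range (fun j => (if h : j < n then (z ⟨j, h⟩).val else 0) * 2 ^ j)]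
        at this
      simpa using this
  · refine ⟨fun j hj => by rw [h₁ j hj]; omega, fun _ => ?_, .inr ⟨f₁, fun z hz => by omega⟩⟩
    exact sum_eq_zero fun j hj => by rw [h₁ j (mem_range.1 hj), zero_mul]
  · rintro c t hc hF ⟨hZ, hsum, hout⟩
    rw [pow₁] at hc
    have hsum := hsum hc
    rw [run_seq]
    set t₀ := t.setVar v_it (c * (Expr.const 1).eval s₁) with ht₀
    have hpt : Params n m k t₀ := (hp₁.frame hF (by decide)).setVar (by decide) _
    have X₀ : t₀.arr a_X = s.arr a_X := (hF.arr _ (by decide)).trans X₁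
    have Z₀ : t₀.arr a_Z = t.arr a_Z := rfl
    have l₀ : t₀.len = s.len := hF.len.trans hF₁.len
    have f₀ : t₀.var v_found = t.var v_found := by simp [ht₀]
    have io₀ : t₀.io = t.io := rfl
    have htry := tryAssignment_spec hpt (X₀ ▸ hf) hZ (l₀ ▸ hlen)
    have hF₂ := tryAssignment.frame t₀
    set t₁ := tryAssignment.run t₀
    have hp₂ := hpt.frame hF₂ (by decide)
    have Z₂ : t₁.arr a_Z = t.arr a_Z := hF₂.arr _ (by decide)
    have hinc := increment_spec hp₂.var_n (Z₂ ▸ hZ)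
    have hF₃ := increment.frame t₁
    set t₂ := increment.run t₁
    have f₃ : t₂.var v_found = t₁.var v_found := hF₃.var _ (by decide)
    have io₃ : t₂.io = t₁.io := hF₃.io (by decide)
    rw [Z₂, hsum] at hinc
    refine ⟨hinc.1, hinc.2, ?_⟩
    rw [X₀, Z₀, f₀, io₀] at htry
    rw [Outcome, f₃, io₃]
    rcases htry with ⟨hlt, hfd, hio⟩ | ⟨hle, hfd, hio⟩
    · rw [hfd, hio]
      rcases hout with hout | ⟨h0, hall⟩
      · exact .inl hout
      · refine .inr ⟨h0, fun z hz => ?_⟩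
        rcases Nat.lt_succ_iff_lt_or_eq.1 hz with hz | hz
        · exact hall z hz
        · have hzz : z = assignmentOf n (t.arr a_Z) := by
            have := eq_of_sum_bits_eq (n := n)
              (f := fun j => if h : j < n then (z ⟨j, h⟩).val else 0) (g := t.arr a_Z)
              (fun j hj => by
                rw [dif_pos hj]
                exact Nat.lt_succ_iff.1 (ZMod.val_lt _)) hZ
              (by
                rw [← Fin.sum_univ_eq_sum_range (fun j =>
                  (if h : j < n then (z ⟨j, h⟩).val else 0) * 2 ^ j), hsum, ← hz]
                simp)
            funext j
            have := this j j.2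
            rw [dif_pos j.2] at this
            rw [assignmentOf, ← this]
            simp
          rw [hzz]
          exact hlt
    · exact .inl ⟨hfd, _, hle, fun j => by rw [val_assignmentOf hZ j, hio j j.2]⟩

/-! ### Reading the input -/

lemma index_inj {W i i' j j' : ℕ} (hj : j < W) (hj' : j' < W) :
    i * W + j = i' * W + j' ↔ i = i' ∧ j = j' := by
  constructor
  · intro h
    rcases lt_trichotomy i i' with hi | hi | hi
    · have := Nat.mul_le_mul_right W (Nat.succ_le_of_lt hi)
      rw [Nat.succ_mul] at this
      omega
    · subst hi
      omega
    · have := Nat.mul_le_mul_right W (Nat.succ_le_of_lt hi)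
      rw [Nat.succ_mul] at this
      omega
  · rintro ⟨rfl, rfl⟩
    rfl

/-- Read the parameters. -/
def setup : Stmt :=
  assign v_n (.input (.const 0)) ;; assign v_m (.input (.const 1)) ;;
  assign v_width (.var v_n + .const 2) ;; assign v_rows (.var v_m + .var v_n) ;;
  assign v_last (.var v_n + .const 1)

lemma setup_spec {n m k : ℕ} {s : Store} (hlen : 2 ≤ s.len) (hk : s.var v_k = k) (hn : s.io 0 = n)
    (hm : s.io 1 = m) : Params n m k (setup.run s) := by
  have h0 : 0 < s.len := by omega
  have h1 : 1 < s.len := by omega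
  constructor <;> simp [setup, h0, h1, hk, hn, hm]

/-- Copy the equations to `X`, and append the rows of an identity matrix. -/
def buildMatrix : Stmt :=
  loop v_r v_m (.var v_width) (loop v_j v_width (.const 1)
    (write a_X (.var v_r + .var v_j) (.input (.const 2 + (.var v_r + .var v_j))))) ;;
  assign v_off (.const 0) ;;
  loop v_j v_m (.const 1) (assign v_off (.var v_off + .var v_width)) ;;
  loop v_j v_n (.const 1) (write a_X (.var v_off + .var v_j) (.const 1) ;;
    assign v_off (.var v_off + .var v_width))

/-- As the array is zero beforehand, only the ones of the identity matrix need writing; its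
right-hand sides are thereby 0. -/
lemma buildMatrix_spec {n m k : ℕ} {s : Store} (hs : Params n m k s) (h0 : s.arr a_X = 0)
    (hlen : 2 + m * (n + 2) ≤ s.len) :
    (∀ x < m * (n + 2), (buildMatrix.run s).arr a_X x = s.io (2 + x)) ∧
    ∀ i < n, ∀ j < n + 2, (buildMatrix.run s).arr a_X ((m + i) * (n + 2) + j) =
      if j = i then 1 else 0 := by
  rw [buildMatrix, run_seq, run_seq, run_seq]
  have hw : (Expr.var v_width).eval s = n + 2 := hs.var_width
  have h₁ := loop_induct (v := v_r) (b := v_m) (st := .var v_width)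
    (P := loop v_j v_width (.const 1)
      (write a_X (.var v_r + .var v_j) (.input (.const 2 + (.var v_r + .var v_j))))) s
    (fun i t => ∀ x, t.arr a_X x = if x < i * (n + 2) then s.io (2 + x) else 0) (by simp [h0]) ?_
  swap
  · intro i t hi hF ht x
    rw [hs.var_m] at hi
    rw [hw]
    set t₀ := t.setVar v_r (i * (n + 2)) with ht₀
    have tw : t₀.var v_width = n + 2 := by
      simp [ht₀, (hF.var v_width (by decide)).trans hs.var_width]
    have := loop_induct (v := v_j) (b := v_width) (st := .const 1)
      (P := write a_X (.var v_r + .var v_j) (.input (.const 2 + (.var v_r + .var v_j)))) t₀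
      (fun j u => ∀ x, u.arr a_X x = if x < i * (n + 2) + j then s.io (2 + x) else 0)
      (by simpa [ht₀] using ht) ?_
    · rw [tw] at this
      rw [this x, Nat.succ_mul]
    · intro j u hj hF' hu x
      rw [tw] at hj
      have ur : u.var v_r = i * (n + 2) := (hF'.var _ (by decide)).trans (by simp [ht₀])
      have uio : u.io = s.io := (hF'.io (by decide)).trans (hF.io (by decide))
      have ul : u.len = s.len := hF'.len.trans hF.len
      have hlt : 2 + (i * (n + 2) + j) < s.len := by
        have := Nat.mul_le_mul_right (n + 2) (Nat.succ_le_of_lt hi)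
        rw [Nat.succ_mul] at this
        omega
      by_cases h : x = i * (n + 2) + j
      · subst h
        simp [ur, uio, ul, hlt]
      · have := hu x
        have hiff : x < i * (n + 2) + (j + 1) ↔ x < i * (n + 2) + j := by omega
        simp only [hiff]
        simp [ur, h, this]
  rw [hs.var_m] at h₁
  set P₁ := loop v_r v_m (.var v_width) (loop v_j v_width (.const 1)
    (write a_X (.var v_r + .var v_j) (.input (.const 2 + (.var v_r + .var v_j))))) with hP₁
  have hF₁ := P₁.frame s
  set s₁ := P₁.run s
  have hp₁ := hs.frame hF₁ (by rw [hP₁]; decide)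
  rw [run_assign, eval_const]
  have hp₀ : Params n m k (s₁.setVar v_off 0) := hp₁.setVar (by decide) _
  have h₂ := loop_induct (v := v_j) (b := v_m) (st := .const 1)
    (P := assign v_off (.var v_off + .var v_width)) (s₁.setVar v_off 0)
    (fun i t => t.var v_off = i * (n + 2)) (by simp) ?_
  swap
  · intro i t hi hF ht
    have hw : t.var v_width = n + 2 := (hF.var _ (by decide)).trans hp₀.var_width
    simp [ht, hw, Nat.succ_mul]
  rw [hp₀.var_m] at h₂
  have hF₂ := (loop v_j v_m (.const 1) (assign v_off (.var v_off + .var v_width))).frame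
    (s₁.setVar v_off 0)
  set s₂ := (loop v_j v_m (.const 1) (assign v_off (.var v_off + .var v_width))).run
    (s₁.setVar v_off 0)
  have hp₂ := hp₀.frame hF₂ (by decide)
  have X₂ : s₂.arr a_X = s₁.arr a_X := hF₂.arr _ (by decide)
  have h₃ := loop_induct (v := v_j) (b := v_n) (st := .const 1)
    (P := write a_X (.var v_off + .var v_j) (.const 1) ;;
      assign v_off (.var v_off + .var v_width)) s₂
    (fun l t => t.var v_off = (m + l) * (n + 2) ∧ (∀ x < m * (n + 2), t.arr a_X x = s.io (2 + x)) ∧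
      ∀ i, ∀ j < n + 2, t.arr a_X ((m + i) * (n + 2) + j) = if i < l ∧ j = i then 1 else 0) ?_ ?_
  · rw [hp₂.var_n] at h₃
    refine ⟨h₃.2.1, fun i hi j hj => ?_⟩
    rw [h₃.2.2 i j hj]
    simp [hi]
  · refine ⟨by simpa using h₂, fun x hx => ?_, fun i j hj => ?_⟩
    · rw [X₂, h₁ x, if_pos hx]
    · rw [X₂, h₁, if_neg, if_neg (by omega)]
      rw [add_mul]
      omega
  · rintro l t hl hF ⟨ho, hx, hu⟩
    rw [hp₂.var_n] at hl
    have tw : t.var v_width = n + 2 := (hF.var _ (by decide)).trans hp₂.var_width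
    refine ⟨by simp [ho, tw, ← add_assoc, Nat.succ_mul], fun x hx' => ?_, fun i j hj => ?_⟩
    · have : x ≠ (m + l) * (n + 2) + l := by
        rw [add_mul]
        omega
      simp [ho, this, hx x hx']
    · by_cases h : i = l ∧ j = l
      · obtain ⟨rfl, rfl⟩ := h
        simp [ho]
      · have hne : (m + i) * (n + 2) + j ≠ (m + l) * (n + 2) + l := by
          rw [Ne, index_inj hj (by omega)]
          omega
        have hiff : (i < l + 1 ∧ j = i) ↔ (i < l ∧ j = i) := by omega
        simp only [hiff]
        simp [ho, hne, hu i j hj]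

/-! ### Decoding the input -/

lemma getElem?_flatMap {α β : Type*} {g : α → List β} {W : ℕ} (hg : ∀ a, (g a).length = W)
    (l : List α) {i j : ℕ} (hj : j < W) :
    (l.flatMap g)[i * W + j]? = l[i]?.bind fun a => (g a)[j]? := by
  induction l generalizing i with
  | nil => simp
  | cons a l ih =>
    rw [List.flatMap_cons, List.getElem?_append, hg]
    cases i with
    | zero => simp [hj]
    | succ i =>
      rw [if_neg (by rw [Nat.succ_mul]; omega), Nat.succ_mul,
        show i * W + W + j - W = i * W + j by omega, ih]
      simp

section

variable {n m : ℕ} (S : LinSystem n m)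

lemma encode_getD_zero : S.encode.getD 0 0 = n := rfl

lemma encode_getD_one : S.encode.getD 1 0 = m := rfl

lemma length_encode : S.encode.length = 2 + m * (n + 2) := by
  simp [LinSystem.encode, List.length_flatMap]
  ring

lemma encode_getD (i : Fin m) {j : ℕ} (hj : j < n + 2) :
    S.encode.getD (2 + (i * (n + 2) + j)) 0 =
      ((List.finRange n).map (fun j => (S.A i j).val) ++ [(S.b i).val, S.w i]).getD j 0 := by
  rw [LinSystem.encode, show 2 + ((i : ℕ) * (n + 2) + j) = (i * (n + 2) + j) + 1 + 1 by omega,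
    List.getD_cons_succ, List.getD_cons_succ, List.getD_eq_getElem?_getD,
    getElem?_flatMap (W := n + 2) (by simp) _ hj, List.getD_eq_getElem?_getD]
  simp

lemma encode_coeff (i : Fin m) (j : Fin n) :
    S.encode.getD (2 + (i * (n + 2) + j)) 0 = (S.A i j).val := by
  rw [encode_getD S i (by omega), List.getD_eq_getElem?_getD, List.getElem?_append_left (by simp)]
  simp

lemma encode_rhs (i : Fin m) : S.encode.getD (2 + (i * (n + 2) + n)) 0 = (S.b i).val := by
  rw [encode_getD S i (by omega), List.getD_eq_getElem?_getD, List.getElem?_append_right (by simp)]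
  simp

lemma encode_weight (i : Fin m) : S.encode.getD (2 + (i * (n + 2) + (n + 1))) 0 = S.w i := by
  rw [encode_getD S i (by omega), List.getD_eq_getElem?_getD, List.getElem?_append_right (by simp)]
  simp

/-- The array `f` holds the system `S`, followed by an identity matrix. -/
structure Holds (f : ℕ → ℕ) : Prop where
  coeff : ∀ (i : Fin m) (j : Fin n), f (i * (n + 2) + j) = (S.A i j).val
  rhs : ∀ i : Fin m, f (i * (n + 2) + n) = (S.b i).val
  weight : ∀ i : Fin m, f (i * (n + 2) + (n + 1)) = S.w i
  unit : ∀ i < n, ∀ j < n + 2, f ((m + i) * (n + 2) + j) = if j = i then 1 else 0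

variable {S} {f : ℕ → ℕ}

lemma Holds.bits (h : Holds S f) : Bits n (m + n) f := by
  intro i hi j hj
  rcases lt_or_ge i m with him | him
  · rcases hj.lt_or_eq with hj | rfl
    · rw [h.coeff ⟨i, him⟩ ⟨j, hj⟩]
      exact Nat.lt_succ_iff.1 (ZMod.val_lt _)
    · rw [h.rhs ⟨i, him⟩]
      exact Nat.lt_succ_iff.1 (ZMod.val_lt _)
  · obtain ⟨i, rfl⟩ := Nat.exists_eq_add_of_le him
    rw [h.unit i (by omega) j (by omega)]
    split_ifs <;> omega

lemma Holds.rowOf_eq (h : Holds S f) (i : Fin m) : rowOf n f i = S.A i := by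
  funext j
  rw [rowOf, h.coeff, ZMod.natCast_zmod_val]

lemma Holds.rhsOf_eq (h : Holds S f) (i : Fin m) : rhsOf n f i = S.b i := by
  rw [rhsOf, h.rhs, ZMod.natCast_zmod_val]

lemma Holds.rowOf_unit (h : Holds S f) (j : Fin n) : rowOf n f (m + j) = Pi.single j 1 := by
  funext l
  rw [rowOf, h.unit j j.2 l (by omega), Pi.single_apply]
  simp [Fin.ext_iff]

lemma Holds.rhsOf_unit (h : Holds S f) {j : ℕ} (hj : j < n) : rhsOf n f (m + j) = 0 := by
  rw [rhsOf, h.unit j hj n (by omega), if_neg (by omega), Nat.cast_zero]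

lemma Holds.value_eq (h : Holds S f) (z : Fin n → ZMod 2) : value n m f z = S.excess z := by
  rw [value, LinSystem.excess, ← Fin.sum_univ_eq_sum_range
    (fun i => sgn (rowOf n f i ⬝ᵥ z + rhsOf n f i) * (weightOf n f i : ℤ))]
  refine sum_congr rfl fun i _ => ?_
  rw [h.rowOf_eq, h.rhsOf_eq, weightOf, h.weight, sgn, Matrix.mulVec]
  simp only [CharTwo.add_eq_zero]
  split_ifs <;> simp

lemma Holds.span_eq_top (h : Holds S f) (hS : S.Irreducible) :
    Submodule.span (ZMod 2) (rowOf n f '' Set.Iio m) = ⊤ := by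
  have himg : rowOf n f '' Set.Iio m = Set.range S.A.row := by
    ext v
    constructor
    · rintro ⟨i, hi, rfl⟩
      exact ⟨⟨i, hi⟩, (h.rowOf_eq ⟨i, hi⟩).symm⟩
    · rintro ⟨i, rfl⟩
      exact ⟨i, i.2, h.rowOf_eq i⟩
  rw [himg]
  refine Submodule.eq_top_of_finrank_eq ?_
  rw [← Matrix.rank_eq_finrank_span_row, hS.rank_eq, Module.finrank_fin_fun]

end

/-! ### The whole program -/

/-- The polynomial-time part. -/
def attempt : Stmt :=
  buildMatrix ;; search ;; majority ;; assign v_found (.const 0) ;; tryAssignment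

/-- Success is certified by evaluating the assignment, failure only by contraposition: if some `l`
had `m < 2 ^ l` and `l * k < n`, the majority algorithm would have delivered excess `k`. -/
lemma attempt_spec {n m k : ℕ} {S : LinSystem n m} {s : Store} (hS : S.Irreducible)
    (hs : Params n m k s) (h0 : s.arr a_X = 0) (hio : ∀ x, s.io x = S.encode.getD x 0)
    (hlen : s.len = S.encode.length) :
    Params n m k (attempt.run s) ∧ Holds S ((attempt.run s).arr a_X) ∧
    (attempt.run s).len = S.encode.length ∧
    (((attempt.run s).var v_found = 1 ∧ ∃ z : Fin n → ZMod 2, k ≤ S.excess z ∧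
      ∀ j : Fin n, (attempt.run s).io j = (z j).val) ∨
    ((attempt.run s).var v_found = 0 ∧ ∀ l, m < 2 ^ l → n ≤ l * k)) := by
  rw [attempt, run_seq, run_seq, run_seq, run_seq]
  have hlen' := hlen.trans (length_encode S)
  obtain ⟨b₁, b₂⟩ := buildMatrix_spec hs h0 hlen'.ge
  have hF₁ := buildMatrix.frame s
  set s₁ := buildMatrix.run s
  have hp₁ := hs.frame hF₁ (by decide)
  have idx : ∀ (i : Fin m) {j}, j < n + 2 → (i : ℕ) * (n + 2) + j < m * (n + 2) := by
    intro i j hj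
    have := Nat.mul_le_mul_right (n + 2) (Nat.succ_le_of_lt i.2)
    rw [Nat.succ_mul] at this
    omega
  have hH : Holds S (s₁.arr a_X) := by
    refine ⟨fun i j => ?_, fun i => ?_, fun i => ?_, b₂⟩
    · rw [b₁ _ (idx i (by omega)), hio, encode_coeff]
    · rw [b₁ _ (idx i (by omega)), hio, encode_rhs]
    · rw [b₁ _ (idx i (by omega)), hio, encode_weight]
  have hsearch : ∀ l, m < 2 ^ l → l * k < n → _ := fun l hl hlk => search_spec hp₁ hH.bits
    (fun i hi j hj he => by
      have := hS.row_injective ((hH.rowOf_eq ⟨i, hi⟩).symm.trans (he.trans (hH.rowOf_eq ⟨j, hj⟩)))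
      simpa using this) (hH.span_eq_top hS) hl hlk
  have hF₂ := search.frame s₁
  set s₂ := search.run s₁
  have hp₂ := hp₁.frame hF₂ (by decide)
  have X₂ : s₂.arr a_X = s₁.arr a_X := hF₂.arr _ (by decide)
  have hbits := majority_bits hp₂
  have hmaj := fun K => majority_spec (K := K) hp₂ (by rw [X₂]; exact hH.bits)
    (fun i hi => by rw [X₂, hH.rowOf_eq ⟨i, hi⟩]; exact hS.row_ne_zero _)
    (fun i hi => by rw [X₂, weightOf, hH.weight ⟨i, hi⟩]; exact S.w_pos _)
    (by rw [X₂]; exact hH.span_eq_top hS)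
    (fun j => by rw [X₂]; exact hH.rowOf_unit j)
    (fun j hj => by rw [X₂]; exact hH.rhsOf_unit hj)
  have hF₃ := majority.frame s₂
  set s₃ := majority.run s₂
  have hp₃ := hp₂.frame hF₃ (by decide)
  have X₃ : s₃.arr a_X = s₁.arr a_X := (hF₃.arr _ (by decide)).trans X₂
  clear_value s₃
  rw [run_assign, eval_const]
  have hp₄ : Params n m k (s₃.setVar v_found 0) := hp₃.setVar (by decide) _
  have l₄ : (s₃.setVar v_found 0).len = s.len := by
    rw [Store.len_setVar, hF₃.len, hF₂.len, hF₁.len]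
  -- Full column rank forces `n ≤ m`, so the assignment fits into the input cells.
  have hmn : n ≤ 2 + m * (n + 2) := by
    have := hS.rank_eq ▸ S.A.rank_le_height
    have := Nat.mul_le_mul_right (n + 2) this
    nlinarith
  have htry := tryAssignment_spec hp₄ (by rw [Store.arr_setVar, X₃]; exact hH.bits) hbits
    (by rw [l₄, hlen']; exact hmn)
  have hF₅ := tryAssignment.frame (s₃.setVar v_found 0)
  set s₅ := tryAssignment.run (s₃.setVar v_found 0)
  have X₅ : s₅.arr a_X = s₁.arr a_X := by rw [hF₅.arr _ (by decide), Store.arr_setVar, X₃]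
  simp only [Store.arr_setVar, X₃, hH.value_eq, Store.var_setVar, if_true] at htry
  refine ⟨hp₄.frame hF₅ (by decide), by rw [X₅]; exact hH, hF₅.len.trans (l₄.trans hlen), ?_⟩
  rcases htry with ⟨hlt, hfd, -⟩ | ⟨hle, hfd, hio'⟩
  · refine .inr ⟨hfd, fun l hl => ?_⟩
    by_contra! hlk
    obtain ⟨hc, K, hK, hKs⟩ := hsearch l hl hlk
    have := hmaj K hc (by rw [X₂]; exact hK) hKs
    rw [X₂, hH.value_eq] at this
    omega
  · exact .inl ⟨hfd, _, hle, fun j => by rw [val_assignmentOf hbits j, hio' j j.2]⟩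

/-- Compute the number of assignments. -/
def power : Stmt :=
  assign v_pow (.const 1) ;; loop v_j v_n (.const 1) (assign v_pow (.var v_pow + .var v_pow))

lemma power_spec (s : Store) : (power.run s).var v_pow = 2 ^ s.var v_n := by
  rw [power, run_seq, run_assign, eval_const]
  have := loop_induct (v := v_j) (b := v_n) (st := .const 1)
    (P := assign v_pow (.var v_pow + .var v_pow)) (s.setVar v_pow 1)
    (fun i t => t.var v_pow = 2 ^ i) (by simp) ?_
  · simpa using this
  · intro i t hi hF ht
    simp [ht, pow_succ, mul_two]

/-- The fallback, if no assignment has been found. -/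
def fallback : Stmt :=
  ifLt (.var v_found) (.const 1) (power ;; exhaust) skip

/-- Find an assignment of excess at least `k`. -/
def solver : Stmt :=
  setup ;; attempt ;; fallback ;; assign v_k (.var v_found)

/-- The initial store on the instance `(x, k)`. -/
def initStore (x : List ℕ) (k : ℕ) : Store where
  var v := if v = 0 then k else 0
  arr _ _ := 0
  io i := x.getD i 0
  len := x.length

lemma represents_initState (x : List ℕ) (k : ℕ) :
    Represents (RAM.initState x k) (initStore x k) where
  var v := by
    have : 2 * v ≠ 1 := by omega
    simp [RAM.initState, initStore, this]
  len := by simp [RAM.initState, initStore]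
  io i hi := rfl
  arr a i := by
    have := lt_address x.length a i
    simp only [RAM.initState, initStore]
    -- Array cells lie beyond the input, where memory is 0 by the default value.
    exact List.getD_eq_default _ _ this.le

/-- The program finds an assignment of excess at least `k`, or reports that there is none. The number
of assignments enters the time only if there are many equations. -/
theorem exec_solver {n m k N : ℕ} {S : LinSystem n m} (hS : S.Irreducible)
    (hN : 2 * m + k + 2 ≤ N) (hpow : (∀ l, m < 2 ^ l → n ≤ l * k) → 2 ^ n ≤ N) :
    ∃ t τ, UExec (solver.compile 0) (RAM.initState S.encode k) t τ ∧ t ≤ solver.time N ∧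
      ((τ.reg 0 = 1 ∧ ∃ z : Fin n → ZMod 2, (k : ℤ) ≤ S.excess z ∧
          ∀ j : Fin n, τ.mem j = (z j).val) ∨
        (τ.reg 0 = 0 ∧ S.maxExcess < (k : ℤ))) := by
  have hnm : n ≤ m := hS.rank_eq ▸ S.A.rank_le_height
  have hnlen : n ≤ S.encode.length := by
    rw [length_encode]
    have := Nat.mul_le_mul_right (n + 2) hnm
    nlinarith
  obtain ⟨s, hs⟩ : ∃ s, initStore S.encode k = s := ⟨_, rfl⟩
  have hR : Represents (RAM.initState S.encode k) s := hs ▸ represents_initState S.encode k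
  have e₁ : Executes N setup s :=
    Protects.executes (p := 0) (by simp [setup, Protects]) (by simp)
  have hp₁ : Params n m k (setup.run s) := setup_spec
    (by simp [← hs, initStore, length_encode]) (by simp [← hs, initStore])
    (by rw [← hs]; exact encode_getD_zero S) (by rw [← hs]; exact encode_getD_one S)
  have hF₁ := setup.frame s
  obtain ⟨s₁, hs₁⟩ : ∃ s₁, setup.run s = s₁ := ⟨_, rfl⟩
  rw [hs₁] at hp₁ hF₁
  have X₁ : s₁.arr a_X = 0 := (hF₁.arr _ (by decide)).trans (by rw [← hs]; rfl)
  have io₁ : ∀ x, s₁.io x = S.encode.getD x 0 := fun x => by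
    rw [hF₁.io (by decide), ← hs]; rfl
  have l₁ : s₁.len = S.encode.length := hF₁.len.trans (by rw [← hs]; rfl)
  -- Since `n ≤ m`, each of the six parameters is at most `2 * m + k + 2`.
  have bound : ∀ {u}, Params n m k u → ∀ v < 6, u.var v ≤ N := by
    intro u hu v hv
    have h₁ := hu.var_k
    have h₂ := hu.var_n
    have h₃ := hu.var_m
    have h₄ := hu.var_width
    have h₅ := hu.var_rows
    have h₆ := hu.var_last
    interval_cases v <;> omega
  have e₂ : Executes N attempt s₁ := by
    refine Protects.executes (p := 6) ?_ (bound hp₁)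
    simp [attempt, buildMatrix, search, copyRows, examineRow, findPivot, checkRow, compareRows,
      process, countMajority, saveRow, eliminate, addRow, majority, extract, tryAssignment, evaluate,
      parity, Protects]
  obtain ⟨hp₂, hH, l₂, hout₂⟩ := attempt_spec hS hp₁ X₁ io₁ l₁
  obtain ⟨s₂, hs₂⟩ : ∃ s₂, attempt.run s₁ = s₂ := ⟨_, rfl⟩
  rw [hs₂] at hp₂ hH l₂ hout₂
  have e₃ : Executes N fallback s₂ ∧ (fallback.run s₂).len = S.encode.length ∧
      (((fallback.run s₂).var v_found = 1 ∧ ∃ z : Fin n → ZMod 2, (k : ℤ) ≤ S.excess z ∧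
        ∀ j : Fin n, (fallback.run s₂).io j = (z j).val) ∨
      ((fallback.run s₂).var v_found = 0 ∧ ∀ z, S.excess z < k)) := by
    rw [fallback, run_ifLt, eval_var, eval_const]
    rcases hout₂ with ⟨h, hout⟩ | ⟨h, hl⟩
    · refine ⟨Executes.ifLt (fun hlt => ?_) fun _ =>
        Protects.executes (P := skip) (p := 0) (by simp [Protects]) (by simp), ?_⟩
      · simp [h] at hlt
      · rw [if_neg (by simp [h]), run_skip]
        exact ⟨l₂, .inl ⟨h, hout⟩⟩
    · rw [if_pos (by simp [h]), run_seq]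
      have hpw := power_spec s₂
      have hF₃ := power.frame s₂
      have e₄ : Executes N power s₂ :=
        Protects.executes (p := 6) (by simp [power, Protects]) (bound hp₂)
      obtain ⟨s₃, hs₃⟩ : ∃ s₃, power.run s₂ = s₃ := ⟨_, rfl⟩
      rw [hs₃] at hpw hF₃ ⊢
      rw [hp₂.var_n] at hpw
      have hp₃ := hp₂.frame hF₃ (by decide)
      have X₃ : s₃.arr a_X = s₂.arr a_X := hF₃.arr _ (by decide)
      have f₃ : s₃.var v_found = 0 := (hF₃.var _ (by decide)).trans h
      have l₃ : s₃.len = S.encode.length := hF₃.len.trans l₂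
      have e₅ : Executes N exhaust s₃ := by
        -- The seventh protected variable is `v_pow = 2 ^ n`, now a loop bound. Only here is `hpow`
        -- used, with the hypothesis supplied by the failed attempt.
        refine Protects.executes (p := 7) ?_ fun v hv => ?_
        · simp [exhaust, tryAssignment, evaluate, parity, increment, Protects]
        · rcases Nat.lt_succ_iff_lt_or_eq.1 hv with hv | rfl
          · exact bound hp₃ v hv
          · rw [hpw]
            exact hpow hl
      refine ⟨Executes.ifLt (fun _ => e₄.seq (hs₃ ▸ e₅)) fun hlt => ?_,
        (exhaust.frame s₃).len.trans l₃, ?_⟩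
      · simp [h] at hlt
      · have := exhaust_spec hp₃ hpw (by rw [X₃]; exact hH.bits) (by rw [l₃]; exact hnlen) f₃
        rw [X₃, Outcome] at this
        simpa only [hH.value_eq, forall_const] using this
  obtain ⟨e₃, l₃, hout₃⟩ := e₃
  have e₄ : Executes N (assign v_k (.var v_found)) (fallback.run s₂) :=
    Protects.executes (p := 0) (by simp [Protects]) (by simp)
  have e : Executes N solver s :=
    e₁.seq (hs₁ ▸ e₂.seq (hs₂ ▸ e₃.seq e₄))
  obtain ⟨t, τ, h₁, h₂, h₃⟩ := e _ hR
  refine ⟨t, τ, h₁, h₂, ?_⟩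
  rw [solver, run_seq, run_seq, run_seq, hs₁, hs₂, run_assign, eval_var] at h₃
  have hv := h₃.var v_k
  rw [Store.var_setVar, if_pos rfl] at hv
  have hio := h₃.io
  rw [Store.len_setVar, Store.io_setVar, l₃] at hio
  rcases hout₃ with ⟨hf, z, hz, hzio⟩ | ⟨hf, hall⟩
  · refine .inl ⟨hv.trans hf, z, hz, fun j => ?_⟩
    rw [hio j (by omega), hzio]
  · refine .inr ⟨hv.trans hf, ?_⟩
    rw [LinSystem.maxExcess, Finset.sup'_lt_iff]
    exact fun z _ => hall z

/-! ### Logarithmic cost of a computation -/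

/-- A bound for the binary lengths of the constants of a program. -/
def constSize : RAM.Prog → ℕ
  | .skip => 0
  | .instr (.const _ c) => Nat.size c
  | .instr _ => 0
  | .seq P Q => constSize P + constSize Q
  | .ifLt _ _ P Q => constSize P + constSize Q
  | .whileLt _ _ P => constSize P

/-- All numbers in the state have at most `B` binary digits. -/
def SizeLE (B : ℕ) (s : RAM.State) : Prop :=
  (∀ i, Nat.size (s.reg i) ≤ B) ∧ ∀ i, Nat.size (s.mem i) ≤ B

lemma SizeLE.setReg {B v : ℕ} {s : RAM.State} (h : SizeLE B s) (d : ℕ) (hv : Nat.size v ≤ B + 1) :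
    SizeLE (B + 1) { s with reg := Function.update s.reg d v } := by
  refine ⟨fun i => ?_, fun i => (h.2 i).trans (Nat.le_succ B)⟩
  rcases eq_or_ne i d with rfl | hi
  · simpa using hv
  · simpa [hi] using (h.1 i).trans (Nat.le_succ B)

lemma size_add_le {a b B : ℕ} (ha : Nat.size a ≤ B) (hb : Nat.size b ≤ B) :
    Nat.size (a + b) ≤ B + 1 := by
  rw [Nat.size_le] at *
  omega

lemma SizeLE.run_instr {B : ℕ} {s : RAM.State} (h : SizeLE B s) (i : RAM.Instr)
    (hi : constSize (.instr i) ≤ B) : SizeLE (B + 1) (i.run s) := by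
  cases i with
  | const d c => exact h.setReg d (Nat.le_succ_of_le hi)
  | add d a b => exact h.setReg d (size_add_le (h.1 a) (h.1 b))
  | sub d a b =>
    exact h.setReg d (((Nat.size_le_size (Nat.sub_le _ _)).trans (h.1 a)).trans (Nat.le_succ B))
  | load d a => exact h.setReg d (Nat.le_succ_of_le (h.2 _))
  | store a b =>
    refine ⟨fun j => (h.1 j).trans (Nat.le_succ B), fun j => ?_⟩
    rcases eq_or_ne j (s.reg a) with rfl | hj
    · simpa [RAM.Instr.run] using (h.1 b).trans (Nat.le_succ B)
    · simpa [RAM.Instr.run, hj] using (h.2 j).trans (Nat.le_succ B)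

lemma cost_log_le {B : ℕ} {s : RAM.State} (h : SizeLE B s) (i : RAM.Instr)
    (hi : constSize (.instr i) ≤ B) : i.cost RAM.logCost s ≤ 1 + 2 * B := by
  cases i with
  | const d c =>
    simp only [RAM.Instr.cost, RAM.logCost, constSize] at *
    omega
  | load d a =>
    have := h.1 a
    have := h.2 (s.reg a)
    simp only [RAM.Instr.cost, RAM.logCost]
    omega
  | add d a b | sub d a b | store a b =>
    have := h.1 a
    have := h.1 b
    simp only [RAM.Instr.cost, RAM.logCost]
    omega

lemma cost_uniform (i : RAM.Instr) (s : RAM.State) : i.cost RAM.uniformCost s = 1 := by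
  cases i <;> rfl

/-- In `t` steps the numbers grow by at most `t` binary digits, which bounds the logarithmic cost
of the computation. -/
theorem exec_logCost {P : RAM.Prog} {s s' : RAM.State} {t : ℕ}
    (h : RAM.Exec RAM.uniformCost P s t s') : ∀ {B : ℕ}, constSize P ≤ B → SizeLE B s →
      ∃ t', RAM.Exec RAM.logCost P s t' s' ∧ t' ≤ t * (1 + 2 * (B + t)) ∧ SizeLE (B + t) s' := by
  have mono : ∀ {B C : ℕ} {s : RAM.State}, SizeLE B s → B ≤ C → SizeLE C s :=
    fun h hBC => ⟨fun i => (h.1 i).trans hBC, fun i => (h.2 i).trans hBC⟩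
  induction h with
  | skip s => exact fun _ hs => ⟨1, .skip s, by omega, mono hs (by omega)⟩
  | instr i s =>
    intro B hc hs
    refine ⟨_, .instr i s, (cost_log_le hs i hc).trans ?_, ?_⟩
    · rw [cost_uniform]; omega
    · rw [cost_uniform]; exact hs.run_instr i hc
  | @seq P Q s s' s'' t t' _ _ ihP ihQ =>
    intro B hc hs
    simp only [constSize] at hc
    obtain ⟨u, hu, hut, hs'⟩ := ihP (by omega) hs
    obtain ⟨v, hv, hvt, hs''⟩ := ihQ (by omega) hs'
    refine ⟨u + v, .seq hu hv, ?_, mono hs'' (by omega)⟩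
    -- Expanding `(t + t') * (1 + 2 * (B + t + t'))` leaves a surplus `2 * t * t'` over the two
    -- separate bounds.
    nlinarith [Nat.zero_le (t * t')]
  | @ifLt_true a b P Q s s' t h _ ih =>
    intro B hc hs
    simp only [constSize] at hc
    obtain ⟨u, hu, hut, hs'⟩ := ih (by omega) hs
    refine ⟨_, .ifLt_true h hu, ?_, mono hs' (by omega)⟩
    have := hs.1 a
    have := hs.1 b
    simp only [RAM.logCost, RAM.uniformCost]
    nlinarith
  | @ifLt_false a b P Q s s' t h _ ih =>
    intro B hc hs
    simp only [constSize] at hc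
    obtain ⟨u, hu, hut, hs'⟩ := ih (by omega) hs
    refine ⟨_, .ifLt_false h hu, ?_, mono hs' (by omega)⟩
    have := hs.1 a
    have := hs.1 b
    simp only [RAM.logCost, RAM.uniformCost]
    nlinarith
  | @whileLt_true a b P s s' s'' t t' h _ _ ihP ihW =>
    intro B hc hs
    obtain ⟨u, hu, hut, hs'⟩ := ihP (by simpa only [constSize] using hc) hs
    obtain ⟨v, hv, hvt, hs''⟩ := ihW (by omega) hs'
    refine ⟨_, .whileLt_true h hu hv, ?_, mono hs'' (by omega)⟩
    have := hs.1 a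
    have := hs.1 b
    simp only [RAM.logCost, RAM.uniformCost]
    nlinarith [Nat.zero_le (t * t')]
  | @whileLt_false a b P s h =>
    intro B hc hs
    refine ⟨_, .whileLt_false h, ?_, mono hs (by omega)⟩
    have := hs.1 a
    have := hs.1 b
    simp only [RAM.logCost, RAM.uniformCost]
    omega

/-! ### The size of an instance -/

lemma length_le_bitSize (x : List ℕ) : x.length ≤ bitSize x := by
  induction x with
  | nil => simp
  | cons a x ih => simp only [bitSize, List.map_cons, List.sum_cons, List.length_cons] at *; omega

lemma size_le_bitSize {x : List ℕ} {a : ℕ} (h : a ∈ x) : Nat.size a ≤ bitSize x :=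
  (Nat.le_succ _).trans (List.le_sum_of_mem (List.mem_map_of_mem (f := fun a => Nat.size a + 1) h))

lemma size_le_self (a : ℕ) : Nat.size a ≤ a :=
  Nat.size_le.2 Nat.lt_two_pow_self

lemma sizeLE_initState (x : List ℕ) (k : ℕ) : SizeLE (k + bitSize x) (RAM.initState x k) := by
  refine ⟨fun i => ?_, fun i => ?_⟩
  · have := size_le_self k
    have := size_le_self x.length
    have := length_le_bitSize x
    simp only [RAM.initState]
    split_ifs
    · omega
    · omega
    · simp
  · simp only [RAM.initState]
    rcases lt_or_ge i x.length with hi | hi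
    · rw [List.getD_eq_getElem _ _ hi]
      exact (size_le_bitSize (List.getElem_mem hi)).trans (Nat.le_add_left _ _)
    · rw [List.getD_eq_default _ _ hi]
      simp

lemma lt_bitSize_encode {n m : ℕ} (S : LinSystem n m) : m + 1 ≤ bitSize S.encode := by
  refine le_trans ?_ (length_le_bitSize _)
  rw [length_encode]
  nlinarith [Nat.zero_le (m * n)]

/-! ### From the search for a solution to the decision problem -/

lemma encode_inj_left {n m n' m' : ℕ} {S : LinSystem n m} {T : LinSystem n' m'}
    (h : S.encode = T.encode) : n = n' ∧ m = m' := by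
  simp only [LinSystem.encode, List.cons.injEq] at h
  exact ⟨h.1, h.2.1⟩

/-- `MaxLinAA` asks for some system with the given encoding, so the decision is well posed for a
given system only if the encoding determines it. -/
lemma encode_injective {n m : ℕ} : Function.Injective (LinSystem.encode (n := n) (m := m)) := by
  rintro S T h
  have hA : S.A = T.A := by
    ext i j
    rw [← ZMod.natCast_zmod_val (S.A i j), ← ZMod.natCast_zmod_val (T.A i j),
      ← encode_coeff S i j, ← encode_coeff T i j, h]
  have hb : S.b = T.b := by
    ext i
    rw [← ZMod.natCast_zmod_val (S.b i), ← ZMod.natCast_zmod_val (T.b i),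
      ← encode_rhs S i, ← encode_rhs T i, h]
  have hw : S.w = T.w := by
    ext i
    rw [← encode_weight S i, ← encode_weight T i, h]
  cases S
  cases T
  simp_all

lemma mem_maxLinAA_iff {n m k : ℕ} (S : LinSystem n m) :
    (S.encode, k) ∈ MaxLinAA ↔ (k : ℤ) ≤ S.maxExcess := by
  refine ⟨?_, fun h => ⟨n, m, S, rfl, h⟩⟩
  rintro ⟨n', m', T, hT, hk⟩
  dsimp only at hT hk
  obtain ⟨rfl, rfl⟩ := encode_inj_left hT
  rwa [encode_injective hT]

/-- The search program already leaves the right answer in `R[0]`; only its cost has to be recounted.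
Its number of steps contributes the exponent `c`, the binary length of the numbers it handles the
exponent `c + 1`. -/
theorem decidableInFPTTime_of_solutionFoundInTime {p : ℕ → ℝ} {g : ℕ → ℕ}
    (h : SolutionFoundInTime p g) : ∃ K, DecidableInFPTTime (SparseInstances p) MaxLinAA
      fun k => g k * (2 * k + 2 * g k + K) := by
  obtain ⟨P, c, hP⟩ := h
  refine ⟨2 * constSize P + 3, P, c + (c + 1), ?_⟩
  rintro x k ⟨n, m, S, hx, hS, hm⟩
  dsimp only at hx
  subst hx
  obtain ⟨t, s, hexec, ht, hs⟩ := hP n m S k hS hm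
  obtain ⟨t', hexec', ht', -⟩ := exec_logCost hexec
    (B := constSize P + (k + bitSize S.encode)) (Nat.le_add_right _ _)
    ⟨fun i => ((sizeLE_initState S.encode k).1 i).trans (Nat.le_add_left _ _),
      fun i => ((sizeLE_initState S.encode k).2 i).trans (Nat.le_add_left _ _)⟩
  refine ⟨t', s, hexec', ht'.trans ?_, ?_⟩
  · have hb := lt_bitSize_encode S
    generalize bitSize S.encode = b at hb ⊢
    have htb : t ≤ g k * b ^ c := ht.trans (Nat.mul_le_mul_left _ (Nat.pow_le_pow_left hb c))
    have h1 : 1 ≤ b ^ (c + 1) := Nat.one_le_pow _ _ (by omega)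
    have h2 : b ^ c ≤ b ^ (c + 1) := Nat.pow_le_pow_right (by omega) (by omega)
    have h3 : b ≤ b ^ (c + 1) := Nat.le_self_pow (by omega) b
    have h4 : g k * b ^ c ≤ g k * b ^ (c + 1) := Nat.mul_le_mul_left _ h2
    -- The constant 3 pays for the summands `1` and `2 * b`; the summand `2 * t` is covered by `2 *
    -- g k`.
    have h5 : 1 + 2 * (constSize P + (k + b) + t) ≤
        (2 * k + 2 * g k + (2 * constSize P + 3)) * b ^ (c + 1) := by
      nlinarith [Nat.mul_le_mul_left (constSize P) h1, Nat.mul_le_mul_left k h1]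
    calc t * (1 + 2 * (constSize P + (k + b) + t))
        ≤ g k * b ^ c * ((2 * k + 2 * g k + (2 * constSize P + 3)) * b ^ (c + 1)) :=
          Nat.mul_le_mul htb h5
      _ = _ := by rw [pow_add b c (c + 1)]; ring
  · rw [mem_maxLinAA_iff]
    rcases hs with ⟨hr, z, hz, -⟩ | ⟨hr, hlt⟩
    · have hk : (k : ℤ) ≤ S.maxExcess := hz.trans (Finset.le_sup' S.excess (Finset.mem_univ z))
      rw [hr, if_pos hk]
    · rw [hr, if_neg (not_le.2 hlt)]

/-! ### The running time of the solver -/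

/-- Take `l = ⌊|p n|⌋ + 1`. The two summands of `l * k` are `⌊|p n|⌋ * k ≤ n / 2` and `k < n / 2`,
whence the factor 2 in the hypotheses. -/
lemma exists_lt_two_pow_of_sublinear {p : ℕ → ℝ} {n m k : ℕ} (hm : (m : ℝ) ≤ (2 : ℝ) ^ p n)
    (hn : 2 * k < n) (hp : ((2 * k : ℕ) : ℝ) * |p n| ≤ n) : ∃ l, m < 2 ^ l ∧ l * k < n := by
  refine ⟨⌊|p n|⌋₊ + 1, ?_, ?_⟩
  · have h1 : (2 : ℝ) ^ p n < 2 ^ ((⌊|p n|⌋₊ + 1 : ℕ) : ℝ) := by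
      refine Real.rpow_lt_rpow_of_exponent_lt one_lt_two ((le_abs_self _).trans_lt ?_)
      exact_mod_cast Nat.lt_floor_add_one |p n|
    rw [Real.rpow_natCast] at h1
    exact_mod_cast hm.trans_lt h1
  · have h1 : (⌊|p n|⌋₊ : ℝ) ≤ |p n| := Nat.floor_le (abs_nonneg _)
    have h2 : ((2 * k * ⌊|p n|⌋₊ : ℕ) : ℝ) ≤ n := by
      push_cast at hp ⊢
      exact (mul_le_mul_of_nonneg_left h1 (by positivity)).trans hp
    have h3 : 2 * k * ⌊|p n|⌋₊ ≤ n := by exact_mod_cast h2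
    nlinarith

/-- For `n` at least `N (2 * k) + 2 * k + 1` the polynomial part succeeds; below that threshold the
number of assignments is bounded in terms of `k`. The threshold appears in the bound but not in the
program. -/
theorem solutionFoundInTime_of_sublinear {p : ℕ → ℝ} {N : ℕ → ℕ}
    (hN : ∀ j n : ℕ, N j ≤ n → (j : ℝ) * |p n| ≤ n) :
    ∃ C c, SolutionFoundInTime p
      fun k => C * (2 ^ (N (2 * k) + 2 * k + 1) + k + 5) ^ c := by
  obtain ⟨C, c, hC⟩ := solver.exists_time_le
  refine ⟨C, c, solver.compile 0, c, fun n m S k hS hm => ?_⟩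
  have hpow : (∀ l, m < 2 ^ l → n ≤ l * k) → 2 ^ n ≤ 2 ^ (N (2 * k) + 2 * k + 1) := fun hl => by
    rcases le_or_gt (N (2 * k) + 2 * k + 1) n with hn | hn
    · obtain ⟨l, hml, hlk⟩ := exists_lt_two_pow_of_sublinear hm (by omega)
        (hN (2 * k) n (by omega))
      exact absurd (hl l hml) (not_le.2 hlk)
    · exact Nat.pow_le_pow_right two_pos hn.le
  show ∃ t τ, _ ∧ t ≤ C * (2 ^ (N (2 * k) + 2 * k + 1) + k + 5) ^ c * (m + 1) ^ c ∧ _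
  generalize 2 ^ (N (2 * k) + 2 * k + 1) = a at hpow ⊢
  obtain ⟨t, τ, hexec, ht, hτ⟩ := exec_solver (N := a + 2 * m + k + 2) (k := k) hS (by omega)
    fun hl => (hpow hl).trans (by omega)
  refine ⟨t, τ, hexec, (ht.trans (hC _)).trans ?_, hτ⟩
  rw [mul_assoc, ← mul_pow]
  refine Nat.mul_le_mul_left _ (Nat.pow_le_pow_left ?_ c)
  nlinarith [Nat.zero_le (a * m), Nat.zero_le (k * m)]

/-! ### Thresholds for sublinearity, and computability of the bounds -/

/-- Here `N` comes from the axiom of choice, so nothing is known about its computability. This is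
the only difference between the plain and the effective version. -/
lemma exists_sublinear_bound {p : ℕ → ℝ} (hp : p =o[Filter.atTop] fun n : ℕ => (n : ℝ)) :
    ∃ N : ℕ → ℕ, ∀ j n : ℕ, N j ≤ n → (j : ℝ) * |p n| ≤ n := by
  suffices h : ∀ j : ℕ, ∃ N, ∀ n, N ≤ n → (j : ℝ) * |p n| ≤ n by
    choose N hN using h
    exact ⟨N, hN⟩
  refine fun j => Filter.eventually_atTop.1 ?_
  -- The shift to `j + 1` covers `j = 0`.
  have hj : (0 : ℝ) < 1 / (j + 1) := by positivity
  filter_upwards [Asymptotics.isLittleO_iff.1 hp hj] with n hn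
  rw [Real.norm_eq_abs, Real.norm_natCast, one_div, inv_mul_eq_div, le_div_iff₀ (by positivity)]
    at hn
  nlinarith [abs_nonneg (p n)]

lemma computable_pow {f g : ℕ → ℕ} (hf : Computable f) (hg : Computable g) :
    Computable fun k => f k ^ g k := by
  have h : Primrec₂ fun a b : ℕ => a ^ b := Primrec₂.unpaired'.1 Nat.Primrec.pow
  exact h.to_comp.comp hf hg

lemma computable_add {f g : ℕ → ℕ} (hf : Computable f) (hg : Computable g) :
    Computable fun k => f k + g k :=
  Primrec.nat_add.to_comp.comp hf hg

lemma computable_mul {f g : ℕ → ℕ} (hf : Computable f) (hg : Computable g) :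
    Computable fun k => f k * g k :=
  Primrec.nat_mul.to_comp.comp hf hg

end MaxLin

open MaxLin

theorem mainTheorem4 (p : ℕ → ℝ) (hp : p =o[Filter.atTop] fun n : ℕ => (n : ℝ)) :
    (IsUniformlyFPTOn (SparseInstances p) MaxLinAA ∧ ∃ g : ℕ → ℕ, SolutionFoundInTime p g) ∧
    (EffectivelySublinear p →
      IsFPTOn (SparseInstances p) MaxLinAA ∧
        ∃ g : ℕ → ℕ, Computable g ∧ SolutionFoundInTime p g) := by
  refine ⟨?_, ?_⟩
  · obtain ⟨N, hN⟩ := exists_sublinear_bound hp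
    obtain ⟨C, c, hg⟩ := solutionFoundInTime_of_sublinear hN
    obtain ⟨K, hf⟩ := decidableInFPTTime_of_solutionFoundInTime hg
    exact ⟨⟨_, hf⟩, _, hg⟩
  · rintro ⟨N, hNc, hN⟩
    obtain ⟨C, c, hg⟩ := solutionFoundInTime_of_sublinear hN
    obtain ⟨K, hf⟩ := decidableInFPTTime_of_solutionFoundInTime hg
    have h2 : Computable fun k : ℕ => 2 * k := computable_mul (Computable.const 2) Computable.id
    have hgc : Computable fun k => C * (2 ^ (N (2 * k) + 2 * k + 1) + k + 5) ^ c :=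
      computable_mul (Computable.const C) (computable_pow (computable_add (computable_add
        (computable_pow (Computable.const 2) (computable_add (computable_add (hNc.comp h2) h2)
          (Computable.const 1))) Computable.id) (Computable.const 5)) (Computable.const c))
    exact ⟨⟨_, computable_mul hgc (computable_add (computable_add h2
      (computable_mul (Computable.const 2) hgc)) (Computable.const K)), hf⟩, _, hgc, hg⟩
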